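/- Let $S$ be a tree on the node set $\{0,\dots,n-1\}$ ($n\ge 1$) and let $r$ be a node of $S$; root $S$ at $r$. For a node $v$ let $S_v$ be the subtree of $S$ consisting of all descendants of $v$ (including $v$). For a descendant $v'$ of $v$ let $S_{v,v'}=S_v\setminus S_{v'}$, and put $S_{v,\epsilon}=S_v$. The center of a nonempty $S_{v,v'}$ is defined as follows. (i) The center of $S_{v,\epsilon}=S_v$ is the smallest node $c\in S_v$ whose removal from $S_v$ leaves only components of size at most $\frac12|S_v|$. (ii) If $v'$ is a node and $(u_0,\dots,u_p)$ is the path in $S$ from $u_0=v$ to $u_p=v'$, the center of $S_{v,v'}$ is $u_i$ for the least index $0\le i<p$ with $|S_{u_{i+1},v'}|\le\frac12|S_{v,v'}|$. The working tree $\mathsf{wt}(S)=\mathsf{wt}(S,r)$ is the rooted tree obtained recursively. Start with the component $S=S_{r,\epsilon}$. Choose the center $c$ of the current component and make it the root of the working tree of that component. Delete $c$, apply the procedure to each connected component that remains, and attach the roots of the resulting working trees to $c$ as its children. **Lemma.** 1. The construction is well defined. For every tree $S$ and root $r$, every component arising in the recursion has a unique center, and the components left after deleting the center are again of the form $S_{u,u'}$.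 The result $\mathsf{wt}(S)$ is a rooted tree on the same node set as $S$, whose root is the center of $S$. 2. $\mathsf{wt}(S)$ has depth $O(\log n)$: there is an absolute constant $C$ such that, for all $n$, $S$ and $r$, every chain of successive child-to-parent links in $\mathsf{wt}(S)$ has at most $C\log n$ links. 3. Any two nodes $u,v$ have a unique least common ancestor $a$ in $\mathsf{wt}(S)$ (a node counts as an ancestor of itself), and $a$ lies on the path from $u$ to $v$ in $S$. 4. $\mathsf{wt}(S)$ can be constructed in log-space. There is a deterministic Turing machine with a two-way read-only input tape, a fixed number of work tapes and a write-only output tape which, given the adjacency matrix of a tree $S$ and a node $r$, halts having output the matrix of the parent relation of $\mathsf{wt}(S,r)$. It uses $O(\log N)$ cells of its work tapes, where $N$ is the length of the input. There is also such a machine whose input is the adjacency matrix of $S$ alone and which outputs the parent relation of $\mathsf{wt}(S,r)$ with $r=0$, the first node. -/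

import Mathlib

namespace WorkingTree

/-! ### Paths, rooted subtrees and centers -/

section Trees

variable {V : Type*}

/-- The node `a` lies on a path from `u` to `v` in `S` (in a tree: on the unique such path). -/
def OnPath (S : SimpleGraph V) (u v a : V) : Prop :=
  ∃ p : S.Walk u v, p.IsPath ∧ a ∈ p.support

/-- In the tree `S` rooted at `r`, the node `v` is an ancestor of `x` (possibly `x` itself),
i.e. `x` is a descendant of `v`. -/
def IsAncestor (S : SimpleGraph V) (r v x : V) : Prop := OnPath S r x v

/-- The node set of `S_{v,w} = S_v \ S_w`, where `S_v` is the set of descendants of `v` in the tree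
`S` rooted at `r`; for `w = none` this is `S_v` itself. -/
def piece (S : SimpleGraph V) (r v : V) (w : Option V) : Set V :=
  {x | IsAncestor S r v x ∧ ∀ w' ∈ w, ¬ IsAncestor S r w' x}

/-- The pair `(v, w)` is admissible for the notation `S_{v,w}`: the node `w`, if present, is a
descendant of `v`. -/
def IsPieceIndex (S : SimpleGraph V) (r v : V) (w : Option V) : Prop :=
  ∀ w' ∈ w, IsAncestor S r v w'

/-- `B` is the node set of a connected component of what remains of the subgraph of `S` induced on
`A` when the node `c` is deleted. -/
def IsComponentAfterRemoval (S : SimpleGraph V) (A : Set V) (c : V) (B : Set V) : Prop :=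
  ∃ K : (S.induce (A \ {c})).ConnectedComponent, B = Subtype.val '' K.supp

/-- `c` is a node of `A` whose removal leaves components of size at most half the size of `A`. -/
def IsBalancedNode (S : SimpleGraph V) (A : Set V) (c : V) : Prop :=
  c ∈ A ∧ ∀ B : Set V, IsComponentAfterRemoval S A c B → 2 * B.ncard ≤ A.ncard

/-- `c` is the center of `S_{v,w}`.
* Without `w`: `c` is the first (in the order of the nodes) among the nodes of `S_v` whose removal
  leaves components of size at most `|S_v| / 2`.
* With a node `w`: if `u_0 = v, u_1, …, u_p = w` is the path from `v` to `w`, then `c = u_i` for the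
  least `i` such that `|S_{u_{i+1},w}| ≤ |S_{v,w}| / 2`. -/
def IsCenter [LinearOrder V] (S : SimpleGraph V) (r v : V) : Option V → V → Prop
  | none, c => IsLeast {x | IsBalancedNode S (piece S r v none) x} c
  | some w, c => ∃ (p : S.Walk v w) (i : ℕ), p.IsPath ∧ c = p.getVert i ∧
      IsLeast {j | j < p.length ∧
        2 * (piece S r (p.getVert (j + 1)) (some w)).ncard ≤ (piece S r v (some w)).ncard} i

/-! ### The recursive construction of the working tree -/

/-- `Stage S r q v w`: the recursive procedure, run on the tree `S` rooted at `r`, is called on the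
component `S_{v,w}`; here `q` is the center of the component which was split just before
(`none` for the first call, which is on all of `S`). -/
inductive Stage [LinearOrder V] (S : SimpleGraph V) (r : V) : Option V → V → Option V → Prop
  | init : Stage S r none r none
  | step {q : Option V} {v : V} {w : Option V} {c v₁ : V} {w₁ : Option V} :
      Stage S r q v w → IsCenter S r v w c → IsPieceIndex S r v₁ w₁ →
      IsComponentAfterRemoval S (piece S r v w) c (piece S r v₁ w₁) →
      Stage S r (some c) v₁ w₁

/-- The parent relation of the working tree of `S` (rooted at `r`): `p` is the parent of `x` if `x`
is the center of one of the components into which the removal of the center `p` split the previous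
component. -/
def Parent [LinearOrder V] (S : SimpleGraph V) (r x p : V) : Prop :=
  ∃ (v : V) (w : Option V), Stage S r (some p) v w ∧ IsCenter S r v w x

/-- The root of the working tree is the center of all of `S`. -/
def IsRoot [LinearOrder V] (S : SimpleGraph V) (r x : V) : Prop := IsCenter S r r none x

end Trees

/-! ### Rooted trees given by a parent relation (`par x p`: the parent of `x` is `p`) -/

section Rooted

variable {V : Type*}

/-- The relation `par` is the parent relation of a rooted tree on all of `V` with root `t`. -/
def IsRootedTree (par : V → V → Prop) (t : V) : Prop :=
  (∀ p, ¬ par t p) ∧ (∀ x, x ≠ t → ∃! p, par x p) ∧ ∀ x, Relation.ReflTransGen par x t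

/-- `a` is a least common ancestor of `u` and `v` (a node counts as an ancestor of itself). -/
def IsLCA (par : V → V → Prop) (u v a : V) : Prop :=
  Relation.ReflTransGen par u a ∧ Relation.ReflTransGen par v a ∧
    ∀ b, Relation.ReflTransGen par u b → Relation.ReflTransGen par v b →
      Relation.ReflTransGen par a b

end Rooted

/-! ### Space-bounded transducers -/

/-- Head moves. -/
inductive Move
  | left | stay | right

/-- The new position of a head on a one-sided tape; at cell `0` a left move has no effect. -/
def Move.apply : Move → ℕ → ℕ
  | .left, i => i - 1
  | .stay, i => i
  | .right, i => i + 1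

/-- What is seen on the input tape: the input word stands between two end markers. -/
inductive InputSymbol (α : Type)
  | leftEnd
  | letter (a : α)
  | rightEnd

/-- Cell `0` holds the left end marker, cells `1, …, |x|` the input word `x`, and cell `|x| + 1`
the right end marker. -/
def inputCell {α : Type} (x : List α) : ℕ → InputSymbol α
  | 0 => .leftEnd
  | i + 1 => match x[i]? with
    | some a => .letter a
    | none => .rightEnd

/-- A deterministic Turing machine with a two-way read-only input tape, finitely many two-way
read-write work tapes and a write-only output tape. In one step it reads the scanned input cell and
the scanned work cells, and either halts (`none`) or changes its state, moves the input head, writes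
on and moves on every work tape, and appends at most one letter to the output. -/
structure Transducer (α β : Type) where
  State : Type
  finite_state : Finite State
  start : State
  Sym : Type
  finite_sym : Finite Sym
  blank : Sym
  tapes : ℕ
  next : State → InputSymbol α → (Fin tapes → Sym) →
    Option (State × Move × (Fin tapes → Sym × Move) × Option β)

namespace Transducer

variable {α β : Type}

/-- Configurations of the machine. -/
structure Cfg (M : Transducer α β) where
  state : M.State
  inputHead : ℕ
  work : Fin M.tapes → ℕ → M.Sym
  workHead : Fin M.tapes → ℕ
  output : List β

/-- The initial configuration. -/
def init (M : Transducer α β) : M.Cfg where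
  state := M.start
  inputHead := 0
  work := fun _ _ => M.blank
  workHead := fun _ => 0
  output := []

/-- One step on the input `x`; `none` if the machine halts. The input head never leaves the input
word and its end markers. -/
def step (M : Transducer α β) (x : List α) (c : M.Cfg) : Option M.Cfg :=
  (M.next c.state (inputCell x c.inputHead) (fun i => c.work i (c.workHead i))).map
    fun (q, m, wr, o) =>
      { state := q
        inputHead := min (m.apply c.inputHead) (x.length + 1)
        work := fun i => Function.update (c.work i) (c.workHead i) (wr i).1
        workHead := fun i => (wr i).2.apply (c.workHead i)
        output := c.output ++ o.toList }

/-- The configuration `c` occurs in the run of the machine on input `x`. -/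
def Occurs (M : Transducer α β) (x : List α) (c : M.Cfg) : Prop :=
  Relation.ReflTransGen (fun c₁ c₂ => M.step x c₁ = some c₂) M.init c

/-- On input `x` the machine halts with output `y`, and throughout the run every work head stays
within the first `s` cells of its tape. -/
def ComputesInSpace (M : Transducer α β) (x : List α) (y : List β) (s : ℕ) : Prop :=
  (∃ c, M.Occurs x c ∧ M.step x c = none ∧ c.output = y) ∧
    ∀ c, M.Occurs x c → ∀ i, c.workHead i < s

end Transducer

/-- The partial map which sends the word `inp d` to the word `out d`, for all `d` with `dom d`, is
computed by a log-space transducer: one machine works for all `d`, and its work space is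
`O(log N)` for inputs of length `N`. -/
def LogspaceComputable {ι α β : Type} (dom : ι → Prop) (inp : ι → List α) (out : ι → List β) :
    Prop :=
  ∃ (M : Transducer α β) (C : ℕ), ∀ d, dom d →
    M.ComputesInSpace (inp d) (out d) (C * (Nat.log 2 (inp d).length + 1))

/-! ### Words encoding relations and trees on the nodes `0, …, n - 1` -/

open Classical in
/-- A subset of `{0, …, n - 1}` as a row of `n` bits, closed by a separator (`none`). -/
noncomputable def encodeRow {n : ℕ} (P : Fin n → Prop) : List (Option Bool) :=
  (List.finRange n).map (fun j => some (decide (P j))) ++ [none]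

/-- A binary relation on `{0, …, n - 1}` as the sequence of the rows of its matrix. -/
noncomputable def encodeRel {n : ℕ} (R : Fin n → Fin n → Prop) : List (Option Bool) :=
  (List.finRange n).flatMap fun i => encodeRow (R i)

/-- A graph together with a chosen node: the adjacency matrix, then the row marking that node. -/
noncomputable def encodePointed {n : ℕ} (S : SimpleGraph (Fin n)) (r : Fin n) :
    List (Option Bool) :=
  encodeRel S.Adj ++ encodeRow (fun x => x = r)

/-- A graph on the nodes `0, …, n - 1`, for some `n`, with a chosen node. -/
structure PointedGraph where
  n : ℕ
  graph : SimpleGraph (Fin n)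
  node : Fin n

end WorkingTree

/-! Combinatorics. Rooting `S` at `r` makes "ancestor" a partial order in which the ancestors of a
node form a chain. Deleting a node `c` from `S_{v,w}`, where `c` lies above `w` if `w` is present,
leaves the part above, `S_{v,c}`, and one part below each child `y` of `c` in the component:
`S_{y,w}` if `w` lies below `y`, and `S_y` otherwise (`IsComponentAfterRemoval.eq_nextPiece`). So
the form `S_{v,w}` is preserved. The pair `(v,w)` is recoverable from the nonempty set
(`IsProper.unique`), and each such set has exactly one center (`IsProper.existsUnique_isCenter`).
Fix a node `x`. The components containing `x` form a chain, obtained by iterating one function on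
triples (previous center, `v`, `w`); this is `trace`. It becomes stationary when `x` is the center,
and the previous center is then the parent of `x` (`parent_iff`). Hence the descendants of `c` in
the working tree are exactly the nodes of the component with center `c` (`reflTransGen_parent_iff`).
Depth: passing to the next component halves the size, except when the new component is a full
subtree split off below a path center. Then `w` disappears, so the next step must halve. The weight
`2 log₂ |S_{v,w}|` plus `1` if `w` is present therefore decreases strictly
(`IsProper.potential_nextOf_lt`). Least common ancestors: the smallest component containing `u` and
`v` has the least common ancestor `a` as its center. If the path from `u` to `v` missed `a`, it
would survive the deletion of `a` inside one component, whose center would be a lower common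
ancestor (`IsLCA.onPath`). Space: since a triple of nodes determines how the recursion continues
towards `x`, no recursion stack is needed, and a loop over a bounded number of registers suffices.
It needs the ancestor relation, which is decided by walking around the forest obtained from `S` by
isolating one node. The step of that walk is injective on pairs (node, pointer), so the walk visits
the whole component without any memory of visited nodes (`reachable_iff_tour`). Machines: registers
with values linear in the input length are stored in binary, side by side, on the tracks of one work
tape. Register programs compile to such machines (`Exec.run`). The class of functions computable by
programs is shown to be closed under case distinction, bounded loops, search and counting, so that
the algorithm itself is written with these closure lemmas only. -/

namespace WorkingTree

/-! ### Machine fragments with one work tape -/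

section Machine

variable {α β : Type} {K : ℕ}

/-- A column of the work tape: one bit for each of `K` tracks. -/
abbrev Column (K : ℕ) := Fin K → Bool

/-- A transducer with one work tape, whose letters are columns of `K` bits. It is used as a part of
a larger machine: halting means passing control to the next part. -/
structure Frag (α β : Type) (K : ℕ) where
  State : Type
  finite_state : Finite State
  start : State
  next : State → InputSymbol α → Option (Column K) →
    Option (State × Move × Option (Column K) × Move × Option β)

/-- The contents of all tapes and the positions of the heads. -/
structure Mem (β : Type) (K : ℕ) where
  pos : ℕ
  tape : ℕ → Option (Column K)
  head : ℕ
  out : List β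

/-- The effect of one action, on an input of length `N`. -/
def Mem.act (m : Mem β K) (N : ℕ) (a : Move × Option (Column K) × Move × Option β) : Mem β K where
  pos := min (a.1.apply m.pos) (N + 1)
  tape := Function.update m.tape m.head a.2.1
  head := a.2.2.1.apply m.head
  out := m.out ++ a.2.2.2.toList

namespace Frag

/-- `F.Run x s q m m'`: started in state `q` with memory `m`, the fragment halts with memory `m'`,
and the work head stays within the first `s` cells. -/
inductive Run (F : Frag α β K) (x : List α) (s : ℕ) : F.State → Mem β K → Mem β K → Prop
  | halt {q : F.State} {m : Mem β K} : m.head < s →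
      F.next q (inputCell x m.pos) (m.tape m.head) = none → Run F x s q m m
  | step {q q' : F.State} {m m' : Mem β K} {a : Move × Option (Column K) × Move × Option β} :
      m.head < s → F.next q (inputCell x m.pos) (m.tape m.head) = some (q', a) →
      Run F x s q' (m.act x.length a) m' → Run F x s q m m'

/-- A fragment as a transducer. -/
def toTransducer (F : Frag α β K) : Transducer α β where
  State := F.State
  finite_state := F.finite_state
  start := F.start
  Sym := Option (Column K)
  finite_sym := inferInstance
  blank := none
  tapes := 1
  next := fun q i w => (F.next q i (w 0)).map fun (q', a) =>
    (q', a.1, fun _ => (a.2.1, a.2.2.1), a.2.2.2)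

/-- The configuration of the transducer with the given state and memory. -/
def cfg (F : Frag α β K) (q : F.State) (m : Mem β K) : F.toTransducer.Cfg where
  state := q
  inputHead := m.pos
  work := fun _ => m.tape
  workHead := fun _ => m.head
  output := m.out

theorem step_cfg (F : Frag α β K) (x : List α) (q : F.State) (m : Mem β K) :
    F.toTransducer.step x (F.cfg q m) =
      (F.next q (inputCell x m.pos) (m.tape m.head)).map
        fun (q', a) => F.cfg q' (m.act x.length a) := by
  simp only [Transducer.step, toTransducer, cfg, Option.map_map]
  rfl

/-- The machine is deterministic, so the configurations that occur are exactly those along the one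
halting run. A single derivation of `Run` thus yields both termination and the space bound. -/
theorem Run.computes {F : Frag α β K} {x : List α} {s : ℕ} {q : F.State} {m m' : Mem β K}
    (h : F.Run x s q m m') :
    (∃ c, Relation.ReflTransGen (fun c₁ c₂ => F.toTransducer.step x c₁ = some c₂) (F.cfg q m) c ∧
      F.toTransducer.step x c = none ∧ c.output = m'.out) ∧
    ∀ c, Relation.ReflTransGen (fun c₁ c₂ => F.toTransducer.step x c₁ = some c₂) (F.cfg q m) c →
      ∀ i, c.workHead i < s := by
  induction h with
  | @halt q m hs e =>
    have hn : F.toTransducer.step x (F.cfg q m) = none := by rw [step_cfg, e]; rfl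
    refine ⟨⟨_, .refl, hn, rfl⟩, fun c hc i => ?_⟩
    rcases hc.cases_head with rfl | ⟨d, hd, -⟩
    · exact hs
    · rw [hn] at hd; cases hd
  | @step q q' m m' a hs e _ ih =>
    have hn : F.toTransducer.step x (F.cfg q m) = some (F.cfg q' (m.act x.length a)) := by
      rw [step_cfg, e]; rfl
    obtain ⟨⟨c, hc, hc'⟩, ih⟩ := ih
    refine ⟨⟨c, .head hn hc, hc'⟩, fun c hc i => ?_⟩
    rcases hc.cases_head with rfl | ⟨d, hd, hdc⟩
    · exact hs
    · rw [hn] at hd; cases hd; exact ih c hdc i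

theorem Run.computesInSpace {F : Frag α β K} {x : List α} {s : ℕ} {m' : Mem β K}
    (h : F.Run x s F.start ⟨0, fun _ => none, 0, []⟩ m') :
    F.toTransducer.ComputesInSpace x m'.out s :=
  h.computes

theorem Run.head_lt {F : Frag α β K} {x : List α} {s : ℕ} {q : F.State} {m m' : Mem β K}
    (h : F.Run x s q m m') : m.head < s := by
  cases h <;> assumption

end Frag

/-- Passing control between fragments costs one such idle step. The bound on the position is needed
because every action clips the input head to the right end marker. -/
theorem Mem.act_idle (m : Mem β K) {N : ℕ} (hm : m.pos ≤ N + 1) :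
    m.act N (.stay, m.tape m.head, .stay, none) = m := by
  cases m
  simp only [Mem.act, Move.apply, Function.update_eq_self, Option.toList_none, List.append_nil,
    Mem.mk.injEq, and_true]
  simpa using hm

/-! ### Sequence, branching and repetition of fragments -/

namespace Frag

/-- One fragment after another. -/
def seq (F G : Frag α β K) : Frag α β K where
  State := F.State ⊕ G.State
  finite_state := by have := F.finite_state; have := G.finite_state; infer_instance
  start := .inl F.start
  next := fun q i c => match q with
    | .inl q => match F.next q i c with
      | some (q', a) => some (.inl q', a)
      | none => some (.inr G.start, .stay, c, .stay, none)
    | .inr q => (G.next q i c).map fun (q', a) => (.inr q', a)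

theorem Run.seq_right {F G : Frag α β K} {x : List α} {s : ℕ} {q : G.State} {m m' : Mem β K}
    (h : G.Run x s q m m') : (F.seq G).Run x s (.inr q) m m' := by
  induction h with
  | halt hs e => exact .halt hs (by simp [seq, e])
  | step hs e _ ih => exact .step hs (by simp only [seq, e]; rfl) ih

theorem Run.seq {F G : Frag α β K} {x : List α} {s : ℕ} {q : F.State} {m₁ m₂ m₃ : Mem β K}
    (h : F.Run x s q m₁ m₂) (h' : G.Run x s G.start m₂ m₃) (hm : m₁.pos ≤ x.length + 1) :
    (F.seq G).Run x s (.inl q) m₁ m₃ := by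
  induction h with
  | @halt q m hs e =>
    refine .step (a := (.stay, m.tape m.head, .stay, none)) (q' := Sum.inr G.start) hs
      (by simp [Frag.seq, e]) ?_
    rw [Mem.act_idle _ hm]
    exact h'.seq_right
  | step hs e _ ih =>
    exact .step hs (by simp only [Frag.seq, e]) (ih h' (min_le_right _ _))

/-- Branching on the scanned column. -/
def ite (P : Option (Column K) → Bool) (F G : Frag α β K) : Frag α β K where
  State := Option (F.State ⊕ G.State)
  finite_state := by have := F.finite_state; have := G.finite_state; infer_instance
  start := none
  next := fun q i c => match q with
    | none => some (some (if P c then .inl F.start else .inr G.start), .stay, c, .stay, none)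
    | some (.inl q) => (F.next q i c).map fun (q', a) => (some (.inl q'), a)
    | some (.inr q) => (G.next q i c).map fun (q', a) => (some (.inr q'), a)

theorem Run.ite_left {P : Option (Column K) → Bool} {F G : Frag α β K} {x : List α} {s : ℕ}
    {q : F.State} {m m' : Mem β K} (h : F.Run x s q m m') :
    (ite P F G).Run x s (some (.inl q)) m m' := by
  induction h with
  | halt hs e => exact .halt hs (by simp [Frag.ite, e])
  | step hs e _ ih => exact .step hs (by simp only [Frag.ite, e]; rfl) ih

theorem Run.ite_right {P : Option (Column K) → Bool} {F G : Frag α β K} {x : List α} {s : ℕ}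
    {q : G.State} {m m' : Mem β K} (h : G.Run x s q m m') :
    (ite P F G).Run x s (some (.inr q)) m m' := by
  induction h with
  | halt hs e => exact .halt hs (by simp [Frag.ite, e])
  | step hs e _ ih => exact .step hs (by simp only [Frag.ite, e]; rfl) ih

theorem Run.ite_true {P : Option (Column K) → Bool} {F G : Frag α β K} {x : List α} {s : ℕ}
    {m m' : Mem β K} (h : F.Run x s F.start m m') (hm : m.pos ≤ x.length + 1)
    (hP : P (m.tape m.head) = true) : (Frag.ite P F G).Run x s (Frag.ite P F G).start m m' := by
  refine .step (q' := some (.inl F.start)) (a := (.stay, m.tape m.head, .stay, none)) h.head_lt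
    (by simp [Frag.ite, hP]) ?_
  rw [Mem.act_idle _ hm]
  exact h.ite_left

theorem Run.ite_false {P : Option (Column K) → Bool} {F G : Frag α β K} {x : List α} {s : ℕ}
    {m m' : Mem β K} (h : G.Run x s G.start m m') (hm : m.pos ≤ x.length + 1)
    (hP : P (m.tape m.head) = false) : (Frag.ite P F G).Run x s (Frag.ite P F G).start m m' := by
  refine .step (q' := some (.inr G.start)) (a := (.stay, m.tape m.head, .stay, none)) h.head_lt
    (by simp [Frag.ite, hP]) ?_
  rw [Mem.act_idle _ hm]
  exact h.ite_right

/-- Repetition of a fragment while a test of the scanned column succeeds. -/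
def loop (P : Option (Column K) → Bool) (F : Frag α β K) : Frag α β K where
  State := Option F.State
  finite_state := by have := F.finite_state; infer_instance
  start := none
  next := fun q i c => match q with
    | none => if P c then some (some F.start, .stay, c, .stay, none) else none
    | some q => match F.next q i c with
      | some (q', a) => some (some q', a)
      | none => some (none, .stay, c, .stay, none)

theorem Run.loop_false {P : Option (Column K) → Bool} {F : Frag α β K} {x : List α} {s : ℕ}
    {m : Mem β K} (hs : m.head < s) (hP : P (m.tape m.head) = false) :
    (Frag.loop P F).Run x s (Frag.loop P F).start m m :=
  .halt hs (by simp [Frag.loop, hP])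

theorem Run.loop_body {P : Option (Column K) → Bool} {F : Frag α β K} {x : List α} {s : ℕ}
    {q : F.State} {m₁ m₂ m₃ : Mem β K} (h : F.Run x s q m₁ m₂)
    (h' : (Frag.loop P F).Run x s none m₂ m₃) (hm : m₁.pos ≤ x.length + 1) :
    (Frag.loop P F).Run x s (some q) m₁ m₃ := by
  induction h with
  | @halt q m hs e =>
    refine .step (a := (.stay, m.tape m.head, .stay, none)) (q' := none) hs
      (by simp [Frag.loop, e]) ?_
    rw [Mem.act_idle _ hm]
    exact h'
  | step hs e _ ih =>
    exact .step hs (by simp only [Frag.loop, e]) (ih h' (min_le_right _ _))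

theorem Run.loop_true {P : Option (Column K) → Bool} {F : Frag α β K} {x : List α} {s : ℕ}
    {m₁ m₂ m₃ : Mem β K} (h : F.Run x s F.start m₁ m₂)
    (h' : (Frag.loop P F).Run x s (Frag.loop P F).start m₂ m₃) (hm : m₁.pos ≤ x.length + 1)
    (hP : P (m₁.tape m₁.head) = true) :
    (Frag.loop P F).Run x s (Frag.loop P F).start m₁ m₃ := by
  refine .step (q' := some F.start) (a := (.stay, m₁.tape m₁.head, .stay, none)) h.head_lt
    (by simp [Frag.loop, hP]) ?_
  rw [Mem.act_idle _ hm]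
  exact h.loop_body h' hm

/-- A single move of the input head and a single output. -/
def once (mv : Move) (o : Option β) : Frag α β K where
  State := Bool
  finite_state := inferInstance
  start := false
  next := fun q _ c => if q then none else some (true, mv, c, .stay, o)

theorem run_once (mv : Move) (o : Option β) {x : List α} {s : ℕ} {m : Mem β K} (hs : m.head < s) :
    (once (α := α) mv o).Run x s (once (α := α) (K := K) mv o).start m
      ⟨min (mv.apply m.pos) (x.length + 1), m.tape, m.head, m.out ++ o.toList⟩ := by
  refine .step (q' := true) (a := (mv, m.tape m.head, .stay, o)) hs (by simp [once]) ?_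
  have : m.act x.length (mv, m.tape m.head, .stay, o) =
      ⟨min (mv.apply m.pos) (x.length + 1), m.tape, m.head, m.out ++ o.toList⟩ := by
    simp [Mem.act, Move.apply]
  rw [this]
  exact .halt hs (by simp [once])

/-- The start of a computation: the first column is written to cell `1`. -/
def boot : Frag α β K where
  State := Fin 3
  finite_state := inferInstance
  start := 0
  next := fun q _ _ => match q with
    | 0 => some (1, .stay, none, .right, none)
    | 1 => some (2, .stay, some fun _ => false, .stay, none)
    | 2 => none

end Frag

/-- The tape whose cells `1, …, ℓ` hold the given columns, and whose other cells are blank. -/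
def mkTape (ℓ : ℕ) (col : ℕ → Column K) : ℕ → Option (Column K)
  | 0 => none
  | j + 1 => if j < ℓ then some (col j) else none

theorem mkTape_congr {ℓ : ℕ} {c d : ℕ → Column K} (h : ∀ j < ℓ, c j = d j) :
    mkTape ℓ c = mkTape ℓ d := by
  funext j
  cases j with
  | zero => rfl
  | succ j =>
    simp only [mkTape]
    split_ifs with hj
    · rw [h j hj]
    · rfl

theorem mkTape_lt {ℓ j : ℕ} (c : ℕ → Column K) (h : j < ℓ) : mkTape ℓ c (j + 1) = some (c j) := by
  simp [mkTape, h]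

theorem update_mkTape {ℓ j : ℕ} (c : ℕ → Column K) (h : j < ℓ) (v : Column K) :
    Function.update (mkTape ℓ c) (j + 1) (some v) = mkTape ℓ (Function.update c j v) := by
  funext i
  cases i with
  | zero => simp [mkTape, Function.update]
  | succ i =>
    by_cases hi : i = j
    · subst hi; simp [mkTape, h]
    · simp [mkTape, Function.update, hi]

/-- Writing on the first blank to the right widens the block; this happens when an increment
overflows. -/
theorem update_mkTape_end {ℓ : ℕ} (c : ℕ → Column K) (v : Column K) :
    Function.update (mkTape ℓ c) (ℓ + 1) (some v) = mkTape (ℓ + 1) (Function.update c ℓ v) := by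
  funext i
  cases i with
  | zero => simp [mkTape, Function.update]
  | succ i =>
    rcases lt_trichotomy i ℓ with hi | hi | hi
    · simp [mkTape, Function.update, hi.ne, hi, hi.trans (Nat.lt_succ_self _)]
    · subst hi; simp [mkTape]
    · simp [mkTape, Function.update, hi.ne', hi.not_gt, (Nat.succ_le_of_lt hi).not_gt]

/-! ### Sweeps of a finite automaton over the work tape -/

namespace Frag

/-- The phases of a sweep over the work tape. -/
inductive Phase
  | fwd | back | last | done

instance : Finite Phase :=
  Finite.of_surjective (fun i : Fin 4 => match i with
    | 0 => Phase.fwd | 1 => .back | 2 => .last | 3 => .done)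
    (fun p => by cases p; exacts [⟨0, rfl⟩, ⟨1, rfl⟩, ⟨2, rfl⟩, ⟨3, rfl⟩])

/-- A finite automaton which runs over all columns from left to right, starting in a state that may
depend on the scanned input letter, and rewrites them. At the right end it may append a column; then
the head returns and the first column is rewritten once more, depending on the last state. -/
def sweep {Q : Type} [Finite Q] (init : InputSymbol α → Q) (δ : Q → Column K → Q × Column K)
    (app : Q → Option (Column K)) (fin : Q → Column K → Column K) : Frag α β K where
  State := Option (Phase × Q)
  finite_state := inferInstance
  start := none
  next := fun q i c => match q, c with
    | none, some c => some (some (.fwd, (δ (init i) c).1), .stay, some (δ (init i) c).2, .right, none)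
    | none, none => none
    | some (.fwd, q), some c => some (some (.fwd, (δ q c).1), .stay, some (δ q c).2, .right, none)
    | some (.fwd, q), none => some (some (.back, q), .stay, app q, .left, none)
    | some (.back, q), some c => some (some (.back, q), .stay, some c, .left, none)
    | some (.back, q), none => some (some (.last, q), .stay, none, .right, none)
    | some (.last, q), some c => some (some (.done, q), .stay, some (fin q c), .stay, none)
    | some (.last, _), none => none
    | some (.done, _), _ => none

section Sweep

variable {Q : Type} [Finite Q] {init : InputSymbol α → Q} {δ : Q → Column K → Q × Column K}
    {app : Q → Option (Column K)} {fin : Q → Column K → Column K}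

/-- The blank cell `0` tells the returning head that it has passed the first column; one move to the
right then brings it there for the final rewriting. -/
theorem run_sweep_back {x : List α} {s p ℓ : ℕ} (hp : p ≤ x.length + 1) (hℓ : ℓ < s) (h0 : 0 < ℓ)
    {c d : ℕ → Column K} (q : Q) (hd : ∀ j, d j = if j = 0 then fin q (c j) else c j) (o : List β) :
    ∀ h ≤ ℓ, (sweep (β := β) init δ app fin).Run x s (some (.back, q)) ⟨p, mkTape ℓ c, h, o⟩
      ⟨p, mkTape ℓ d, 1, o⟩ := by
  intro h
  induction h with
  | zero =>
    intro _
    refine .step (q' := some (.last, q)) (a := (.stay, none, .right, none)) (by simp; omega)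
      (by simp [sweep, mkTape]) ?_
    have e1 : Mem.act (⟨p, mkTape ℓ c, 0, o⟩ : Mem β K) x.length (.stay, none, .right, none) =
        ⟨p, mkTape ℓ c, 1, o⟩ := by
      have : Function.update (mkTape ℓ c) 0 none = mkTape ℓ c :=
        Function.update_eq_self (f := mkTape ℓ c) 0
      simp [Mem.act, Move.apply, hp, this]
    rw [e1]
    refine .step (q' := some (.done, q)) (a := (.stay, some (fin q (c 0)), .stay, none))
      (by simp; omega) (by simp [sweep, mkTape_lt c h0]) ?_
    have e2 : Mem.act (⟨p, mkTape ℓ c, 1, o⟩ : Mem β K) x.length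
        (.stay, some (fin q (c 0)), .stay, none) = ⟨p, mkTape ℓ d, 1, o⟩ := by
      have : Function.update (mkTape ℓ c) 1 (some (fin q (c 0))) = mkTape ℓ d := by
        rw [update_mkTape c h0]
        refine mkTape_congr fun j _ => ?_
        by_cases hj : j = 0
        · subst hj; simp [hd]
        · simp [hd, hj]
      simp [Mem.act, Move.apply, hp, this]
    rw [e2]
    exact .halt (by simp; omega) (by simp [sweep])
  | succ h ih =>
    intro hh
    refine .step (q' := some (.back, q)) (a := (.stay, some (c h), .left, none)) (by simp; omega)
      (by simp [sweep, mkTape_lt c hh]) ?_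
    have e1 : Mem.act (⟨p, mkTape ℓ c, h + 1, o⟩ : Mem β K) x.length
        (.stay, some (c h), .left, none) = ⟨p, mkTape ℓ c, h, o⟩ := by
      simp [Mem.act, Move.apply, hp, update_mkTape c hh]
    rw [e1]
    exact ih (by omega)

/-- Induction on the number `k` of columns still to be read. On the way the tape holds the hybrid
`b`: rewritten columns `c'` to the left of the head, old columns `c` from the head on. -/
theorem run_sweep_fwd {x : List α} {s p ℓ ℓ' : ℕ} (hp : p ≤ x.length + 1) (hs : ℓ + 1 < s)
    (h0 : 0 < ℓ) {c c' d : ℕ → Column K} {q : ℕ → Q}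
    (hq : ∀ j < ℓ, δ (q j) (c j) = (q (j + 1), c' j))
    (hend : (app (q ℓ) = none ∧ ℓ' = ℓ) ∨ (app (q ℓ) = some (c' ℓ) ∧ ℓ' = ℓ + 1))
    (hd : ∀ j, d j = if j = 0 then fin (q ℓ) (c' j) else c' j) (o : List β) :
    ∀ k j, j + k = ℓ → ∀ b : ℕ → Column K, (∀ i, b i = if i < j then c' i else c i) →
      (sweep (β := β) init δ app fin).Run x s (some (.fwd, q j)) ⟨p, mkTape ℓ b, j + 1, o⟩
      ⟨p, mkTape ℓ' d, 1, o⟩ := by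
  intro k
  induction k with
  | zero =>
    intro j hj b hb
    obtain rfl : j = ℓ := by simpa using hj
    have hbt : mkTape j b (j + 1) = none := by simp [mkTape]
    refine .step (q' := some (.back, q j)) (a := (.stay, app (q j), .left, none)) (by simpa using hs)
      (by simp [sweep, hbt]) ?_
    rcases hend with ⟨ha, rfl⟩ | ⟨ha, rfl⟩
    · have e1 : Mem.act (⟨p, mkTape ℓ' b, ℓ' + 1, o⟩ : Mem β K) x.length
          (.stay, app (q ℓ'), .left, none) = ⟨p, mkTape ℓ' c', ℓ', o⟩ := by
        have h2 : mkTape ℓ' b = mkTape ℓ' c' := mkTape_congr fun i hi => by simp [hb, hi]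
        simp [Mem.act, Move.apply, hp, ha, ← h2, hbt]
      rw [e1]
      exact run_sweep_back hp (by omega) h0 _ hd o _ le_rfl
    · have e1 : Mem.act (⟨p, mkTape j b, j + 1, o⟩ : Mem β K) x.length
          (.stay, app (q j), .left, none) = ⟨p, mkTape (j + 1) c', j, o⟩ := by
        have h2 : mkTape (j + 1) (Function.update b j (c' j)) = mkTape (j + 1) c' :=
          mkTape_congr fun i hi => by
            by_cases hij : i = j
            · subst hij; simp
            · have : i < j := by omega
              simp [hij, hb, this]
        simp [Mem.act, Move.apply, hp, ha, update_mkTape_end, h2]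
      rw [e1]
      exact run_sweep_back hp (by omega) (by omega) _ hd o _ (by omega)
  | succ k ih =>
    intro j hj b hb
    have hjℓ : j < ℓ := by omega
    have hbj : b j = c j := by simp [hb]
    refine .step (q' := some (.fwd, q (j + 1))) (a := (.stay, some (c' j), .right, none))
      (by simp; omega) (by simp [sweep, mkTape_lt b hjℓ, hbj, hq j hjℓ]) ?_
    have e1 : Mem.act (⟨p, mkTape ℓ b, j + 1, o⟩ : Mem β K) x.length
        (.stay, some (c' j), .right, none) =
        ⟨p, mkTape ℓ (Function.update b j (c' j)), j + 1 + 1, o⟩ := by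
      simp [Mem.act, Move.apply, hp, update_mkTape b hjℓ]
    rw [e1]
    refine ih (j + 1) (by omega) _ fun i => ?_
    by_cases hij : i = j
    · subst hij; simp
    · have : i < j + 1 ↔ i < j := by omega
      simp [hij, hb, this]

/-- Here `c` is the tape before the sweep, `c'` after the forward pass and `d` after the last
rewriting of column `0`; `q j` is the state of the automaton before column `j`. The first column is
treated apart, since there the initial state is taken from the scanned input letter. -/
theorem run_sweep {x : List α} {s p ℓ ℓ' : ℕ} (hp : p ≤ x.length + 1) (hs : ℓ + 1 < s)
    (h0 : 0 < ℓ) {c c' d : ℕ → Column K} {q : ℕ → Q} (hq0 : q 0 = init (inputCell x p))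
    (hq : ∀ j < ℓ, δ (q j) (c j) = (q (j + 1), c' j))
    (hend : (app (q ℓ) = none ∧ ℓ' = ℓ) ∨ (app (q ℓ) = some (c' ℓ) ∧ ℓ' = ℓ + 1))
    (hd : ∀ j, d j = if j = 0 then fin (q ℓ) (c' j) else c' j) (o : List β) :
    (sweep (β := β) init δ app fin).Run x s (sweep (β := β) init δ app fin).start
      ⟨p, mkTape ℓ c, 1, o⟩ ⟨p, mkTape ℓ' d, 1, o⟩ := by
  refine .step (q' := some (.fwd, q 1)) (a := (.stay, some (c' 0), .right, none))
    (by simp; omega) (by simp [sweep, mkTape_lt c h0, ← hq0, hq 0 h0]) ?_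
  have e1 : Mem.act (⟨p, mkTape ℓ c, 1, o⟩ : Mem β K) x.length
      (.stay, some (c' 0), .right, none) =
      ⟨p, mkTape ℓ (Function.update c 0 (c' 0)), 1 + 1, o⟩ := by
    have := update_mkTape c h0 (c' 0)
    simp only [zero_add] at this
    simp [Mem.act, Move.apply, hp, this]
  rw [e1]
  refine run_sweep_fwd hp hs h0 hq hend hd o (ℓ - 1) 1 (by omega) _ fun i => ?_
  by_cases hi : i = 0
  · subst hi; simp
  · simp [hi]

end Sweep

end Frag

end Machine

/-! ### Register programs -/

section Programs

variable {α β : Type}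

/-- Programs over registers which hold natural numbers. Branching and repetition test the lowest bit
of a register. -/
inductive Prog (α β : Type)
  | copy (i j : ℕ)
  | inc (i : ℕ)
  | eq (b i j : ℕ)
  | look (P : InputSymbol α → Bool) (b : ℕ)
  | move (mv : Move)
  | emit (o : β)
  | seq (p q : Prog α β)
  | ite (i : ℕ) (p q : Prog α β)
  | loop (i : ℕ) (p : Prog α β)

/-- The state of a program: registers, position of the input head and output. -/
structure St (β : Type) where
  reg : ℕ → ℕ
  pos : ℕ
  out : List β

/-- Assignment to a register. -/
def St.set (s : St β) (i v : ℕ) : St β := { s with reg := Function.update s.reg i v }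

/-- The bound on register contents, for inputs of length `N`. -/
def regBound (N : ℕ) : ℕ := 2 * N + 2

/-- `Exec x p s t`: on input `x`, started in state `s`, the program `p` halts in state `t`, and it
never increments a register beyond the bound. -/
inductive Exec (x : List α) : Prog α β → St β → St β → Prop
  | copy (i j : ℕ) (s : St β) : Exec x (.copy i j) s (s.set i (s.reg j))
  | inc (i : ℕ) (s : St β) : s.reg i + 1 ≤ regBound x.length →
      Exec x (.inc i) s (s.set i (s.reg i + 1))
  | eq (b i j : ℕ) (s : St β) : Exec x (.eq b i j) s (s.set b (if s.reg i = s.reg j then 1 else 0))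
  | look (P : InputSymbol α → Bool) (b : ℕ) (s : St β) :
      Exec x (.look P b) s (s.set b (if P (inputCell x s.pos) then 1 else 0))
  | move (mv : Move) (s : St β) :
      Exec x (.move mv) s { s with pos := min (mv.apply s.pos) (x.length + 1) }
  | emit (o : β) (s : St β) : Exec x (.emit o) s { s with out := s.out ++ [o] }
  | seq {p q : Prog α β} {s t u : St β} : Exec x p s t → Exec x q t u → Exec x (.seq p q) s u
  | ite_true {i : ℕ} {p q : Prog α β} {s t : St β} : (s.reg i).testBit 0 = true → Exec x p s t →
      Exec x (.ite i p q) s t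
  | ite_false {i : ℕ} {p q : Prog α β} {s t : St β} : (s.reg i).testBit 0 = false → Exec x q s t →
      Exec x (.ite i p q) s t
  | loop_true {i : ℕ} {p : Prog α β} {s t u : St β} : (s.reg i).testBit 0 = true → Exec x p s t →
      Exec x (.loop i p) t u → Exec x (.loop i p) s u
  | loop_false {i : ℕ} {p : Prog α β} {s : St β} : (s.reg i).testBit 0 = false →
      Exec x (.loop i p) s s

/-- All registers of a program have numbers below this bound. -/
def Prog.bound : Prog α β → ℕ
  | .copy i j => max (i + 1) (j + 1)
  | .inc i => i + 1
  | .eq b i j => max (b + 1) (max (i + 1) (j + 1))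
  | .look _ b => b + 1
  | .move _ => 0
  | .emit _ => 0
  | .seq p q => max p.bound q.bound
  | .ite i p q => max (i + 1) (max p.bound q.bound)
  | .loop i p => max (i + 1) p.bound

/-- The bit of a column in track `i`. -/
def Column.get {K : ℕ} (c : Column K) (i : ℕ) : Bool := if h : i < K then c ⟨i, h⟩ else false

/-- A column with the bit in track `i` replaced. -/
def Column.put {K : ℕ} (c : Column K) (i : ℕ) (v : Bool) : Column K :=
  fun k => if k.1 = i then v else c k

/-- The program as a machine fragment with `K` registers. -/
def Prog.compile (K : ℕ) : Prog α β → Frag α β K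
  | .copy i j => .sweep (Q := Unit) (fun _ => ()) (fun _ c => ((), Column.put c i (Column.get c j)))
      (fun _ => none) (fun _ c => c)
  | .inc i => .sweep (Q := Bool) (fun _ => true)
      (fun q c => (q && Column.get c i, Column.put c i (Column.get c i != q)))
      (fun q => if q then some (Column.put (fun _ => false) i true) else none) (fun _ c => c)
  | .eq b i j => .sweep (Q := Bool) (fun _ => true)
      (fun q c => (q && (Column.get c i == Column.get c j), Column.put c b false))
      (fun _ => none) (fun q c => Column.put c b q)
  | .look P b => .sweep (Q := Bool) P (fun q c => (q, Column.put c b false))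
      (fun _ => none) (fun q c => Column.put c b q)
  | .move mv => .once mv none
  | .emit o => .once .stay (some o)
  | .seq p q => .seq (p.compile K) (q.compile K)
  | .ite i p q => .ite (fun c => c.any fun c => Column.get c i) (p.compile K) (q.compile K)
  | .loop i p => .loop (fun c => c.any fun c => Column.get c i) (p.compile K)

/-! ### Correctness of the compilation of register programs -/

variable {K : ℕ}

/-- The columns which hold the given register contents in binary. -/
def columns (K : ℕ) (reg : ℕ → ℕ) (j : ℕ) : Column K := fun k => (reg k.1).testBit j

theorem columns_get {reg : ℕ → ℕ} {i j : ℕ} (h : i < K) :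
    Column.get (columns K reg j) i = (reg i).testBit j := by
  simp [Column.get, columns, h]

theorem columns_update (reg : ℕ → ℕ) (i n j : ℕ) :
    columns K (Function.update reg i n) j = Column.put (columns K reg j) i (n.testBit j) := by
  funext k
  by_cases h : k.1 = i
  · simp [columns, Column.put, h]
  · simp [columns, Column.put, h, Function.update]

/-- The number of cells used to hold numbers up to the bound. -/
def regWidth (N : ℕ) : ℕ := Nat.log 2 (regBound N) + 1

theorem regBound_lt (N : ℕ) : regBound N < 2 ^ regWidth N :=
  Nat.lt_pow_succ_log_self (by norm_num) _

/-- The memory represents the state of a program on inputs of length `N`. -/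
structure Represents (N : ℕ) (s : St β) (m : Mem β K) (ℓ : ℕ) : Prop where
  pos_le : m.pos ≤ N + 1
  pos_eq : m.pos = s.pos
  out_eq : m.out = s.out
  head_eq : m.head = 1
  tape_eq : m.tape = mkTape ℓ (columns K s.reg)
  width_pos : 0 < ℓ
  width_le : ℓ ≤ regWidth N
  reg_lt : ∀ i < K, s.reg i < 2 ^ ℓ

theorem Represents.eq {N : ℕ} {s : St β} {m : Mem β K} {ℓ : ℕ} (h : Represents N s m ℓ) :
    m = ⟨s.pos, mkTape ℓ (columns K s.reg), 1, s.out⟩ := by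
  obtain ⟨-, h2, h3, h4, h5, -⟩ := h
  cases m
  simp_all

/-- The carry reaches bit `j` exactly if all lower bits are `1`. This condition is the state of the
automaton for increments. -/
theorem testBit_succ_eq (n j : ℕ) :
    (n + 1).testBit j = (n.testBit j != decide (∀ i < j, n.testBit i = true)) := by
  induction j generalizing n with
  | zero =>
    simp only [Nat.testBit_zero, not_lt_zero, false_imp_iff, implies_true, decide_true]
    rcases Nat.mod_two_eq_zero_or_one n with h | h
    · have : (n + 1) % 2 = 1 := by omega
      simp [h, this]
    · have : (n + 1) % 2 = 0 := by omega
      simp [h, this]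
  | succ j ih =>
    rw [Nat.testBit_succ, Nat.testBit_succ]
    rcases Nat.mod_two_eq_zero_or_one n with h | h
    · have h1 : (n + 1) / 2 = n / 2 := by omega
      have h2 : ¬ ∀ i < j + 1, n.testBit i = true := by
        intro h'
        have := h' 0 (by omega)
        simp [Nat.testBit_zero, h] at this
      rw [h1, decide_eq_false h2]
      simp
    · have h1 : (n + 1) / 2 = n / 2 + 1 := by omega
      rw [h1, ih]
      congr 2
      refine propext ⟨fun H i hi => ?_, fun H i hi => ?_⟩
      · cases i with
        | zero => simp [Nat.testBit_zero, h]
        | succ i => rw [Nat.testBit_succ]; exact H i (by omega)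
      · rw [← Nat.testBit_succ]; exact H _ (by omega)

/-- If the carry runs off the end of the block, the new value is large enough to require the extra
column; this keeps the width below that of the register bound. -/
theorem two_pow_le_succ {n ℓ : ℕ} (h : ∀ i < ℓ, n.testBit i = true) : 2 ^ ℓ ≤ n + 1 := by
  induction ℓ generalizing n with
  | zero => simp
  | succ ℓ ih =>
    have h0 := h 0 (by omega)
    have := ih (n := n / 2) fun i hi => by rw [← Nat.testBit_succ]; exact h _ (by omega)
    simp only [Nat.testBit_zero, decide_eq_true_eq] at h0
    rw [pow_succ]
    omega

theorem eq_iff_testBit {a b ℓ : ℕ} (ha : a < 2 ^ ℓ) (hb : b < 2 ^ ℓ) :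
    a = b ↔ ∀ i < ℓ, a.testBit i = b.testBit i := by
  refine ⟨fun h i _ => by rw [h], fun h => Nat.eq_of_testBit_eq fun i => ?_⟩
  by_cases hi : i < ℓ
  · exact h i hi
  · have : 2 ^ ℓ ≤ 2 ^ i := Nat.pow_le_pow_right (by norm_num) (by omega)
    rw [Nat.testBit_lt_two_pow (by omega), Nat.testBit_lt_two_pow (by omega)]

theorem decide_forall_lt_succ (P : ℕ → Prop) [DecidablePred P] (j : ℕ)
    [Decidable (∀ i < j, P i)] [Decidable (∀ i < j + 1, P i)] :
    decide (∀ i < j + 1, P i) = (decide (∀ i < j, P i) && decide (P j)) := by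
  rw [← Bool.decide_and]
  congr 1
  refine propext ⟨fun h => ⟨fun i hi => h i (by omega), h j (by omega)⟩, fun h i hi => ?_⟩
  rcases Nat.lt_succ_iff_lt_or_eq.1 hi with h1 | rfl
  exacts [h.1 i h1, h.2]

theorem testBit_ite (P : Prop) [Decidable P] (j : ℕ) :
    (if P then 1 else 0 : ℕ).testBit j = (decide (j = 0) && decide P) := by
  by_cases hP : P
  · cases j <;> simp [hP, Nat.testBit_succ]
  · simp [hP]

theorem put_put (c : Column K) (i : ℕ) (v w : Bool) :
    Column.put (Column.put c i v) i w = Column.put c i w := by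
  funext k
  by_cases h : k.1 = i <;> simp [Column.put, h]

theorem Represents.set {N : ℕ} {s : St β} {m : Mem β K} {ℓ ℓ' : ℕ} (h : Represents N s m ℓ)
    (i v : ℕ) (hℓ : ℓ ≤ ℓ') (hℓ' : ℓ' ≤ regWidth N) (hv : v < 2 ^ ℓ') :
    Represents N (s.set i v)
      (⟨s.pos, mkTape ℓ' (columns K (s.set i v).reg), 1, s.out⟩ : Mem β K) ℓ' where
  pos_le := h.pos_eq ▸ h.pos_le
  pos_eq := rfl
  out_eq := rfl
  head_eq := rfl
  tape_eq := rfl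
  width_pos := h.width_pos.trans_le hℓ
  width_le := hℓ'
  reg_lt := fun k hk => by
    by_cases hki : k = i
    · subst hki; simpa [St.set] using hv
    · simpa [St.set, hki] using (h.reg_lt k hk).trans_le (Nat.pow_le_pow_right (by norm_num) hℓ)

/-- Each instruction on registers is one sweep, and the control structure carries over literally.
The width `ℓ` of the block may grow, but stays at most `regWidth`. The two further cells are the
blank cell `0` and the blank to the right of the block, which the head must reach to notice its end.
-/
theorem Exec.run {x : List α} {p : Prog α β} {s t : St β} (h : Exec x p s t) (hK : p.bound ≤ K)
    {m : Mem β K} {ℓ : ℕ} (hm : Represents x.length s m ℓ) :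
    ∃ m' ℓ', Represents x.length t m' ℓ' ∧
      (p.compile K).Run x (regWidth x.length + 2) (p.compile K).start m m' := by
  have hbit : ∀ {s : St β} {m : Mem β K} {ℓ i : ℕ}, Represents x.length s m ℓ → i < K →
      ((m.tape m.head).any fun c => Column.get c i) = (s.reg i).testBit 0 := by
    intro s m ℓ i hm hi
    rw [hm.head_eq, hm.tape_eq, mkTape_lt _ hm.width_pos]
    simp [columns_get hi]
  induction h generalizing m ℓ with
  | copy i j s =>
    have hj : j < K := by simp only [Prog.bound] at hK; omega
    refine ⟨_, ℓ, hm.set i _ le_rfl hm.width_le (hm.reg_lt j hj), ?_⟩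
    have hp := hm.pos_le
    rw [hm.eq] at hp ⊢
    refine Frag.run_sweep (q := fun _ => ()) (c' := columns K (s.set i (s.reg j)).reg) hp
      (by have := hm.width_le; omega) hm.width_pos rfl (fun k _ => ?_) (.inl ⟨rfl, rfl⟩)
      (by simp) _
    simp only [St.set, columns_update, columns_get hj]
  | inc i s hb =>
    have hi : i < K := by simp only [Prog.bound] at hK; omega
    have hlt := hm.reg_lt i hi
    have hw := (hb.trans_lt (regBound_lt _))
    have hp := hm.pos_le
    -- All bits are `1` exactly when the carry overflows and a column must be appended.
    by_cases hall : ∀ k < ℓ, (s.reg i).testBit k = true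
    · have hle := two_pow_le_succ hall
      have hℓ : ℓ + 1 ≤ regWidth x.length := by
        have : 2 ^ ℓ < 2 ^ regWidth x.length := by omega
        exact (Nat.pow_lt_pow_iff_right (by norm_num)).1 this
      refine ⟨_, ℓ + 1, hm.set i _ (by omega) hℓ (by rw [pow_succ]; omega), ?_⟩
      rw [hm.eq] at hp ⊢
      refine Frag.run_sweep (q := fun k => decide (∀ i' < k, (s.reg i).testBit i' = true))
        (c' := columns K (s.set i (s.reg i + 1)).reg) hp
        (by omega) hm.width_pos (by simp) (fun k _ => ?_) (.inr ⟨?_, rfl⟩) (by simp) _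
      · simp only [St.set, columns_update, columns_get hi, testBit_succ_eq, decide_forall_lt_succ,
          Bool.decide_eq_true]
      · have : ∀ k : Fin K, k.1 ≠ i → (s.reg k.1).testBit ℓ = false := fun k _ =>
          Nat.testBit_lt_two_pow (hm.reg_lt k.1 k.2)
        simp only [decide_eq_true hall, if_true, Option.some.injEq]
        have e : (s.reg i + 1).testBit ℓ = true := by
          rw [testBit_succ_eq, Nat.testBit_lt_two_pow hlt]; simpa using hall
        funext k
        by_cases hk : k.1 = i
        · simp [St.set, columns_update, Column.put, hk, e]
        · simp [St.set, Column.put, hk, columns, this k hk]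
    · have hlt' : s.reg i + 1 < 2 ^ ℓ := by
        by_contra hcon
        have e : s.reg i = 2 ^ ℓ - 1 := by omega
        exact hall fun k hk => by rw [e, Nat.testBit_two_pow_sub_one]; simpa using hk
      refine ⟨_, ℓ, hm.set i _ le_rfl hm.width_le hlt', ?_⟩
      have := hm.width_le
      rw [hm.eq] at hp ⊢
      refine Frag.run_sweep (q := fun k => decide (∀ i' < k, (s.reg i).testBit i' = true))
        (c' := columns K (s.set i (s.reg i + 1)).reg) hp
        (by omega) hm.width_pos (by simp) (fun k _ => ?_) (.inl ⟨?_, rfl⟩) (by simp) _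
      · simp only [St.set, columns_update, columns_get hi, testBit_succ_eq, decide_forall_lt_succ,
          Bool.decide_eq_true]
      · simp only [decide_eq_false hall]; rfl
  | eq b i j s =>
    have hi : i < K := by simp only [Prog.bound] at hK; omega
    have hj : j < K := by simp only [Prog.bound] at hK; omega
    have h1 : 1 < 2 ^ ℓ := Nat.one_lt_two_pow hm.width_pos.ne'
    refine ⟨_, ℓ, hm.set b _ le_rfl hm.width_le (by split_ifs <;> omega), ?_⟩
    have hp := hm.pos_le
    have := hm.width_le
    rw [hm.eq] at hp ⊢
    -- The forward pass clears register `b` while comparing; the verdict is put into the lowest bit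
    -- at the end. As each column is read before it is rewritten, `b` may coincide with `i` or `j`.
    refine Frag.run_sweep
      (q := fun k => decide (∀ i' < k, (s.reg i).testBit i' = (s.reg j).testBit i'))
      (c' := fun k => Column.put (columns K s.reg k) b false) hp
      (by omega) hm.width_pos (by simp) (fun k _ => ?_) (.inl ⟨rfl, rfl⟩) (fun k => ?_) _
    · simp only [columns_get hi, columns_get hj, decide_forall_lt_succ, Bool.beq_eq_decide_eq]
    · simp only [← eq_iff_testBit (hm.reg_lt i hi) (hm.reg_lt j hj), St.set, columns_update, testBit_ite, put_put]
      by_cases hk : k = 0 <;> simp [hk]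
  | look P b s =>
    have h1 : 1 < 2 ^ ℓ := Nat.one_lt_two_pow hm.width_pos.ne'
    refine ⟨_, ℓ, hm.set b _ le_rfl hm.width_le (by split_ifs <;> omega), ?_⟩
    have hp := hm.pos_le
    have := hm.width_le
    rw [hm.eq] at hp ⊢
    refine Frag.run_sweep (q := fun _ => P (inputCell x s.pos))
      (c' := fun k => Column.put (columns K s.reg k) b false) hp
      (by omega) hm.width_pos ?_ (fun k _ => ?_) (.inl ⟨?_, rfl⟩) (fun k => ?_) _
    any_goals rfl
    simp only [St.set, columns_update, testBit_ite, put_put]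
    by_cases hk : k = 0 <;> simp [hk]
  | move mv s =>
    refine ⟨_, ℓ, ?_, Frag.run_once mv none (by rw [hm.head_eq]; omega)⟩
    exact ⟨min_le_right _ _, by rw [hm.pos_eq], by simp [hm.out_eq], hm.head_eq, hm.tape_eq,
      hm.width_pos, hm.width_le, hm.reg_lt⟩
  | emit o s =>
    refine ⟨_, ℓ, ?_, Frag.run_once .stay (some o) (by rw [hm.head_eq]; omega)⟩
    exact ⟨min_le_right _ _, by simpa [Move.apply, ← hm.pos_eq] using hm.pos_le,
      by simp [hm.out_eq], hm.head_eq, hm.tape_eq, hm.width_pos, hm.width_le, hm.reg_lt⟩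
  | seq _ _ ih1 ih2 =>
    simp only [Prog.bound, max_le_iff] at hK
    obtain ⟨m₁, ℓ₁, h1, r1⟩ := ih1 hK.1 hm
    obtain ⟨m₂, ℓ₂, h2, r2⟩ := ih2 hK.2 h1
    exact ⟨m₂, ℓ₂, h2, r1.seq r2 hm.pos_le⟩
  | ite_true hb _ ih =>
    simp only [Prog.bound, max_le_iff] at hK
    obtain ⟨m₁, ℓ₁, h1, r1⟩ := ih hK.2.1 hm
    exact ⟨m₁, ℓ₁, h1, r1.ite_true hm.pos_le ((hbit hm hK.1).trans hb)⟩
  | ite_false hb _ ih =>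
    simp only [Prog.bound, max_le_iff] at hK
    obtain ⟨m₁, ℓ₁, h1, r1⟩ := ih hK.2.2 hm
    exact ⟨m₁, ℓ₁, h1, r1.ite_false hm.pos_le ((hbit hm hK.1).trans hb)⟩
  | loop_true hb _ _ ih1 ih2 =>
    have hK' := hK
    simp only [Prog.bound, max_le_iff] at hK'
    obtain ⟨m₁, ℓ₁, h1, r1⟩ := ih1 hK'.2 hm
    obtain ⟨m₂, ℓ₂, h2, r2⟩ := ih2 hK h1
    exact ⟨m₂, ℓ₂, h2, r1.loop_true r2 hm.pos_le ((hbit hm hK'.1).trans hb)⟩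
  | loop_false hb =>
    simp only [Prog.bound, max_le_iff] at hK
    exact ⟨m, ℓ, hm, .loop_false (by rw [hm.head_eq]; omega) ((hbit hm hK.1).trans hb)⟩

theorem Frag.run_boot (x : List α) :
    (Frag.boot : Frag α β K).Run x (regWidth x.length + 2) (0 : Fin 3) ⟨0, fun _ => none, 0, []⟩
      ⟨0, mkTape 1 (columns K fun _ => 0), 1, []⟩ := by
  refine .step (q' := (1 : Fin 3)) (a := (.stay, none, .right, none)) (by simp) rfl ?_
  refine .step (q' := (2 : Fin 3)) (a := (.stay, some fun _ => false, .stay, none))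
    (by simp [Mem.act, Move.apply]) rfl ?_
  have : (Mem.act (Mem.act (⟨0, fun _ => none, 0, []⟩ : Mem β K) x.length
      (.stay, none, .right, none)) x.length (.stay, some fun _ => false, .stay, none)) =
      ⟨0, mkTape 1 (columns K fun _ => 0), 1, []⟩ := by
    simp only [Mem.act, Move.apply, Nat.zero_min, zero_add, Option.toList_none, List.append_nil,
      Mem.mk.injEq, and_true, true_and]
    funext j
    rcases j with _ | _ | j
    · simp [mkTape, Function.update]
    · simp only [mkTape, Function.update]
      simp
      funext k
      simp [columns]
    · simp [mkTape, Function.update]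
  rw [this]
  exact .halt (by simp) rfl

/-- From `2N + 2 < 2 ^ (log₂ N + 3)` the width is at most `log₂ N + 3`; the two extra cells give
`log₂ N + 5`. -/
theorem regWidth_add_two_le (N : ℕ) : regWidth N + 2 ≤ 5 * (Nat.log 2 N + 1) := by
  have h1 : regBound N < 2 ^ (Nat.log 2 N + 3) := by
    have := Nat.lt_pow_succ_log_self (b := 2) (by norm_num) N
    rw [regBound, pow_succ, pow_succ]
    rw [pow_succ] at this
    omega
  have h2 : Nat.log 2 (regBound N) < Nat.log 2 N + 3 :=
    Nat.log_lt_of_lt_pow (by simp [regBound]) h1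
  rw [regWidth]
  omega

/-- A program which writes the right words computes in logarithmic space. -/
theorem Prog.logspaceComputable {ι : Type} {dom : ι → Prop} {inp : ι → List α} {out : ι → List β}
    (p : Prog α β) (h : ∀ d, dom d → ∃ t, Exec (inp d) p ⟨fun _ => 0, 0, []⟩ t ∧ t.out = out d) :
    LogspaceComputable dom inp out := by
  refine ⟨(Frag.seq Frag.boot (p.compile p.bound)).toTransducer, 5, fun d hd => ?_⟩
  obtain ⟨t, ht, hout⟩ := h d hd
  obtain ⟨m, ℓ, hm, hr⟩ := ht.run (K := p.bound) le_rfl (ℓ := 1)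
    (m := ⟨0, mkTape 1 (columns p.bound fun _ => 0), 1, []⟩)
    ⟨by simp, rfl, rfl, rfl, rfl, by simp, by simp [regWidth], by simp⟩
  have := ((Frag.run_boot (inp d)).seq hr (by simp)).computesInSpace
  rw [hm.out_eq, hout] at this
  exact ⟨this.1, fun c hc i => (this.2 c hc i).trans_le (regWidth_add_two_le _)⟩

end Programs

/-! ### Functions computable with logarithmically many bits -/

section Computable

open Classical

/-- The letters of the input and output words. -/
abbrev Letter := Option Bool

/-- An input word together with the contents of some registers. -/
structure Inp (ι : Type*) where
  word : List Letter
  reg : ι → ℕ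

/-- The invariant is indexed by the number of completed rounds, and must determine the flag register
`f`: it is `1` before the last round `T` is reached and `0` then. Termination after exactly `T`
rounds is thereby built in. -/
theorem Exec.loop_of_invariant {α β : Type} {x : List α} {p : Prog α β} {f T : ℕ}
    (I : ℕ → St β → Prop)
    (hbody : ∀ t < T, ∀ s, I t s → ∃ u, Exec x p s u ∧ I (t + 1) u)
    (hflag : ∀ t ≤ T, ∀ s, I t s → s.reg f = if t = T then 0 else 1) {s : St β} (hs : I 0 s) :
    ∃ u, Exec x (.loop f p) s u ∧ I T u := by
  have key : ∀ k t, t + k = T → ∀ s, I t s → ∃ u, Exec x (.loop f p) s u ∧ I T u := by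
    intro k
    induction k with
    | zero =>
      rintro t rfl s hs
      refine ⟨s, .loop_false ?_, hs⟩
      rw [hflag t le_rfl s hs]; simp
    | succ k ih =>
      intro t ht s hs
      obtain ⟨u, hu, hI⟩ := hbody t (by omega) s hs
      obtain ⟨v, hv, hI'⟩ := ih (t + 1) (by omega) u hI
      refine ⟨v, .loop_true ?_ hu hv, hI'⟩
      rw [hflag t (by omega) s hs, if_neg (by omega)]; simp
  exact key T 0 (by omega) s hs

/-- Assignment of `0`. -/
def Prog.zero {α β : Type} (b : ℕ) : Prog α β := .look (fun _ => false) b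

theorem Exec.zero {α β : Type} {x : List α} (b : ℕ) (s : St β) : Exec x (.zero b) s (s.set b 0) :=
  Exec.look (x := x) (fun _ => false) b s

/-- Assignment of `1`. -/
def Prog.one {α β : Type} (b : ℕ) : Prog α β := .look (fun _ => true) b

theorem Exec.one {α β : Type} {x : List α} (b : ℕ) (s : St β) : Exec x (.one b) s (s.set b 1) :=
  Exec.look (x := x) (fun _ => true) b s

/-- Test for inequality. -/
def Prog.ne {α β : Type} (b i j : ℕ) : Prog α β := .seq (.eq b i j) (.ite b (.zero b) (.one b))

@[simp] theorem St.set_reg {β : Type} (s : St β) (i v k : ℕ) :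
    (s.set i v).reg k = if k = i then v else s.reg k := by
  simp [St.set, Function.update_apply]

@[simp] theorem St.set_pos {β : Type} (s : St β) (i v : ℕ) : (s.set i v).pos = s.pos := rfl

@[simp] theorem St.set_out {β : Type} (s : St β) (i v : ℕ) : (s.set i v).out = s.out := rfl

@[simp] theorem St.set_set {β : Type} (s : St β) (i v w : ℕ) : (s.set i v).set i w = s.set i w := by
  simp [St.set]

theorem Exec.ne {α β : Type} {x : List α} (b i j : ℕ) (s : St β) :
    Exec x (.ne b i j) s (s.set b (if s.reg i = s.reg j then 0 else 1)) := by
  by_cases h : s.reg i = s.reg j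
  · have h' : ((s.set b 1).reg b).testBit 0 = true := by simp
    have := (Exec.eq (x := x) b i j s)
    rw [if_pos h] at this ⊢
    unfold Prog.ne
    simpa using this.seq (.ite_true (q := .one b) h' (.zero b _))
  · have h' : ((s.set b 0).reg b).testBit 0 = false := by simp
    have := (Exec.eq (x := x) b i j s)
    rw [if_neg h] at this ⊢
    unfold Prog.ne
    simpa using this.seq (.ite_false (p := .zero b) h' (.one b _))

/-- The function `f` of `e` can be computed from the word and the registers of `Γ e`: wherever these
registers are (at the addresses `a`), there is a program which puts the value into a given register
`b` above them and changes no register below `b`. -/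
def LComp {E ι : Type*} (Γ : E → Inp ι) (f : E → ℕ) : Prop :=
  ∀ (a : ι → ℕ) (b : ℕ), (∀ i, a i < b) → ∃ p : Prog Letter Letter, ∀ (e : E) (s : St Letter),
    (∀ i, s.reg (a i) = (Γ e).reg i) → ∃ t, Exec (Γ e).word p s t ∧ t.reg b = f e ∧
      (∀ i < b, t.reg i = s.reg i) ∧ t.out = s.out

/-- The predicate `P` can be decided from the word and the registers of `Γ e`. -/
def LDec {E ι : Type*} (Γ : E → Inp ι) (P : E → Prop) : Prop :=
  LComp Γ fun e => if P e then 1 else 0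

/-- The word `g e` can be written, given the word and the registers of `Γ e`. -/
def LOut {E ι : Type*} (Γ : E → Inp ι) (g : E → List Letter) : Prop :=
  ∀ (a : ι → ℕ) (b : ℕ), (∀ i, a i < b) → ∃ p : Prog Letter Letter, ∀ (e : E) (s : St Letter),
    (∀ i, s.reg (a i) = (Γ e).reg i) → ∃ t, Exec (Γ e).word p s t ∧
      (∀ i < b, t.reg i = s.reg i) ∧ t.out = s.out ++ g e

/-! ### Closure properties of computable functions and decidable predicates -/

variable {E E' ι κ : Type*} {Γ : E → Inp ι} {Δ : E' → Inp κ}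

theorem LComp.congr {f g : E → ℕ} (h : LComp Γ f) (hfg : ∀ e, f e = g e) : LComp Γ g := by
  rwa [← funext hfg]

theorem LDec.congr {P Q : E → Prop} (h : LDec Γ P) (hPQ : ∀ e, P e ↔ Q e) : LDec Γ Q := by
  rwa [← funext fun e => propext (hPQ e)]

/-- A program for `f` works for any registers that carry the right contents, so the context may be
enlarged, renamed or restricted. All weakening lemmas are instances. -/
theorem LComp.comap {f : E' → ℕ} (h : LComp Δ f) (φ : E → E') (r : κ → ι)
    (hw : ∀ e, (Δ (φ e)).word = (Γ e).word) (hr : ∀ e i, (Δ (φ e)).reg i = (Γ e).reg (r i)) :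
    LComp Γ fun e => f (φ e) := by
  intro a b hab
  obtain ⟨p, hp⟩ := h (fun i => a (r i)) b fun i => hab _
  refine ⟨p, fun e s hs => ?_⟩
  rw [← hw]
  exact hp (φ e) s fun i => by rw [hs, hr]

theorem LComp.var (i : ι) : LComp Γ fun e => (Γ e).reg i := by
  intro a b hab
  exact ⟨.copy b (a i), fun e s hs => ⟨_, .copy _ _ _, by simp [hs], fun k hk => by
    simp [hk.ne], rfl⟩⟩

theorem LComp.zero : LComp Γ fun _ => 0 := fun _ b _ =>
  ⟨.zero b, fun _ _ _ => ⟨_, .zero _ _, by simp, fun k hk => by simp [hk.ne], rfl⟩⟩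

theorem LComp.succ {f : E → ℕ} (h : LComp Γ f) (hb : ∀ e, f e < regBound (Γ e).word.length) :
    LComp Γ fun e => f e + 1 := by
  intro a b hab
  obtain ⟨p, hp⟩ := h a b hab
  refine ⟨.seq p (.inc b), fun e s hs => ?_⟩
  obtain ⟨t, h1, h2, h3, h4⟩ := hp e s hs
  refine ⟨_, h1.seq (.inc b t ?_), by simp [h2], fun k hk => ?_, h4⟩
  · rw [h2]; exact hb e
  · simp [hk.ne, h3 k hk]

theorem LComp.one : LComp Γ fun _ => 1 :=
  LComp.zero.succ fun _ => by simp [regBound]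

theorem LComp.eq {f g : E → ℕ} (hf : LComp Γ f) (hg : LComp Γ g) : LDec Γ fun e => f e = g e := by
  intro a b hab
  obtain ⟨p, hp⟩ := hf a b hab
  -- The second value goes to register `b + 1`, so that its program leaves the first value in `b`
  -- intact.
  obtain ⟨q, hq⟩ := hg a (b + 1) fun i => (hab i).trans (Nat.lt_succ_self b)
  refine ⟨.seq p (.seq q (.eq b b (b + 1))), fun e s hs => ?_⟩
  obtain ⟨t, h1, h2, h3, h4⟩ := hp e s hs
  obtain ⟨u, k1, k2, k3, k4⟩ := hq e t fun i => by rw [h3 _ (hab i), hs]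
  refine ⟨_, h1.seq (k1.seq (.eq _ _ _ _)), ?_, fun k hk => ?_, k4.trans h4⟩
  · simp only [St.set_reg, if_true, k2, k3 b (by omega), h2]
    congr
  · simp only [St.set_reg, hk.ne, if_false, k3 k (by omega), h3 k hk]

/-- The restriction of a context to a subtype. -/
abbrev restrict (Γ : E → Inp ι) (P : E → Prop) : {e // P e} → Inp ι := fun e => Γ e.1

theorem LComp.restrict {f : E → ℕ} (h : LComp Γ f) (P : E → Prop) :
    LComp (restrict Γ P) fun e => f e.1 :=
  h.comap Subtype.val id (fun _ => rfl) fun _ _ => rfl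

/-- Each branch has to be computable only where it is taken. This matters for functions such as
`child`, whose search succeeds only under a hypothesis. -/
theorem LDec.cases {P : E → Prop} {f : E → ℕ} (hP : LDec Γ P)
    (h1 : LComp (WorkingTree.restrict Γ P) fun e => f e.1)
    (h2 : LComp (WorkingTree.restrict Γ fun e => ¬ P e) fun e => f e.1) : LComp Γ f := by
  intro a b hab
  obtain ⟨p, hp⟩ := hP a b hab
  obtain ⟨q₁, hq₁⟩ := h1 a b hab
  obtain ⟨q₂, hq₂⟩ := h2 a b hab
  refine ⟨.seq p (.ite b q₁ q₂), fun e s hs => ?_⟩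
  obtain ⟨t, k1, k2, k3, k4⟩ := hp e s hs
  by_cases he : P e
  · obtain ⟨u, l1, l2, l3, l4⟩ := hq₁ ⟨e, he⟩ t fun i => by rw [k3 _ (hab i), hs]
    exact ⟨u, k1.seq (.ite_true (by simp [k2, he]) l1), l2, fun i hi => by rw [l3 i hi, k3 i hi],
      l4.trans k4⟩
  · obtain ⟨u, l1, l2, l3, l4⟩ := hq₂ ⟨e, he⟩ t fun i => by rw [k3 _ (hab i), hs]
    exact ⟨u, k1.seq (.ite_false (by simp [k2, he]) l1), l2, fun i hi => by rw [l3 i hi, k3 i hi],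
      l4.trans k4⟩

theorem LComp.ite {P : E → Prop} {f g : E → ℕ} (hP : LDec Γ P)
    (hf : LComp Γ f) (hg : LComp Γ g) : LComp Γ fun e => if P e then f e else g e := by
  refine hP.cases ((hf.restrict _).congr fun e => ?_) ((hg.restrict _).congr fun e => ?_)
  · rw [if_pos e.2]
  · rw [if_neg e.2]

theorem LDec.not {P : E → Prop} (h : LDec Γ P) : LDec Γ fun e => ¬ P e :=
  (LComp.ite h .zero .one).congr fun e => by by_cases hP : P e <;> simp [hP]

theorem LDec.and {P Q : E → Prop} (hP : LDec Γ P) (hQ : LDec Γ Q) : LDec Γ fun e => P e ∧ Q e :=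
  (LComp.ite hP hQ .zero).congr fun e => by by_cases hP : P e <;> simp [hP]

theorem LDec.or {P Q : E → Prop} (hP : LDec Γ P) (hQ : LDec Γ Q) : LDec Γ fun e => P e ∨ Q e :=
  (LComp.ite hP .one hQ).congr fun e => by by_cases hP : P e <;> simp [hP]

theorem LDec.imp {P Q : E → Prop} (hP : LDec Γ P) (hQ : LDec Γ Q) : LDec Γ fun e => P e → Q e :=
  (hP.not.or hQ).congr fun e => by tauto

theorem inputCell_min {α : Type} (x : List α) (i : ℕ) :
    inputCell x (min i (x.length + 1)) = inputCell x i := by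
  rcases le_total i (x.length + 1) with h | h
  · rw [min_eq_left h]
  · rw [min_eq_right h]
    obtain ⟨j, rfl⟩ : ∃ j, i = j + 1 := ⟨i - 1, by omega⟩
    simp only [inputCell]
    rw [List.getElem?_eq_none le_rfl, List.getElem?_eq_none (by omega)]

/-- A test of the input letter at a computed position. -/
theorem LComp.read {f : E → ℕ} (hf : LComp Γ f) (hb : ∀ e, f e ≤ regBound (Γ e).word.length)
    (P : InputSymbol Letter → Bool) :
    LDec Γ fun e => P (inputCell (Γ e).word (f e)) = Bool.true := by
  intro a b hab
  obtain ⟨p, hp⟩ := hf a b hab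
  -- The position of the input head is not known to the program. The head is first driven back to
  -- the left end marker, which `Q` recognizes, and then moved to the right `f e` times, with
  -- register `b + 1` as counter.
  let Q : InputSymbol Letter → Bool := fun c => match c with
    | .leftEnd => Bool.false
    | _ => Bool.true
  have hQ : ∀ (x : List Letter) (i : ℕ), (Q (inputCell x i) = Bool.true) = ¬ i = 0 := by
    intro x i
    cases i with
    | zero => simp [Q, inputCell]
    | succ i => rw [inputCell]; cases x[i]? <;> simp [Q]
  refine ⟨.seq p (.seq (.move .left) (.seq (.look Q (b + 1)) (.seq (.loop (b + 1) (.seq (.move .left)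
    (.look Q (b + 1)))) (.seq (.zero (b + 1)) (.seq (.ne (b + 2) b (b + 1)) (.seq (.loop (b + 2)
    (.seq (.move .right) (.seq (.inc (b + 1)) (.ne (b + 2) b (b + 1))))) (.look P b))))))),
    fun e s hs => ?_⟩
  obtain ⟨t, h1, h2, h3, h4⟩ := hp e s hs
  have hbe := hb e
  beta_reduce
  generalize (Γ e).word = x at h1 hbe ⊢
  set T := min (t.pos - 1) (x.length + 1) with hT
  obtain ⟨u, hu, hu1, hu2, hu3, hu4⟩ := Exec.loop_of_invariant (x := x)
    (p := .seq (.move .left) (.look Q (b + 1))) (f := b + 1) (T := T)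
    (fun k s => s.pos = T - k ∧ s.reg (b + 1) = (if s.pos = 0 then 0 else 1) ∧ s.out = t.out ∧
      ∀ i ≤ b, s.reg i = t.reg i)
    (fun k hk s hI => ⟨_, (Exec.move .left s).seq (.look Q (b + 1) _), by
      obtain ⟨i1, i2, i3, i4⟩ := hI
      refine ⟨?_, ?_, i3, fun i hi => ?_⟩
      · simp only [St.set_pos, Move.apply, i1]; omega
      · simp only [St.set_reg, St.set_pos, hQ, if_true, ite_not]
      · have : i ≠ b + 1 := by omega
        simp [this, i4 i hi]⟩)
    (fun k hk s hI => by
      rw [hI.2.1, hI.1]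
      congr 1
      exact propext (by omega))
    (s := St.set { t with pos := T } (b + 1) (if Q (inputCell x T) = Bool.true then 1 else 0))
    ⟨by simp, by simp [hQ], rfl, fun i hi => by
      have : i ≠ b + 1 := by omega
      simp [this]⟩
  obtain ⟨v, hv, hv1, hv2, hv3, hv4, hv5⟩ := Exec.loop_of_invariant (x := x)
    (p := .seq (.move .right) (.seq (.inc (b + 1)) (.ne (b + 2) b (b + 1)))) (f := b + 2) (T := f e)
    -- The counter may exceed the position of the right end marker, where the head stays; by
    -- `inputCell_min` the letter read is the same.
    (fun k s => s.pos = min k (x.length + 1) ∧ s.reg (b + 1) = k ∧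
      s.reg (b + 2) = (if f e = k then 0 else 1) ∧ s.out = t.out ∧ ∀ i ≤ b, s.reg i = t.reg i)
    (fun k hk s ⟨i1, i2, i3, i4, i5⟩ => ⟨_, (Exec.move .right s).seq
      ((Exec.inc (b + 1) _ (by simp only [i2]; omega)).seq (.ne _ _ _ _)), by
      refine ⟨?_, ?_, ?_, i4, fun i hi => ?_⟩
      · simp only [St.set_pos, Move.apply, i1]; omega
      · simp [i2]
      · simp [i2, i5 b le_rfl, h2]
      · have h1 : i ≠ b + 1 := by omega
        have h2 : i ≠ b + 2 := by omega
        simp [h1, h2, i5 i hi]⟩)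
    (fun k hk s hI => by
      rw [hI.2.2.1]
      congr 1
      exact propext eq_comm)
    (s := St.set (u.set (b + 1) 0) (b + 2)
      (if (u.set (b + 1) 0).reg b = (u.set (b + 1) 0).reg (b + 1) then 0 else 1))
    ⟨by simp [hu1], by simp, by simp [hu4, h2], hu3, fun i hi => by
      have h1 : i ≠ b + 1 := by omega
      have h2 : i ≠ b + 2 := by omega
      simp [h1, h2, hu4 i hi]⟩
  refine ⟨_, h1.seq ((Exec.move .left t).seq ((Exec.look Q (b + 1) _).seq (hu.seq
    ((Exec.zero (b + 1) u).seq ((Exec.ne _ _ _ _).seq (hv.seq (.look P b v))))))), ?_,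
    fun i hi => ?_, hv4.trans h4⟩
  · simp only [St.set_reg, if_true, hv1, inputCell_min]
    congr
  · simp [hi.ne, hv5 i hi.le, h3 i hi]

/-! ### Iteration -/

/-- The program for the value at `b + j` changes nothing below that register, so the earlier values
survive. -/
theorem LComp.block {m : ℕ} {F : Fin m → E → ℕ} (h : ∀ j, LComp Γ (F j)) (a : ι → ℕ) (b : ℕ)
    (hab : ∀ i, a i < b) : ∃ p : Prog Letter Letter, ∀ (e : E) (s : St Letter),
    (∀ i, s.reg (a i) = (Γ e).reg i) → ∃ t, Exec (Γ e).word p s t ∧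
      (∀ j : Fin m, t.reg (b + j) = F j e) ∧ (∀ i < b, t.reg i = s.reg i) ∧ t.out = s.out := by
  induction m with
  | zero => exact ⟨.zero b, fun e s _ => ⟨_, .zero b s, fun j => j.elim0, fun i hi => by
      simp [hi.ne], rfl⟩⟩
  | succ m ih =>
    obtain ⟨p, hp⟩ := ih fun j => h j.castSucc
    obtain ⟨q, hq⟩ := h (Fin.last m) a (b + m) fun i => (hab i).trans_le (Nat.le_add_right _ _)
    refine ⟨.seq p q, fun e s hs => ?_⟩
    obtain ⟨t, h1, h2, h3, h4⟩ := hp e s hs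
    obtain ⟨u, k1, k2, k3, k4⟩ := hq e t fun i => by rw [h3 _ (hab i), hs]
    refine ⟨u, h1.seq k1, fun j => ?_, fun i hi => ?_, k4.trans h4⟩
    · induction j using Fin.lastCases with
      | last => exact k2
      | cast j => rw [← h2 j]; exact k3 _ (by simp)
    · rw [k3 i (by omega), h3 i hi]

/-- In an iteration every new value may depend on all old ones. The new values are therefore
computed in a separate block, and only afterwards copied over the old ones. -/
theorem Exec.copyBlock (b c m : ℕ) (hbc : b + m ≤ c) : ∃ p : Prog Letter Letter,
    ∀ (x : List Letter) (s : St Letter), ∃ t, Exec x p s t ∧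
      (∀ j < m, t.reg (b + j) = s.reg (c + j)) ∧ (∀ i, i < b ∨ b + m ≤ i → t.reg i = s.reg i) ∧
      t.out = s.out := by
  induction m with
  | zero => exact ⟨.move .stay, fun x s => ⟨_, .move .stay s, by simp, fun _ _ => rfl, rfl⟩⟩
  | succ m ih =>
    obtain ⟨p, hp⟩ := ih (by omega)
    refine ⟨.seq p (.copy (b + m) (c + m)), fun x s => ?_⟩
    obtain ⟨t, h1, h2, h3, h4⟩ := hp x s
    refine ⟨_, h1.seq (.copy _ _ _), fun j hj => ?_, fun i hi => ?_, h4⟩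
    · rcases Nat.lt_succ_iff_lt_or_eq.1 hj with hj | rfl
      · simp [h2 j hj, hj.ne]
      · simp [h3 (c + j) (by omega)]
    · have : i ≠ b + m := by omega
      simp [this, h3 i (by omega)]

/-- The context in which the current index `t` and the current values `Z e t` of an iteration are
available, for the indices which satisfy `D`. -/
def loopCtx {m : ℕ} (Γ : E → Inp ι) (Z : E → ℕ → Fin m → ℕ) (D : E → ℕ → Prop) :
    {p : E × ℕ // D p.1 p.2} → Inp (ι ⊕ Option (Fin m)) := fun p =>
  ⟨(Γ p.1.1).word, Sum.elim (Γ p.1.1).reg fun o => o.elim p.1.2 (Z p.1.1 p.1.2)⟩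

/-- The last values of an iteration are computable if the initial values, the end of the iteration
and the steps are. -/
theorem LComp.loop {m : ℕ} {T : E → ℕ} {Z : E → ℕ → Fin m → ℕ}
    (hT : ∀ e, T e ≤ regBound (Γ e).word.length) (h0 : ∀ j, LComp Γ fun e => Z e 0 j)
    (htest : LDec (loopCtx Γ Z fun e t => t ≤ T e) fun p => p.1.2 = T p.1.1)
    (hstep : ∀ j, LComp (loopCtx Γ Z fun e t => t < T e) fun p => Z p.1.1 (p.1.2 + 1) j)
    (j : Fin m) : LComp Γ fun e => Z e (T e) j := by
  intro a b hab
  obtain ⟨p₀, hp₀⟩ := LComp.block h0 a (b + 1) fun i => (hab i).trans (Nat.lt_succ_self _)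
  -- Layout: `b` holds the index, the next `m` registers the current values. The flag is register `b
  -- + 1 + m`, which is also the start of the block for the new values; the flag is recomputed after
  -- these have been copied.
  let a' : ι ⊕ Option (Fin m) → ℕ := Sum.elim a fun o => o.elim b fun j => b + 1 + j
  have ha' : ∀ i, a' i < b + 1 + m := by
    rintro (i | _ | i)
    · have := hab i; simp [a']; omega
    · simp [a']; omega
    · simp [a']
  obtain ⟨q, hq⟩ := htest.not a' _ ha'
  obtain ⟨p, hp⟩ := LComp.block hstep a' _ ha'
  obtain ⟨r, hr⟩ := Exec.copyBlock (b + 1) (b + 1 + m) m le_rfl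
  refine ⟨.seq p₀ (.seq (.zero b) (.seq q (.seq (.loop (b + 1 + m) (.seq p (.seq r (.seq (.inc b)
    q)))) (.copy b (b + 1 + j))))), fun e s hs => ?_⟩
  have hctx : ∀ (D : E → ℕ → Prop) (k : ℕ) (hk : D e k) (t : St Letter),
      (∀ i < b, t.reg i = s.reg i) → t.reg b = k → (∀ j : Fin m, t.reg (b + 1 + j) = Z e k j) →
      ∀ i, t.reg (a' i) = (loopCtx Γ Z D ⟨(e, k), hk⟩).reg i := by
    rintro D k hk t h1 h2 h3 (i | _ | i)
    · simp [a', loopCtx, h1 _ (hab i), hs]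
    · simp [a', loopCtx, h2]
    · simp [a', loopCtx, h3]
  obtain ⟨s₁, e1, z1, r1, o1⟩ := hp₀ e s hs
  have r2 : ∀ i < b, (s₁.set b 0).reg i = s.reg i := fun i hi => by simp [hi.ne, r1 i (by omega)]
  have z2 : ∀ j : Fin m, (s₁.set b 0).reg (b + 1 + j) = Z e 0 j := fun j => by
    have : b + 1 + j.1 ≠ b := by omega
    simp [this, z1]
  obtain ⟨s₂, e2, f2, r3, o2⟩ := hq ⟨(e, 0), Nat.zero_le _⟩ (s₁.set b 0)
    (hctx _ _ _ _ r2 (by simp) z2)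
  obtain ⟨u, hu, u1, u2, u3, u4, u5⟩ := Exec.loop_of_invariant (x := (Γ e).word)
    (p := .seq p (.seq r (.seq (.inc b) q))) (f := b + 1 + m) (T := T e)
    (fun k t => t.reg b = k ∧ (∀ i < b, t.reg i = s.reg i) ∧
      (∀ j : Fin m, t.reg (b + 1 + j) = Z e k j) ∧
      t.reg (b + 1 + m) = (if k = T e then 0 else 1) ∧ t.out = s.out)
    (fun k hk t ⟨i1, i2, i3, i4, i5⟩ => by
      obtain ⟨t₁, x1, y1, w1, v1⟩ := hp ⟨(e, k), hk⟩ t (hctx _ _ _ _ i2 i1 i3)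
      obtain ⟨t₂, x2, y2, w2, v2⟩ := hr (Γ e).word t₁
      have hb2 : t₂.reg b = k := by rw [w2 b (by omega), w1 b (by omega), i1]
      have w3 : ∀ i < b, (t₂.set b (k + 1)).reg i = s.reg i := fun i hi => by
        simp [hi.ne, w2 i (by omega), w1 i (by omega), i2 i hi]
      have z3 : ∀ j : Fin m, (t₂.set b (k + 1)).reg (b + 1 + j) = Z e (k + 1) j := fun j => by
        have : b + 1 + j.1 ≠ b := by omega
        simp [this, y2 j j.2, y1]
      obtain ⟨t₃, x4, y4, w4, v4⟩ := hq ⟨(e, k + 1), hk⟩ (t₂.set b (k + 1))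
        (hctx _ _ _ _ w3 (by simp) z3)
      have x3 : Exec (Γ e).word (.inc b) t₂ (t₂.set b (k + 1)) := by
        have := Exec.inc (x := (Γ e).word) b t₂ (by have := hT e; omega)
        rwa [hb2] at this
      refine ⟨t₃, x1.seq (x2.seq (x3.seq x4)), ?_, fun i hi => ?_, fun j => ?_, ?_, ?_⟩
      · rw [w4 b (by omega)]; simp
      · rw [w4 i (by omega), w3 i hi]
      · rw [w4 _ (by omega), z3]
      · rw [y4]; by_cases hk' : k + 1 = T e <;> simp [hk']
      · rw [v4, St.set_out, v2, v1, i5])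
    (fun k hk t hI => hI.2.2.2.1)
    (s := s₂) ⟨by rw [r3 b (by omega)]; simp, fun i hi => by rw [r3 i (by omega), r2 i hi],
      fun j => by rw [r3 _ (by omega), z2], by
        rw [f2]; by_cases hk' : 0 = T e <;> simp [hk'],
      by rw [o2, St.set_out, o1]⟩
  refine ⟨_, e1.seq ((Exec.zero b s₁).seq (e2.seq (hu.seq (.copy _ _ _)))), by simp [u3],
    fun i hi => by simp [hi.ne, u2 i hi], u5⟩

/-! ### Output -/

theorem LOut.single (o : Letter) : LOut Γ fun _ => [o] := fun _ _ _ =>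
  ⟨.emit o, fun _ s _ => ⟨_, .emit o s, fun _ _ => rfl, rfl⟩⟩

theorem LOut.append {g h : E → List Letter} (hg : LOut Γ g) (hh : LOut Γ h) :
    LOut Γ fun e => g e ++ h e := by
  intro a b hab
  obtain ⟨p, hp⟩ := hg a b hab
  obtain ⟨q, hq⟩ := hh a b hab
  refine ⟨.seq p q, fun e s hs => ?_⟩
  obtain ⟨t, h1, h2, h3⟩ := hp e s hs
  obtain ⟨u, k1, k2, k3⟩ := hq e t fun i => by rw [h2 _ (hab i), hs]
  exact ⟨u, h1.seq k1, fun i hi => by rw [k2 i hi, h2 i hi], by simp [k3, h3]⟩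

theorem LOut.ite {P : E → Prop} {g h : E → List Letter} (hP : LDec Γ P) (hg : LOut Γ g)
    (hh : LOut Γ h) : LOut Γ fun e => if P e then g e else h e := by
  intro a b hab
  obtain ⟨p, hp⟩ := hP a b hab
  obtain ⟨q₁, hq₁⟩ := hg a b hab
  obtain ⟨q₂, hq₂⟩ := hh a b hab
  refine ⟨.seq p (.ite b q₁ q₂), fun e s hs => ?_⟩
  obtain ⟨t, k1, k2, k3, k4⟩ := hp e s hs
  by_cases he : P e
  · obtain ⟨u, l1, l2, l3⟩ := hq₁ e t fun i => by rw [k3 _ (hab i), hs]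
    exact ⟨u, k1.seq (.ite_true (by simp [k2, he]) l1), fun i hi => by rw [l2 i hi, k3 i hi],
      by simp [l3, k4, he]⟩
  · obtain ⟨u, l1, l2, l3⟩ := hq₂ e t fun i => by rw [k3 _ (hab i), hs]
    exact ⟨u, k1.seq (.ite_false (by simp [k2, he]) l1), fun i hi => by rw [l2 i hi, k3 i hi],
      by simp [l3, k4, he]⟩

/-- The context in which a number below `n e` is available in addition. -/
def finCtx (Γ : E → Inp ι) (n : E → ℕ) : (Σ e, Fin (n e)) → Inp (Option ι) := fun p =>
  ⟨(Γ p.1).word, fun o => o.elim p.2.1 (Γ p.1).reg⟩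

theorem LOut.flatMap {n : E → ℕ} {g : (e : E) → Fin (n e) → List Letter} (hn : LComp Γ n)
    (hb : ∀ e, n e ≤ regBound (Γ e).word.length) (hg : LOut (finCtx Γ n) fun p => g p.1 p.2) :
    LOut Γ fun e => (List.finRange (n e)).flatMap (g e) := by
  intro a b hab
  obtain ⟨p, hp⟩ := hn a b hab
  let a' : Option ι → ℕ := fun o => o.elim (b + 1) a
  have ha' : ∀ i, a' i < b + 3 := by
    rintro (_ | i)
    · simp [a']
    · have := hab i; simp [a']; omega
  obtain ⟨q, hq⟩ := hg a' _ ha'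
  refine ⟨.seq p (.seq (.zero (b + 1)) (.seq (.ne (b + 2) b (b + 1)) (.loop (b + 2) (.seq q
    (.seq (.inc (b + 1)) (.ne (b + 2) b (b + 1))))))), fun e s hs => ?_⟩
  obtain ⟨t, h1, h2, h3, h4⟩ := hp e s hs
  obtain ⟨u, hu, -, -, u3, -, u5⟩ := Exec.loop_of_invariant (x := (Γ e).word)
    (p := .seq q (.seq (.inc (b + 1)) (.ne (b + 2) b (b + 1)))) (f := b + 2) (T := n e)
    (fun k u => u.reg b = n e ∧ u.reg (b + 1) = k ∧ (∀ i < b, u.reg i = s.reg i) ∧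
      u.reg (b + 2) = (if k = n e then 0 else 1) ∧
      -- After `k` rounds the output for the first `k` numbers has been written.
      u.out = s.out ++ ((List.finRange (n e)).take k).flatMap (g e))
    (fun k hk u ⟨i1, i2, i3, i4, i5⟩ => by
      obtain ⟨v, x1, x2, x3⟩ := hq ⟨e, ⟨k, hk⟩⟩ u (by
        rintro (_ | i)
        · simp [a', finCtx, i2]
        · simp [a', finCtx, i3 _ (hab i), hs])
      refine ⟨_, x1.seq ((Exec.inc (b + 1) v ?_).seq (.ne _ _ _ _)), ?_, ?_, fun i hi => ?_, ?_, ?_⟩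
      · rw [x2 _ (by omega), i2]
        exact (Nat.succ_le_of_lt hk).trans (hb e)
      · simp [x2 b (by omega), i1]
      · simp [x2 (b + 1) (by omega), i2]
      · have h1 : i ≠ b + 1 := by omega
        have h2 : i ≠ b + 2 := by omega
        simp [h1, h2, x2 i (by omega), i3 i hi]
      · simp [x2 b (by omega), x2 (b + 1) (by omega), i1, i2, eq_comm]
      · have : (List.finRange (n e)).take (k + 1) = (List.finRange (n e)).take k ++ [⟨k, hk⟩] := by
          rw [List.take_add_one]
          simp [hk]
        simp [x3, i5, this])
    (fun k hk t hI => hI.2.2.2.1)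
    (s := St.set (t.set (b + 1) 0) (b + 2)
      (if (t.set (b + 1) 0).reg b = (t.set (b + 1) 0).reg (b + 1) then 0 else 1))
    ⟨by simp [h2], by simp, fun i hi => by
      have h1 : i ≠ b + 1 := by omega
      have h2 : i ≠ b + 2 := by omega
      simp [h1, h2, h3 i hi], by simp [h2, eq_comm], by simp [h4]⟩
  refine ⟨u, h1.seq ((Exec.zero (b + 1) t).seq ((Exec.ne _ _ _ _).seq hu)), u3, ?_⟩
  rw [u5, List.take_of_length_le (by simp)]

theorem LOut.logspaceComputable {E : Type} {dom : E → Prop} {inp out : E → List Letter}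
    (h : LOut (fun d : {d // dom d} => (⟨inp d, Empty.elim⟩ : Inp Empty)) fun d => out d) :
    LogspaceComputable dom inp out := by
  obtain ⟨p, hp⟩ := h Empty.elim 0 fun i => i.elim
  refine p.logspaceComputable fun d hd => ?_
  obtain ⟨t, h1, -, h2⟩ := hp ⟨d, hd⟩ ⟨fun _ => 0, 0, []⟩ fun i => i.elim
  exact ⟨t, h1, by simpa using h2⟩

end Computable

/-! ### The order of a rooted tree -/

section TreeOrder

variable {V : Type*} {S : SimpleGraph V} {r : V}

theorem OnPath.mem_support (hS : S.IsAcyclic) {u v a : V} (h : OnPath S u v a) {p : S.Walk u v}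
    (hp : p.IsPath) : a ∈ p.support := by
  obtain ⟨q, hq, ha⟩ := h
  have : q = p := congrArg Subtype.val ((hS.subsingleton_path u v).elim ⟨q, hq⟩ ⟨p, hp⟩)
  exact this ▸ ha

theorem OnPath.mem_walk (hS : S.IsAcyclic) {u v a : V} (h : OnPath S u v a) (p : S.Walk u v) :
    a ∈ p.support := by
  classical
  exact p.support_bypass_subset_support (h.mem_support hS p.bypass_isPath)

variable (hS : S.IsTree)
include hS

theorem exists_isPath (u v : V) : ∃ p : S.Walk u v, p.IsPath :=
  (hS.existsUnique_path u v).exists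

/-- Every walk contains the unique path between its ends. In this form `v` separates `x` from the
root, and walks can be cut and joined without checking that they are paths. -/
theorem isAncestor_iff_forall_walk {v x : V} :
    IsAncestor S r v x ↔ ∀ p : S.Walk r x, v ∈ p.support := by
  refine ⟨fun h p => h.mem_walk hS.isAcyclic p, fun h => ?_⟩
  obtain ⟨p, hp⟩ := exists_isPath hS r x
  exact ⟨p, hp, h p⟩

theorem isAncestor_refl (x : V) : IsAncestor S r x x := by
  obtain ⟨p, hp⟩ := exists_isPath hS r x
  exact ⟨p, hp, p.end_mem_support⟩

theorem isAncestor_root (x : V) : IsAncestor S r r x := by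
  obtain ⟨p, hp⟩ := exists_isPath hS r x
  exact ⟨p, hp, p.start_mem_support⟩

omit hS in
theorem isAncestor_of_append {v w y : V} {p : S.Walk r v} {q : S.Walk v w}
    (h : (p.append q).IsPath) (hy : y ∈ q.support) : IsAncestor S r v y ∧ IsAncestor S r y w := by
  classical
  refine ⟨⟨p.append (q.takeUntil y hy), ?_, ?_⟩, ⟨_, h, ?_⟩⟩
  · rw [← q.take_spec hy, SimpleGraph.Walk.append_assoc] at h
    exact h.of_append_left
  · simp
  · simp [SimpleGraph.Walk.mem_support_append_iff, hy]

/-- The path from the root to `w` passes `v`, and its two halves are the unique paths `p` and `q`.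
-/
theorem IsAncestor.append_isPath {v w : V} (h : IsAncestor S r v w) {p : S.Walk r v}
    {q : S.Walk v w} (hp : p.IsPath) (hq : q.IsPath) : (p.append q).IsPath := by
  classical
  obtain ⟨z, hz, hv⟩ := h
  have h1 : z.takeUntil v hv = p :=
    (hS.existsUnique_path r v).unique (hz.takeUntil hv) hp
  have h2 : z.dropUntil v hv = q :=
    (hS.existsUnique_path v w).unique (hz.dropUntil hv) hq
  rwa [← h1, ← h2, z.take_spec]

theorem IsAncestor.trans {a b x : V} (h : IsAncestor S r a b) (h' : IsAncestor S r b x) :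
    IsAncestor S r a x := by
  classical
  rw [isAncestor_iff_forall_walk hS] at *
  intro p
  exact p.support_takeUntil_subset_support (h' p) (h _)

theorem IsAncestor.antisymm {a b : V} (h : IsAncestor S r a b) (h' : IsAncestor S r b a) :
    a = b := by
  classical
  by_contra hab
  obtain ⟨p, hp, hb⟩ := h'
  exact SimpleGraph.Walk.endpoint_notMem_support_takeUntil hp hb hab
    ((isAncestor_iff_forall_walk hS).1 h _)

/-- Both nodes lie on the path from the root to `x`, and one of them comes first there. -/
theorem IsAncestor.total {a b x : V} (h : IsAncestor S r a x) (h' : IsAncestor S r b x) :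
    IsAncestor S r a b ∨ IsAncestor S r b a := by
  classical
  obtain ⟨p, hp, ha⟩ := h
  have hb := h'.mem_support hS.isAcyclic hp
  rw [← p.take_spec ha, SimpleGraph.Walk.mem_support_append_iff] at hb
  rcases hb with hb | hb
  · exact .inr ⟨_, hp.takeUntil ha, hb⟩
  · exact .inl (isAncestor_of_append (p := p.takeUntil a ha) (by rwa [p.take_spec]) hb).1

theorem isAncestor_of_adj {u v : V} (h : S.Adj u v) : IsAncestor S r u v ∨ IsAncestor S r v u := by
  by_cases hv : IsAncestor S r v u
  · exact .inr hv
  · obtain ⟨p, hp⟩ := exists_isPath hS r u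
    exact .inl ⟨p.concat h, hp.concat (fun h' => hv ⟨p, hp, h'⟩) h, by simp⟩

/-- The path to the child `v` is the path to its parent `u` with one edge added. -/
theorem IsAncestor.of_adj {u v z : V} (h : S.Adj u v) (huv : IsAncestor S r u v)
    (hz : IsAncestor S r z v) : z = v ∨ IsAncestor S r z u := by
  obtain ⟨p, hp⟩ := exists_isPath hS r u
  have hv : v ∉ p.support := fun h' => h.ne (huv.antisymm hS ⟨p, hp, h'⟩)
  have := hz.mem_support hS.isAcyclic (hp.concat hv h)
  rw [SimpleGraph.Walk.support_concat, List.mem_append,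
    List.mem_singleton] at this
  exact this.symm.imp_right fun h => ⟨p, hp, h⟩

theorem exists_child {c x : V} (h : IsAncestor S r c x) (hne : x ≠ c) :
    ∃ y, S.Adj c y ∧ IsAncestor S r c y ∧ IsAncestor S r y x := by
  obtain ⟨p, hp⟩ := exists_isPath hS r c
  obtain ⟨q, hq⟩ := exists_isPath hS c x
  have hpq := h.append_isPath hS hp hq
  have hn : ¬ q.Nil := SimpleGraph.Walk.not_nil_of_ne hne.symm
  have := isAncestor_of_append hpq (q.getVert_mem_support 1)
  exact ⟨q.snd, q.adj_snd hn, this.1, this.2⟩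

theorem reachable_induce {A : Set V} {z x : V} (h : IsAncestor S r z x)
    (hA : ∀ y, IsAncestor S r z y → IsAncestor S r y x → y ∈ A) :
    (S.induce A).Reachable ⟨z, hA z (isAncestor_refl hS z) h⟩ ⟨x, hA x h (isAncestor_refl hS x)⟩ := by
  obtain ⟨p, hp⟩ := exists_isPath hS r z
  obtain ⟨q, hq⟩ := exists_isPath hS z x
  have hpq := h.append_isPath hS hp hq
  exact ⟨q.induce A fun y hy => hA y (isAncestor_of_append hpq hy).1 (isAncestor_of_append hpq hy).2⟩

end TreeOrder

/-! ### Components -/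

section Components

variable {V : Type*} {S : SimpleGraph V} {r : V}

theorem mem_piece_none {v x : V} : x ∈ piece S r v none ↔ IsAncestor S r v x := by
  simp [piece]

theorem mem_piece_some {v w x : V} :
    x ∈ piece S r v (some w) ↔ IsAncestor S r v x ∧ ¬ IsAncestor S r w x := by
  simp [piece]

theorem IsComponentAfterRemoval.nonempty {A B : Set V} {c : V}
    (h : IsComponentAfterRemoval S A c B) : B.Nonempty := by
  obtain ⟨K, rfl⟩ := h
  exact K.nonempty_supp.image _

theorem IsComponentAfterRemoval.subset {A B : Set V} {c : V}
    (h : IsComponentAfterRemoval S A c B) : B ⊆ A \ {c} := by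
  obtain ⟨K, rfl⟩ := h
  rintro _ ⟨x, -, rfl⟩
  exact x.2

theorem IsComponentAfterRemoval.unique {A B B' : Set V} {c x : V}
    (h : IsComponentAfterRemoval S A c B) (h' : IsComponentAfterRemoval S A c B') (hx : x ∈ B)
    (hx' : x ∈ B') : B = B' := by
  obtain ⟨K, rfl⟩ := h
  obtain ⟨K', rfl⟩ := h'
  obtain ⟨y, hy, rfl⟩ := hx
  obtain ⟨y', hy', e⟩ := hx'
  obtain rfl := Subtype.ext e
  rw [SimpleGraph.ConnectedComponent.mem_supp_iff] at hy hy'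
  rw [← hy, ← hy']

theorem IsComponentAfterRemoval.mem_of_walk {A B : Set V} {c x y : V}
    (h : IsComponentAfterRemoval S A c B) (hx : x ∈ B) (p : S.Walk x y)
    (hp : ∀ z ∈ p.support, z ∈ A \ {c}) : y ∈ B := by
  obtain ⟨K, rfl⟩ := h
  obtain ⟨x, hx, rfl⟩ := hx
  refine ⟨⟨y, hp _ p.end_mem_support⟩, ?_, rfl⟩
  rw [SimpleGraph.ConnectedComponent.mem_supp_iff] at hx ⊢
  rw [← hx]
  exact SimpleGraph.ConnectedComponent.sound ⟨(p.induce _ hp).reverse⟩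

/-- A set that is connected within the remaining graph and closed under its edges is a component. -/
theorem isComponentAfterRemoval_of {A B : Set V} {c z : V} (hBA : B ⊆ A \ {c}) (hz : z ∈ B)
    (hclosed : ∀ a ∈ B, ∀ b ∈ A \ {c}, S.Adj a b → b ∈ B)
    (hconn : ∀ x (hx : x ∈ B), (S.induce (A \ {c})).Reachable ⟨z, hBA hz⟩ ⟨x, hBA hx⟩) :
    IsComponentAfterRemoval S A c B := by
  refine ⟨(S.induce (A \ {c})).connectedComponentMk ⟨z, hBA hz⟩, Set.Subset.antisymm ?_ ?_⟩
  · intro x hx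
    exact ⟨⟨x, hBA hx⟩, SimpleGraph.ConnectedComponent.sound (hconn x hx).symm, rfl⟩
  · rintro _ ⟨x, hx, rfl⟩
    obtain ⟨p⟩ := (SimpleGraph.ConnectedComponent.exact hx).symm
    have : ∀ {a b} (p : (S.induce (A \ {c})).Walk a b), a.1 ∈ B → b.1 ∈ B := by
      intro a b p
      induction p with
      | nil => exact id
      | cons h _ ih => exact fun ha => ih (hclosed _ ha _ (Subtype.prop _) h)
    exact this p hz

/-- `S_{v,w}` is a meaningful expression for a nonempty set. -/
def IsProper (S : SimpleGraph V) (r v : V) (w : Option V) : Prop :=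
  IsPieceIndex S r v w ∧ (piece S r v w).Nonempty

variable (hS : S.IsTree)
include hS

theorem IsProper.mem {v : V} {w : Option V} (h : IsProper S r v w) : v ∈ piece S r v w := by
  refine ⟨isAncestor_refl hS v, fun w' hw hv => ?_⟩
  obtain ⟨x, hx⟩ := h.2
  obtain rfl := hv.antisymm hS (h.1 w' hw)
  exact hx.2 w' hw hx.1

/-- The node `v` is the topmost element of the set. If `w` is present, it is the topmost descendant
of `v` missing from the set. This lets `trace`, which stores pairs, be compared with `Stage`, where
any admissible name of a component is allowed. -/
theorem IsProper.unique {v v' : V} {w w' : Option V} (h : IsProper S r v w)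
    (h' : IsProper S r v' w') (he : piece S r v w = piece S r v' w') : v = v' ∧ w = w' := by
  have h1 : v ∈ piece S r v' w' := he ▸ h.mem hS
  have h2 : v' ∈ piece S r v w := he ▸ h'.mem hS
  obtain rfl : v = v' := h2.1.antisymm hS h1.1
  refine ⟨rfl, ?_⟩
  have key : ∀ {w w' : Option V} {u : V}, piece S r v w = piece S r v w' →
      IsPieceIndex S r v w → w = some u → ∃ u' ∈ w', IsAncestor S r u' u := by
    rintro w w' u he hw rfl
    by_contra hcon
    push Not at hcon
    have : u ∈ piece S r v (some u) := he ▸ ⟨hw u rfl, hcon⟩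
    exact this.2 u rfl (isAncestor_refl hS u)
  cases hw : w with
  | none =>
    cases hw' : w' with
    | none => rfl
    | some u' =>
      obtain ⟨u, hu, -⟩ := key he.symm h'.1 hw'
      rw [hw] at hu
      cases hu
  | some u =>
    obtain ⟨u', hu', h3⟩ := key he h.1 hw
    obtain ⟨u'', hu'', h4⟩ := key he.symm h'.1 hu'
    obtain rfl : u = u'' := Option.some.inj (hw ▸ hu'')
    rw [hu', h3.antisymm hS h4]

/-- An edge that enters the subtree of `c` from outside must end in `c`, which has been deleted.
Connectedness holds because paths downward from `v` to nodes outside that subtree avoid it. -/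
theorem isComponentAfterRemoval_up {v c : V} {w : Option V} (hc : c ∈ piece S r v w)
    (hcw : IsPieceIndex S r c w) (hcv : c ≠ v) :
    IsComponentAfterRemoval S (piece S r v w) c (piece S r v (some c)) := by
  have hmem : ∀ x, x ∈ piece S r v (some c) ↔ IsAncestor S r v x ∧ ¬ IsAncestor S r c x :=
    fun x => mem_piece_some
  have hsub : piece S r v (some c) ⊆ piece S r v w \ {c} := by
    intro x hx
    rw [hmem] at hx
    refine ⟨⟨hx.1, fun w' hw h => hx.2 ((hcw w' hw).trans hS h)⟩, ?_⟩
    rintro rfl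
    exact hx.2 (isAncestor_refl hS x)
  have hv : v ∈ piece S r v (some c) :=
    (hmem v).2 ⟨isAncestor_refl hS v, fun h => hcv (h.antisymm hS hc.1)⟩
  refine isComponentAfterRemoval_of hsub hv (fun a ha b hb hab => ?_) fun x hx => ?_
  · rw [hmem] at ha ⊢
    refine ⟨hb.1.1, fun hcb => ha.2 ?_⟩
    rcases isAncestor_of_adj (r := r) hS hab with h | h
    · exact (h.of_adj hS hab hcb).resolve_left fun e => hb.2 e.symm
    · exact hcb.trans hS h
  · refine reachable_induce hS hx.1 fun y h1 h2 => hsub ((hmem y).2 ⟨h1, fun h => ?_⟩)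
    exact ((hmem x).1 hx).2 (h.trans hS h2)

/-- The lower end of the component below `y`. -/
noncomputable def lowerEnd (S : SimpleGraph V) (r : V) (w : Option V) (y : V) : Option V :=
  open Classical in if IsPieceIndex S r y w then w else none

omit hS in
theorem isPieceIndex_lowerEnd (y : V) (w : Option V) : IsPieceIndex S r y (lowerEnd S r w y) := by
  unfold lowerEnd
  split_ifs with h
  · exact h
  · intro w' hw; cases hw

theorem mem_piece_lowerEnd {v y x : V} {w : Option V} (hy : y ∈ piece S r v w) :
    x ∈ piece S r y (lowerEnd S r w y) ↔ x ∈ piece S r v w ∧ IsAncestor S r y x := by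
  unfold lowerEnd
  split_ifs with h
  · exact ⟨fun hx => ⟨⟨hy.1.trans hS hx.1, hx.2⟩, hx.1⟩, fun hx => ⟨hx.2, hx.1.2⟩⟩
  · rw [mem_piece_none]
    refine ⟨fun hx => ⟨⟨hy.1.trans hS hx, fun w' hw hwx => h ?_⟩, hx⟩, fun hx => hx.2⟩
    intro w'' hw'
    obtain rfl : w' = w'' := Option.mem_unique hw hw'
    exact (hx.total hS hwx).resolve_right (hy.2 w' hw)

/-- The subtree of the child `y` can be left only through the edge from `y` to its parent `c`, and
`c` has been deleted. -/
theorem isComponentAfterRemoval_down {v c y : V} {w : Option V} (hc : c ∈ piece S r v w)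
    (hy : y ∈ piece S r v w) (hcy : S.Adj c y) (hle : IsAncestor S r c y) :
    IsComponentAfterRemoval S (piece S r v w) c (piece S r y (lowerEnd S r w y)) := by
  have hsub : piece S r y (lowerEnd S r w y) ⊆ piece S r v w \ {c} := by
    intro x hx
    rw [mem_piece_lowerEnd hS hy] at hx
    refine ⟨hx.1, ?_⟩
    rintro rfl
    exact hcy.ne (hle.antisymm hS hx.2)
  refine isComponentAfterRemoval_of hsub ((mem_piece_lowerEnd hS hy).2 ⟨hy, isAncestor_refl hS y⟩)
    (fun a ha b hb hab => ?_) fun x hx => ?_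
  · rw [mem_piece_lowerEnd hS hy] at ha ⊢
    refine ⟨hb.1, ?_⟩
    rcases isAncestor_of_adj (r := r) hS hab with h | h
    · exact ha.2.trans hS h
    · rcases h.of_adj hS hab.symm ha.2 with rfl | h'
      -- Here the edge leads from `y` upward to `b`. Both `b` and `c` are adjacent to `y` and above
      -- it, hence equal, contrary to the deletion of `c`.
      · rcases hle.of_adj hS hcy h with rfl | h1
        · exact isAncestor_refl hS _
        · rcases h.of_adj hS hab.symm hle with h2 | h2
          · exact (hcy.ne h2).elim
          · exact (hb.2 (h1.antisymm hS h2)).elim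
      · exact h'
  · rw [mem_piece_lowerEnd hS hy] at hx
    exact reachable_induce hS hx.2 fun z h1 h2 => hsub ((mem_piece_lowerEnd hS hy).2
      ⟨⟨hy.1.trans hS h1, fun w' hw h => hx.1.2 w' hw (h.trans hS h2)⟩, h1⟩)

/-- The child of `c` on the path to its descendant `x`. -/
noncomputable def child (S : SimpleGraph V) (r c x : V) : V :=
  open Classical in
  if h : ∃ y, S.Adj c y ∧ IsAncestor S r c y ∧ IsAncestor S r y x then h.choose else c

theorem child_spec {c x : V} (h : IsAncestor S r c x) (hne : x ≠ c) :
    S.Adj c (child S r c x) ∧ IsAncestor S r c (child S r c x) ∧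
      IsAncestor S r (child S r c x) x := by
  have h' := exists_child hS h hne
  rw [child, dif_pos h']
  exact h'.choose_spec

theorem child_ne {c x : V} (h : IsAncestor S r c x) (hne : x ≠ c) : child S r c x ≠ c :=
  (child_spec hS h hne).1.ne'

/-- Ancestors of `x` form a chain, and nothing lies strictly between a node and its child. Hence the
chosen child is the only one above `x`, and it can be found by search. -/
theorem child_isAncestor {c x z : V} (h : IsAncestor S r c x) (hne : x ≠ c)
    (hcz : IsAncestor S r c z) (hzc : z ≠ c) (hzx : IsAncestor S r z x) :
    IsAncestor S r (child S r c x) z := by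
  obtain ⟨h1, h2, h3⟩ := child_spec hS h hne
  rcases h3.total hS hzx with h' | h'
  · exact h'
  · rcases h2.of_adj hS h1 h' with rfl | h''
    · exact isAncestor_refl hS _
    · exact (hzc (h''.antisymm hS hcz)).elim

/-- The component which contains `x` after the removal of the center `c` of `S_{v,w}`. -/
noncomputable def nextPiece (S : SimpleGraph V) (r v : V) (w : Option V) (c x : V) : V × Option V :=
  open Classical in
  if IsAncestor S r c x then (child S r c x, lowerEnd S r w (child S r c x)) else (v, some c)

theorem nextPiece_spec {v c x : V} {w : Option V} (hc : c ∈ piece S r v w)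
    (hcw : IsPieceIndex S r c w) (hx : x ∈ piece S r v w) (hxc : x ≠ c) :
    IsPieceIndex S r (nextPiece S r v w c x).1 (nextPiece S r v w c x).2 ∧
    IsComponentAfterRemoval S (piece S r v w) c
      (piece S r (nextPiece S r v w c x).1 (nextPiece S r v w c x).2) ∧
    x ∈ piece S r (nextPiece S r v w c x).1 (nextPiece S r v w c x).2 := by
  unfold nextPiece
  split_ifs with h
  · obtain ⟨h1, h2, h3⟩ := child_spec hS h hxc
    have hy : child S r c x ∈ piece S r v w :=
      ⟨hc.1.trans hS h2, fun w' hw hw' => hx.2 w' hw (hw'.trans hS h3)⟩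
    exact ⟨isPieceIndex_lowerEnd _ _, isComponentAfterRemoval_down hS hc hy h1 h2,
      (mem_piece_lowerEnd hS hy).2 ⟨hx, h3⟩⟩
  · refine ⟨fun w' hw => ?_, isComponentAfterRemoval_up hS hc hcw ?_, mem_piece_some.2 ⟨hx.1, h⟩⟩
    · obtain rfl : c = w' := Option.some.inj hw
      exact hc.1
    · rintro rfl
      exact h hx.1

/-- Every component left after the removal of a center is of the form `S_{v,w}`. -/
theorem IsComponentAfterRemoval.eq_nextPiece {v c x : V} {w : Option V} {B : Set V}
    (hB : IsComponentAfterRemoval S (piece S r v w) c B) (hc : c ∈ piece S r v w)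
    (hcw : IsPieceIndex S r c w) (hx : x ∈ B) :
    B = piece S r (nextPiece S r v w c x).1 (nextPiece S r v w c x).2 := by
  obtain ⟨h1, h2⟩ := hB.subset hx
  obtain ⟨-, h4, h5⟩ := nextPiece_spec hS hc hcw h1 h2
  exact hB.unique h4 hx h5

end Components

/-! ### Centers -/

section Centers

variable {V : Type*} {S : SimpleGraph V} {r : V}

theorem lowerEnd_none (S : SimpleGraph V) (r y : V) : lowerEnd S r none y = none := by
  simp [lowerEnd]

variable [Finite V] (hS : S.IsTree)
include hS

theorem ncard_piece_add {v c : V} {w : Option V} (hvc : IsAncestor S r v c)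
    (hcw : IsPieceIndex S r c w) :
    (piece S r v (some c)).ncard + (piece S r c w).ncard = (piece S r v w).ncard := by
  rw [← Set.ncard_union_eq _ (Set.toFinite _) (Set.toFinite _)]
  · congr 1
    ext x
    rw [Set.mem_union, mem_piece_some]
    refine ⟨?_, fun hx => ?_⟩
    · rintro (⟨h1, h2⟩ | h)
      · exact ⟨h1, fun w' hw h => h2 ((hcw w' hw).trans hS h)⟩
      · exact ⟨hvc.trans hS h.1, h.2⟩
    · by_cases h : IsAncestor S r c x
      · exact .inr ⟨h, hx.2⟩
      · exact .inl ⟨hx.1, h⟩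
  · rw [Set.disjoint_left]
    intro x hx hx'
    exact (mem_piece_some.1 hx).2 hx'.1

theorem ncard_piece_le {x y : V} {w : Option V} (h : IsAncestor S r x y) :
    (piece S r y w).ncard ≤ (piece S r x w).ncard :=
  Set.ncard_le_ncard (fun _ hz => ⟨h.trans hS hz.1, hz.2⟩) (Set.toFinite _)

omit [Finite V] hS in
theorem piece_self (v : V) : piece S r v (some v) = ∅ := by
  ext x
  simp [mem_piece_some]

/-- The components are the part above `c` and the subtrees of its children. By monotonicity the
children may be replaced by all proper descendants, which leaves a condition on ancestors and sizes
only, fit for a program. -/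
theorem isBalancedNode_iff {v c : V} : IsBalancedNode S (piece S r v none) c ↔
    IsAncestor S r v c ∧
      2 * (piece S r v (some c)).ncard ≤ (piece S r v none).ncard ∧
      ∀ x, IsAncestor S r c x → x ≠ c →
        2 * (piece S r x none).ncard ≤ (piece S r v none).ncard := by
  have hnone : IsPieceIndex S r c none := fun _ h => by cases h
  constructor
  · rintro ⟨hc, h⟩
    refine ⟨hc.1, ?_, fun x hcx hxc => ?_⟩
    · by_cases hcv : c = v
      · rw [hcv, piece_self]; simp
      · exact h _ (isComponentAfterRemoval_up hS hc hnone hcv)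
    · obtain ⟨h1, h2, h3⟩ := child_spec hS hcx hxc
      have := h _ (isComponentAfterRemoval_down hS hc (mem_piece_none.2 (hc.1.trans hS h2)) h1 h2)
      rw [lowerEnd_none] at this
      exact (Nat.mul_le_mul_left 2 (ncard_piece_le hS h3)).trans this
  · rintro ⟨hc, h1, h2⟩
    refine ⟨mem_piece_none.2 hc, fun B hB => ?_⟩
    obtain ⟨x, hx⟩ := hB.nonempty
    have hxc : x ≠ c := (hB.subset hx).2
    rw [hB.eq_nextPiece hS (mem_piece_none.2 hc) hnone hx]
    unfold nextPiece
    split_ifs with hcx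
    · rw [lowerEnd_none]
      exact h2 _ (child_spec hS hcx hxc).2.1 (child_ne hS hcx hxc)
    · exact h1

/-- Take `c` with the smallest subtree among the nodes whose subtree contains more than half of
`S_v`; the node `v` itself qualifies. The part above `c` is then less than half, and no proper
descendant exceeds half. -/
theorem exists_isBalancedNode (v : V) : ∃ c, IsBalancedNode S (piece S r v none) c := by
  obtain ⟨c, ⟨hc1, hc2⟩, hmin⟩ := Set.exists_min_image
    {c | IsAncestor S r v c ∧ (piece S r v none).ncard < 2 * (piece S r c none).ncard}
    (fun c => (piece S r c none).ncard) (Set.toFinite _) ⟨v, isAncestor_refl hS v, by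
      have : 0 < (piece S r v none).ncard := (Set.ncard_pos (Set.toFinite _)).2
        ⟨v, mem_piece_none.2 (isAncestor_refl hS v)⟩
      omega⟩
  refine ⟨c, (isBalancedNode_iff hS).2 ⟨hc1, ?_, fun x hcx hxc => ?_⟩⟩
  · have := ncard_piece_add hS hc1 (w := none) (fun _ h => by cases h)
    omega
  · by_contra hcon
    have h1 := hmin x ⟨hc1.trans hS hcx, not_le.1 hcon⟩
    have h2 : (piece S r x none).ncard < (piece S r c none).ncard := by
      refine Set.ncard_lt_ncard ⟨fun z hz => ?_, fun h => ?_⟩ (Set.toFinite _)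
      · exact mem_piece_none.2 (hcx.trans hS (mem_piece_none.1 hz))
      · exact hxc ((mem_piece_none.1 (h (mem_piece_none.2 (isAncestor_refl hS c)))).antisymm hS hcx)
    omega

omit [Finite V] in
theorem isAncestor_getVert {v w : V} (h : IsAncestor S r v w) {p : S.Walk v w} (hp : p.IsPath)
    {i j : ℕ} (hij : i ≤ j) : IsAncestor S r (p.getVert i) (p.getVert j) := by
  obtain ⟨q, hq⟩ := exists_isPath hS r v
  have hpq := h.append_isPath hS hq hp
  have h1 : (q.append (p.take j)).IsPath := by
    rw [← p.append_take_drop_eq j, SimpleGraph.Walk.append_assoc] at hpq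
    exact hpq.of_append_left
  refine ⟨_, h1, ?_⟩
  rw [SimpleGraph.Walk.mem_support_append_iff]
  right
  have := (p.take j).getVert_mem_support i
  rwa [SimpleGraph.Walk.take_getVert, min_eq_right hij] at this

omit [Finite V] in
theorem exists_getVert_eq {v w x : V} (h : IsAncestor S r v w) {p : S.Walk v w} (hp : p.IsPath)
    (hvx : IsAncestor S r v x) (hxw : IsAncestor S r x w) :
    ∃ i ≤ p.length, p.getVert i = x := by
  obtain ⟨q, hq⟩ := exists_isPath hS r v
  have hx := hxw.mem_support hS.isAcyclic (h.append_isPath hS hq hp)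
  rw [SimpleGraph.Walk.mem_support_append_iff] at hx
  rcases hx with hx | hx
  · exact ⟨0, Nat.zero_le _, by simpa using hvx.antisymm hS ⟨q, hq, hx⟩⟩
  · obtain ⟨i, h1, h2⟩ := SimpleGraph.Walk.mem_support_iff_exists_getVert.1 hx
    exact ⟨i, h2, h1⟩

variable [LinearOrder V]

/-- The path from `v` to `w` is the interval between them, and the sizes `|S_{x,w}|` decrease along
it. So the condition on the next node extends to all later ones, and minimality of the index means
that `c` is the first node or that `S_{c,w}` is still larger than half. -/
theorem isCenter_some_iff {v w c : V} (hvw : IsAncestor S r v w) : IsCenter S r v (some w) c ↔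
    IsAncestor S r v c ∧ IsAncestor S r c w ∧ c ≠ w ∧
      (∀ x, IsAncestor S r c x → x ≠ c → IsAncestor S r x w →
        2 * (piece S r x (some w)).ncard ≤ (piece S r v (some w)).ncard) ∧
      (c = v ∨ (piece S r v (some w)).ncard < 2 * (piece S r c (some w)).ncard) := by
  constructor
  · rintro ⟨p, i, hp, rfl, ⟨hi, h2⟩, hmin⟩
    have hmono : ∀ {i j : ℕ}, i ≤ j → IsAncestor S r (p.getVert i) (p.getVert j) :=
      fun h => isAncestor_getVert hS hvw hp h
    have hinj := hp.getVert_injOn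
    have hv : IsAncestor S r v (p.getVert i) := by simpa using hmono (Nat.zero_le i)
    refine ⟨hv, by simpa using hmono hi.le, ?_, fun x h3 h4 h5 => ?_, ?_⟩
    · intro h
      rw [hp.getVert_eq_end_iff hi.le] at h
      omega
    · obtain ⟨j, hj, rfl⟩ := exists_getVert_eq hS hvw hp (hv.trans hS h3) h5
      have hij : i + 1 ≤ j := by
        by_contra hcon
        exact h4 ((hmono (by omega)).antisymm hS h3)
      exact (Nat.mul_le_mul_left 2 (ncard_piece_le hS (hmono hij))).trans h2
    · by_cases hi0 : i = 0
      · left; simp [hi0]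
      · right
        by_contra hcon
        have := hmin (a := i - 1) ⟨by omega, by
          rw [Nat.sub_add_cancel (by omega)]; exact not_lt.1 hcon⟩
        omega
  · rintro ⟨h1, h2, h3, h4, h5⟩
    obtain ⟨p, hp⟩ := exists_isPath hS v w
    have hmono : ∀ {i j : ℕ}, i ≤ j → IsAncestor S r (p.getVert i) (p.getVert j) :=
      fun h => isAncestor_getVert hS hvw hp h
    obtain ⟨i, hi, rfl⟩ := exists_getVert_eq hS hvw hp h1 h2
    have hi' : i < p.length := by
      refine lt_of_le_of_ne hi ?_
      rintro rfl
      simp at h3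
    refine ⟨p, i, hp, rfl, ⟨hi', h4 _ (hmono (Nat.le_succ i)) (p.adj_getVert_succ hi').ne' ?_⟩, ?_⟩
    · simpa using hmono (i := i + 1) (j := p.length) hi'
    · rintro j ⟨hj, hj'⟩
      by_contra hcon
      rcases h5 with h5 | h5
      · rw [hp.getVert_eq_start_iff hi] at h5
        omega
      · have := ncard_piece_le (w := some w) hS (hmono (show j + 1 ≤ i by omega))
        omega

theorem IsCenter.mem {v c : V} {w : Option V} (hv : IsPieceIndex S r v w)
    (h : IsCenter S r v w c) : c ∈ piece S r v w ∧ IsPieceIndex S r c w := by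
  cases w with
  | none => exact ⟨h.1.1, fun _ h => by cases h⟩
  | some w =>
    obtain ⟨h1, h2, h3, -⟩ := (isCenter_some_iff hS (hv w rfl)).1 h
    refine ⟨mem_piece_some.2 ⟨h1, fun h => h3 (h2.antisymm hS h)⟩, fun w' hw => ?_⟩
    obtain rfl : w = w' := Option.some.inj hw
    exact h2

theorem IsProper.existsUnique_isCenter {v : V} {w : Option V} (h : IsProper S r v w) :
    ∃! c, IsCenter S r v w c := by
  refine existsUnique_of_exists_of_unique ?_ ?_
  · cases w with
    | none =>
      obtain ⟨c, hc⟩ := exists_isBalancedNode (r := r) hS v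
      obtain ⟨c, hc, hmin⟩ := Set.exists_min_image {x | IsBalancedNode S (piece S r v none) x} id
        (Set.toFinite _) ⟨c, hc⟩
      exact ⟨c, hc, fun x hx => hmin x hx⟩
    | some w =>
      obtain ⟨p, hp⟩ := exists_isPath hS v w
      have hne : v ≠ w := by
        rintro rfl
        obtain ⟨x, hx⟩ := h.2
        rw [piece_self] at hx
        exact hx
      have hlen : 0 < p.length := by
        exact Nat.pos_of_ne_zero fun h => hne (SimpleGraph.Walk.eq_of_length_eq_zero h)
      classical
      have hex : ∃ j, j < p.length ∧
          2 * (piece S r (p.getVert (j + 1)) (some w)).ncard ≤ (piece S r v (some w)).ncard := by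
        -- The last admissible index always works, because `S_{w,w}` is empty.
        refine ⟨p.length - 1, by omega, ?_⟩
        rw [Nat.sub_add_cancel hlen, p.getVert_length, piece_self]
        simp
      exact ⟨_, p, Nat.find hex, hp, rfl, Nat.find_spec hex, fun j hj => Nat.find_min' hex hj⟩
  · intro c c' hc hc'
    cases w with
    | none => exact hc.unique hc'
    | some w =>
      obtain ⟨p, i, hp, rfl, hi⟩ := hc
      obtain ⟨p', i', hp', rfl, hi'⟩ := hc'
      obtain rfl := (hS.existsUnique_path v w).unique hp hp'
      rw [hi.unique hi']

/-- The center of `S_{v,w}` as a function. -/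
noncomputable def center (S : SimpleGraph V) (r v : V) (w : Option V) : V :=
  open Classical in if h : ∃ c, IsCenter S r v w c then h.choose else v

theorem IsProper.isCenter {v : V} {w : Option V} (h : IsProper S r v w) :
    IsCenter S r v w (center S r v w) := by
  have := (h.existsUnique_isCenter hS).exists
  rw [center, dif_pos this]
  exact this.choose_spec

theorem IsProper.center_eq_iff {v c : V} {w : Option V} (h : IsProper S r v w) :
    center S r v w = c ↔ IsCenter S r v w c :=
  ⟨fun e => e ▸ h.isCenter hS, fun hc => (h.existsUnique_isCenter hS).unique (h.isCenter hS) hc⟩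

/-- The component which contains `x` after the removal of the center. -/
noncomputable def nextOf (S : SimpleGraph V) (r v : V) (w : Option V) (x : V) : V × Option V :=
  nextPiece S r v w (center S r v w) x

theorem IsProper.nextOf_spec {v x : V} {w : Option V} (h : IsProper S r v w)
    (hx : x ∈ piece S r v w) (hxc : x ≠ center S r v w) :
    IsPieceIndex S r (nextOf S r v w x).1 (nextOf S r v w x).2 ∧
    IsComponentAfterRemoval S (piece S r v w) (center S r v w)
      (piece S r (nextOf S r v w x).1 (nextOf S r v w x).2) ∧
    x ∈ piece S r (nextOf S r v w x).1 (nextOf S r v w x).2 :=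
  nextPiece_spec hS ((h.isCenter hS).mem hS h.1).1 ((h.isCenter hS).mem hS h.1).2 hx hxc

theorem IsProper.nextOf {v x : V} {w : Option V} (h : IsProper S r v w)
    (hx : x ∈ piece S r v w) (hxc : x ≠ center S r v w) :
    IsProper S r (nextOf S r v w x).1 (nextOf S r v w x).2 :=
  ⟨(h.nextOf_spec hS hx hxc).1, _, (h.nextOf_spec hS hx hxc).2.2⟩

theorem IsProper.ncard_nextOf_lt {v x : V} {w : Option V} (h : IsProper S r v w)
    (hx : x ∈ piece S r v w) (hxc : x ≠ center S r v w) :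
    (piece S r (WorkingTree.nextOf S r v w x).1 (WorkingTree.nextOf S r v w x).2).ncard <
      (piece S r v w).ncard := by
  have h1 := (h.nextOf_spec hS hx hxc).2.1.subset
  refine Set.ncard_lt_ncard ⟨fun z hz => (h1 hz).1, fun h2 => ?_⟩ (Set.toFinite _)
  exact (h1 (h2 ((h.isCenter hS).mem hS h.1).1)).2 rfl

/-- For a path center `c` the part towards `w` is at most half by the choice of `c`, and so is the
part above, because `S_{c,w}` is larger than half unless `c = v`. Only subtrees hanging off the path
at `c` may be larger, and these have no lower end. -/
theorem IsProper.ncard_nextOf {v x : V} {w : Option V} (h : IsProper S r v w)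
    (hx : x ∈ piece S r v w) (hxc : x ≠ center S r v w) :
    2 * (piece S r (WorkingTree.nextOf S r v w x).1 (WorkingTree.nextOf S r v w x).2).ncard ≤
      (piece S r v w).ncard ∨ w ≠ none ∧ (WorkingTree.nextOf S r v w x).2 = none := by
  have hcen := h.isCenter hS
  cases w with
  | none => exact .inl (hcen.1.2 _ (h.nextOf_spec hS hx hxc).2.1)
  | some w =>
    obtain ⟨h1, h2, h3, h4, h5⟩ := (isCenter_some_iff hS (h.1 w rfl)).1 hcen
    unfold WorkingTree.nextOf nextPiece lowerEnd
    split_ifs with hcx hw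
    · obtain ⟨-, k2, k3⟩ := child_spec hS hcx hxc
      exact .inl (h4 _ k2 (child_ne hS hcx hxc) (hw w rfl))
    · exact .inr ⟨by simp, rfl⟩
    · left
      have := ncard_piece_add hS h1 (w := some w) (fun w' hw => by
        obtain rfl : w = w' := Option.some.inj hw
        exact h2)
      rcases h5 with h5 | h5
      · exact absurd hx.1 (h5 ▸ hcx)
      · dsimp only; omega

/-- A quantity which decreases from each component to the next. -/
noncomputable def potential (S : SimpleGraph V) (r v : V) (w : Option V) : ℕ :=
  2 * Nat.log 2 (piece S r v w).ncard + if w = none then 0 else 1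

/-- Halving lowers the doubled logarithm by at least `2`, which outweighs the possible gain of `1`
from a new lower end. Without halving the lower end is lost, and the size does not increase. -/
theorem IsProper.potential_nextOf_lt {v x : V} {w : Option V} (h : IsProper S r v w)
    (hx : x ∈ piece S r v w) (hxc : x ≠ center S r v w) :
    potential S r (WorkingTree.nextOf S r v w x).1 (WorkingTree.nextOf S r v w x).2 <
      potential S r v w := by
  have h1 := h.ncard_nextOf_lt hS hx hxc
  have h2 := h.ncard_nextOf hS hx hxc
  have h3 := (Set.ncard_pos (Set.toFinite _)).2 (h.nextOf hS hx hxc).2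
  generalize WorkingTree.nextOf S r v w x = z at h1 h2 h3
  unfold potential
  generalize (piece S r z.1 z.2).ncard = b at h1 h2 h3
  generalize (piece S r v w).ncard = a at h1 h2
  have hmono := Nat.log_mono_right (b := 2) h1.le
  rcases h2 with h2 | ⟨hw, hz⟩
  · have := Nat.log_mono_right (b := 2) h2
    rw [mul_comm, Nat.log_mul_base (by norm_num) h3.ne'] at this
    split_ifs <;> omega
  · rw [if_pos hz, if_neg hw]
    omega

-- The factor `3` absorbs the summand `1`: a lower end lies outside its nonempty component, so there
-- are at least two nodes and the logarithm of their number is at least `1`.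
omit [LinearOrder V] in
theorem IsProper.potential_le {v : V} {w : Option V} (h : IsProper S r v w) :
    potential S r v w ≤ 3 * Nat.log 2 (Nat.card V) := by
  have h1 := Set.ncard_le_card (piece S r v w)
  have h2 := Nat.log_mono_right (b := 2) h1
  unfold potential
  cases w with
  | none => rw [if_pos rfl]; omega
  | some w =>
    have h3 : (piece S r v (some w)).ncard < Nat.card V := by
      rw [← Set.ncard_univ]
      refine Set.ncard_lt_ncard ⟨Set.subset_univ _, fun hu => ?_⟩ (Set.toFinite _)
      exact (mem_piece_some.1 (hu (Set.mem_univ w))).2 (isAncestor_refl hS w)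
    have h4 := (Set.ncard_pos (Set.toFinite _)).2 h.2
    have h5 := Nat.log_mono_right (b := 2) (show 2 ≤ Nat.card V by omega)
    have h6 : Nat.log 2 2 = 1 := by norm_num
    rw [if_neg (by simp)]
    omega

end Centers

/-! ### The sequence of components which contain a given node -/

section Trace

variable {V : Type*} [LinearOrder V] {S : SimpleGraph V} {r : V}

/-- From the component which contains `x` to the next smaller one, unless `x` is the center. -/
noncomputable def nextStage (S : SimpleGraph V) (r x : V) (s : Option V × V × Option V) :
    Option V × V × Option V :=
  if x = center S r s.2.1 s.2.2 then s
  else (some (center S r s.2.1 s.2.2), nextOf S r s.2.1 s.2.2 x)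

/-- The stages of the construction whose components contain `x`. -/
noncomputable def trace (S : SimpleGraph V) (r x : V) (t : ℕ) : Option V × V × Option V :=
  (nextStage S r x)^[t] (none, r, none)

theorem trace_succ (x : V) (t : ℕ) :
    trace S r x (t + 1) = nextStage S r x (trace S r x t) :=
  Function.iterate_succ_apply' _ _ _

/-- The center of the component at the given time. -/
noncomputable def traceCenter (S : SimpleGraph V) (r x : V) (t : ℕ) : V :=
  center S r (trace S r x t).2.1 (trace S r x t).2.2

/-- The component at the given time. -/
def tracePiece (S : SimpleGraph V) (r x : V) (t : ℕ) : Set V :=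
  piece S r (trace S r x t).2.1 (trace S r x t).2.2

theorem trace_succ_of_eq {x : V} {t : ℕ} (h : x = traceCenter S r x t) :
    trace S r x (t + 1) = trace S r x t := by
  rw [trace_succ, nextStage]; exact if_pos h

theorem trace_succ_of_ne {x : V} {t : ℕ} (h : x ≠ traceCenter S r x t) :
    trace S r x (t + 1) = (some (traceCenter S r x t),
      nextOf S r (trace S r x t).2.1 (trace S r x t).2.2 x) := by
  rw [trace_succ, nextStage]; exact if_neg h

theorem trace_add_of_eq {x : V} {t : ℕ} (h : x = traceCenter S r x t) (k : ℕ) :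
    trace S r x (t + k) = trace S r x t := by
  induction k with
  | zero => rfl
  | succ k ih =>
    rw [← add_assoc, trace_succ_of_eq, ih]
    rwa [traceCenter, ih]

variable [Finite V] (hS : S.IsTree)
include hS

omit [Finite V] in
theorem Stage.isProper {q : Option V} {v : V} {w : Option V} (h : Stage S r q v w) :
    IsProper S r v w := by
  cases h with
  | init => exact ⟨fun _ h => (by cases h), r, mem_piece_none.2 (isAncestor_refl hS r)⟩
  | step _ _ h1 h2 => exact ⟨h1, h2.nonempty⟩

theorem trace_spec (x : V) (t : ℕ) :
    Stage S r (trace S r x t).1 (trace S r x t).2.1 (trace S r x t).2.2 ∧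
      x ∈ tracePiece S r x t := by
  induction t with
  | zero => exact ⟨.init, mem_piece_none.2 (isAncestor_root hS x)⟩
  | succ t ih =>
    unfold tracePiece at ih ⊢
    by_cases h : x = traceCenter S r x t
    · rwa [trace_succ_of_eq h]
    · rw [trace_succ_of_ne h]
      have hp := ih.1.isProper hS
      obtain ⟨h1, h2, h3⟩ := hp.nextOf_spec hS ih.2 h
      exact ⟨.step ih.1 (hp.isCenter hS) h1 h2, h3⟩

theorem trace_isProper (x : V) (t : ℕ) :
    IsProper S r (trace S r x t).2.1 (trace S r x t).2.2 :=
  (trace_spec hS x t).1.isProper hS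

theorem trace_isCenter (x : V) (t : ℕ) :
    IsCenter S r (trace S r x t).2.1 (trace S r x t).2.2 (traceCenter S r x t) :=
  (trace_isProper hS x t).isCenter hS

/-- The recursion branches, but only one of the new components contains `x`. By uniqueness of the
pair `(v,w)` it is named as in the trace. -/
theorem Stage.exists_trace_eq {q : Option V} {v x : V} {w : Option V} (h : Stage S r q v w)
    (hx : x ∈ piece S r v w) : ∃ t, trace S r x t = (q, v, w) := by
  induction h with
  | init => exact ⟨0, rfl⟩
  | @step q v w c v₁ w₁ hst hc h1 h2 ih =>
    obtain ⟨hxv, hxc⟩ := h2.subset hx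
    obtain ⟨t, ht⟩ := ih hxv
    have hp := hst.isProper hS
    obtain rfl := (hp.center_eq_iff hS).2 hc
    refine ⟨t + 1, ?_⟩
    have hne : x ≠ traceCenter S r x t := by rw [traceCenter, ht]; exact hxc
    rw [trace_succ_of_ne hne, traceCenter, ht]
    obtain ⟨k1, k2, k3⟩ := hp.nextOf_spec hS hxv hxc
    obtain ⟨e1, e2⟩ := (show IsProper S r v₁ w₁ from ⟨h1, _, hx⟩).unique hS
      (hp.nextOf hS hxv hxc) (h2.unique k2 hx k3)
    exact congrArg (Prod.mk _) (Prod.ext e1.symm e2.symm)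

/-- As long as `x` is not the center, the component shrinks at each step, yet it always contains
`x`. After `Nat.card V` steps no room is left. -/
theorem traceCenter_eq {x : V} {t : ℕ} (ht : Nat.card V ≤ t) : traceCenter S r x t = x := by
  have key : ∀ t, x = traceCenter S r x t ∨ (tracePiece S r x t).ncard + t ≤ Nat.card V := by
    intro t
    induction t with
    | zero => exact .inr (Set.ncard_le_card _)
    | succ t ih =>
      by_cases h : x = traceCenter S r x t
      · left
        rwa [traceCenter, trace_succ_of_eq h]
      · right
        have h1 := ih.resolve_left h
        have h2 := (trace_isProper hS x t).ncard_nextOf_lt hS (trace_spec hS x t).2 h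
        unfold tracePiece at h1 ⊢
        rw [trace_succ_of_ne h]
        dsimp only
        omega
  rcases key t with h | h
  · exact h.symm
  · have := (Set.ncard_pos (Set.toFinite _)).2 ⟨x, (trace_spec (r := r) hS x t).2⟩
    omega

/-- Once `x` is the center the trace is stationary, so every stage with center `x` agrees with the
trace at the fixed time `Nat.card V`. In particular, each node is the center at exactly one stage.
-/
theorem Stage.trace_eq {q : Option V} {v x : V} {w : Option V} (h : Stage S r q v w)
    (hx : IsCenter S r v w x) : trace S r x (Nat.card V) = (q, v, w) := by
  have hp := h.isProper hS
  obtain ⟨t, ht⟩ := h.exists_trace_eq hS (hx.mem hS hp.1).1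
  have hc : x = traceCenter S r x t := by
    rw [traceCenter, ht, (hp.center_eq_iff hS).2 hx]
  rw [← ht, ← trace_add_of_eq (traceCenter_eq hS le_rfl).symm t, add_comm, trace_add_of_eq hc]

theorem parent_iff {x p : V} : Parent S r x p ↔ (trace S r x (Nat.card V)).1 = some p := by
  constructor
  · rintro ⟨v, w, h, hx⟩
    rw [h.trace_eq hS hx]
  · intro h
    refine ⟨_, _, h ▸ (trace_spec hS x _).1, ?_⟩
    have := trace_isCenter (r := r) hS x (Nat.card V)
    rwa [traceCenter_eq hS le_rfl] at this

/-- The component of which `c` is the center. -/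
def pieceOf (S : SimpleGraph V) (r c : V) : Set V := tracePiece S r c (Nat.card V)

theorem mem_pieceOf_self (x : V) : x ∈ pieceOf S r x := (trace_spec hS x _).2

theorem isCenter_pieceOf (x : V) : IsCenter S r (trace S r x (Nat.card V)).2.1
    (trace S r x (Nat.card V)).2.2 x := by
  have := trace_isCenter (r := r) hS x (Nat.card V)
  rwa [traceCenter_eq hS le_rfl] at this

theorem Parent.spec {x p : V} (h : Parent S r x p) :
    pieceOf S r x ⊆ pieceOf S r p ∧
      potential S r (trace S r x (Nat.card V)).2.1 (trace S r x (Nat.card V)).2.2 <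
        potential S r (trace S r p (Nat.card V)).2.1 (trace S r p (Nat.card V)).2.2 := by
  obtain ⟨v, w, h, hx⟩ := h
  have hx' := (hx.mem hS (h.isProper hS).1).1
  have e := h.trace_eq hS hx
  unfold pieceOf tracePiece
  rw [e]
  cases h with
  | @step q v' w' _ _ _ hst hc h1 h2 =>
    have hp := hst.isProper hS
    rw [hst.trace_eq hS hc]
    refine ⟨fun z hz => (h2.subset hz).1, ?_⟩
    obtain ⟨hxv, hxc⟩ := h2.subset hx'
    obtain rfl := (hp.center_eq_iff hS).2 hc
    obtain ⟨k1, k2, k3⟩ := hp.nextOf_spec hS hxv hxc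
    obtain ⟨e1, e2⟩ := (show IsProper S r v w from ⟨h1, _, hx'⟩).unique hS
      (hp.nextOf hS hxv hxc) (h2.unique k2 hx' k3)
    have := hp.potential_nextOf_lt hS hxv hxc
    rwa [← e1, ← e2] at this

theorem eq_or_potential_lt {x y : V} (h : Relation.ReflTransGen (Parent S r) x y) :
    x = y ∨ potential S r (trace S r x (Nat.card V)).2.1 (trace S r x (Nat.card V)).2.2 <
        potential S r (trace S r y (Nat.card V)).2.1 (trace S r y (Nat.card V)).2.2 := by
  induction h with
  | refl => exact .inl rfl
  | tail _ h ih =>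
    have := (h.spec hS).2
    rcases ih with rfl | ih
    · exact .inr this
    · exact .inr (ih.trans this)

theorem traceCenter_reflTransGen (x : V) (t k : ℕ) :
    Relation.ReflTransGen (Parent S r) (traceCenter S r x (t + k)) (traceCenter S r x t) := by
  induction k with
  | zero => exact .refl
  | succ k ih =>
    by_cases h : x = traceCenter S r x (t + k)
    · rwa [← add_assoc, traceCenter, trace_succ_of_eq h]
    · refine .head ⟨_, _, ?_, trace_isCenter hS x (t + (k + 1))⟩ ih
      have := (trace_spec (r := r) hS x (t + (k + 1))).1
      have e : (trace S r x (t + (k + 1))).1 = some (traceCenter S r x (t + k)) := by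
        rw [← add_assoc, trace_succ_of_ne h]
      rwa [e] at this

theorem exists_traceCenter_eq {u c : V} (h : u ∈ pieceOf S r c) : ∃ t, traceCenter S r u t = c := by
  obtain ⟨t, ht⟩ := (trace_spec hS c (Nat.card V)).1.exists_trace_eq hS h
  refine ⟨t, ?_⟩
  have := traceCenter_eq (r := r) (x := c) hS le_rfl
  rwa [traceCenter, ht]

/-- Components only shrink downward, which gives one direction. Conversely, if `u` lies in the
component with center `c`, then `c` occurs among the centers of the trace of `u`, and consecutive
distinct centers of that trace are child and parent. -/
theorem reflTransGen_parent_iff {u c : V} :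
    Relation.ReflTransGen (Parent S r) u c ↔ u ∈ pieceOf S r c := by
  constructor
  · intro h
    induction h with
    | refl => exact mem_pieceOf_self hS u
    | tail _ h ih => exact (h.spec hS).1 ih
  · intro h
    obtain ⟨t, rfl⟩ := exists_traceCenter_eq hS h
    have := traceCenter_reflTransGen (r := r) hS u t (Nat.card V)
    rwa [traceCenter_eq hS (Nat.le_add_left _ _)] at this

/-- The working tree is a rooted tree on all nodes. -/
theorem isRootedTree_parent : ∃ t, IsRoot S r t ∧ IsRootedTree (Parent S r) t := by
  have hr : IsProper S r r none := Stage.init.isProper hS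
  refine ⟨center S r r none, hr.isCenter hS, fun p hp => ?_, fun x hx => ?_, fun x => ?_⟩
  · rw [parent_iff hS, Stage.init.trace_eq hS (hr.isCenter hS)] at hp
    cases hp
  -- For `x` other than the root, the previous center is missing only at time `0`.
  · have key : ∀ t, (trace S r x (t + 1)).1 ≠ none := by
      intro t
      induction t with
      | zero =>
        rw [trace_succ_of_ne hx]
        simp
      | succ t ih =>
        by_cases h : x = traceCenter S r x (t + 1)
        · rwa [trace_succ_of_eq h]
        · rw [trace_succ_of_ne h]
          simp
    have : Nonempty V := ⟨x⟩
    have h1 := key (Nat.card V - 1)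
    rw [Nat.sub_add_cancel Nat.card_pos] at h1
    obtain ⟨p, hp⟩ := Option.ne_none_iff_exists'.1 h1
    refine ⟨p, (parent_iff hS).2 hp, fun p' hp' => ?_⟩
    have hp' := (parent_iff hS).1 hp'
    rw [hp] at hp'
    exact (Option.some.inj hp').symm
  · have := traceCenter_reflTransGen (r := r) hS x 0 (Nat.card V)
    rwa [traceCenter_eq hS (Nat.le_add_left _ _)] at this

/-- The potential rises by at least `1` with each link towards the root and is bounded at the upper
end of the chain. -/
theorem relSeries_length_le (s : RelSeries {e : V × V | Parent S r e.1 e.2}) :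
    s.length ≤ 3 * Nat.log 2 (Nat.card V) := by
  have key : ∀ i : Fin (s.length + 1), i.1 ≤
      potential S r (trace S r (s i) (Nat.card V)).2.1 (trace S r (s i) (Nat.card V)).2.2 := by
    intro i
    induction i using Fin.induction with
    | zero => exact Nat.zero_le _
    | succ i ih =>
      have := (Parent.spec hS (show Parent S r (s i.castSucc) (s i.succ) from s.step i)).2
      simp only [Fin.val_castSucc, Fin.val_succ] at ih ⊢
      omega
  exact (key (Fin.last _)).trans ((trace_isProper hS _ _).potential_le hS)

/-- Choose the smallest component that contains both nodes. Any other common ancestor is also a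
center on the trace of `u`, so the two are comparable, and minimality decides the order. -/
theorem exists_isLCA (u v : V) : ∃ a, IsLCA (Parent S r) u v a := by
  obtain ⟨t, -, -, -, ht⟩ := isRootedTree_parent (r := r) hS
  obtain ⟨c, ⟨hu, hv⟩, hmin⟩ := Set.exists_min_image
    {c | u ∈ pieceOf S r c ∧ v ∈ pieceOf S r c} (fun c => (pieceOf S r c).ncard) (Set.toFinite _)
    ⟨t, (reflTransGen_parent_iff hS).1 (ht u), (reflTransGen_parent_iff hS).1 (ht v)⟩
  refine ⟨c, (reflTransGen_parent_iff hS).2 hu, (reflTransGen_parent_iff hS).2 hv,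
    fun b hub hvb => ?_⟩
  rw [reflTransGen_parent_iff hS] at hub hvb ⊢
  obtain ⟨t₁, h1⟩ := exists_traceCenter_eq hS hu
  obtain ⟨t₂, h2⟩ := exists_traceCenter_eq hS hub
  rcases le_total t₁ t₂ with h | h
  · have h3 := traceCenter_reflTransGen (r := r) hS u t₁ (t₂ - t₁)
    rw [Nat.add_sub_cancel' h, h1, h2] at h3
    have h4 : pieceOf S r b ⊆ pieceOf S r c := fun z hz => by
      rw [← reflTransGen_parent_iff hS] at hz ⊢
      exact hz.trans h3
    rw [Set.eq_of_subset_of_ncard_le h4 (hmin b ⟨hub, hvb⟩) (Set.toFinite _)]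
    exact mem_pieceOf_self hS c
  · have h3 := traceCenter_reflTransGen (r := r) hS u t₂ (t₁ - t₂)
    rw [Nat.add_sub_cancel' h, h1, h2] at h3
    exact (reflTransGen_parent_iff hS).1 h3

theorem IsLCA.unique_of_isTree {u v a b : V} (ha : IsLCA (Parent S r) u v a)
    (hb : IsLCA (Parent S r) u v b) : a = b := by
  have h1 := eq_or_potential_lt hS (ha.2.2 b hb.1 hb.2.1)
  have h2 := eq_or_potential_lt hS (hb.2.2 a ha.1 ha.2.1)
  rcases h1 with h1 | h1
  · exact h1
  · rcases h2 with h2 | h2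
    · exact h2.symm
    · omega

-- Every `S_{v,w}` is connected: go up to `v` and down again.
omit [LinearOrder V] [Finite V] in
theorem exists_walk_piece {v x y : V} {w : Option V} (hx : x ∈ piece S r v w)
    (hy : y ∈ piece S r v w) : ∃ p : S.Walk x y, ∀ z ∈ p.support, z ∈ piece S r v w := by
  have key : ∀ {x}, x ∈ piece S r v w → ∃ p : S.Walk v x, ∀ z ∈ p.support, z ∈ piece S r v w := by
    intro x hx
    obtain ⟨p, hp⟩ := exists_isPath hS r v
    obtain ⟨q, hq⟩ := exists_isPath hS v x
    refine ⟨q, fun z hz => ?_⟩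
    obtain ⟨h1, h2⟩ := isAncestor_of_append (hx.1.append_isPath hS hp hq) hz
    exact ⟨h1, fun w' hw h => hx.2 w' hw (h.trans hS h2)⟩
  obtain ⟨p, hp⟩ := key hx
  obtain ⟨q, hq⟩ := key hy
  refine ⟨p.reverse.append q, fun z hz => ?_⟩
  rw [SimpleGraph.Walk.mem_support_append_iff, SimpleGraph.Walk.support_reverse,
    List.mem_reverse] at hz
  exact hz.elim (hp z) (hq z)

theorem IsLCA.onPath {u v a : V} (ha : IsLCA (Parent S r) u v a) : OnPath S u v a := by
  obtain ⟨p, hp⟩ := exists_isPath hS u v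
  refine ⟨p, hp, ?_⟩
  by_contra hap
  obtain ⟨hu, hv, hmin⟩ := ha
  rw [reflTransGen_parent_iff hS] at hu hv
  have hua : u ≠ a := by rintro rfl; exact hap p.start_mem_support
  have hst := (trace_spec (r := r) hS a (Nat.card V)).1
  have hpr := hst.isProper hS
  have hc := isCenter_pieceOf (r := r) hS a
  have hca := (hpr.center_eq_iff hS).2 hc
  -- The component of `a` is connected, so the unique path between two of its nodes stays inside it;
  -- by assumption the path also avoids `a`.
  have hpA : ∀ z ∈ p.support, z ∈ pieceOf S r a \ {a} := by
    intro z hz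
    obtain ⟨q, hq⟩ := exists_walk_piece hS hu hv
    refine ⟨hq z (OnPath.mem_walk hS.isAcyclic ⟨p, hp, hz⟩ q), ?_⟩
    rintro rfl
    exact hap hz
  obtain ⟨k1, k2, k3⟩ := hpr.nextOf_spec hS hu (hca.symm ▸ hua)
  rw [hca] at k2
  have hv' := k2.mem_of_walk k3 p hpA
  have hst' := hst.step hc k1 k2
  have hcb := (hst'.isProper hS).isCenter hS
  have htr := hst'.trace_eq hS hcb
  -- The path lies in one component left by `a`. Its center `b` is a child of `a` and a common
  -- ancestor, so `a` would have to be below its own child.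
  set b := center S r (nextOf S r (trace S r a (Nat.card V)).2.1
    (trace S r a (Nat.card V)).2.2 u).1 (nextOf S r (trace S r a (Nat.card V)).2.1
    (trace S r a (Nat.card V)).2.2 u).2 with hb
  have hba : Parent S r b a := ⟨_, _, hst', hcb⟩
  have hub : u ∈ pieceOf S r b := by unfold pieceOf tracePiece; rw [htr]; exact k3
  have hvb : v ∈ pieceOf S r b := by unfold pieceOf tracePiece; rw [htr]; exact hv'
  have h1 := eq_or_potential_lt hS (hmin b ((reflTransGen_parent_iff hS).2 hub)
    ((reflTransGen_parent_iff hS).2 hvb))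
  have h2 := (hba.spec hS).2
  rcases h1 with h1 | h1
  · rw [← h1] at h2; exact lt_irrefl _ h2
  · omega

end Trace

/-! ### Traversal of a forest -/

section Tour

open Classical

variable {n : ℕ}

/-- One step of the traversal of a graph: the state `(u, j)` consists of the current node and a
pointer to a node which might be visited next. -/
noncomputable def tourStep (F : SimpleGraph (Fin n)) (s : Fin n × Fin n) : Fin n × Fin n :=
  if F.Adj s.1 s.2 then (s.2, finRotate n s.1) else (s.1, finRotate n s.2)

/-- Write a state reached as `(p, q + 1)`. It came from `(q, p)` if `p` and `q` are adjacent, and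
from `(p, q)` otherwise. Hence the traversal permutes a finite set and returns to its start. -/
theorem tourStep_injective (F : SimpleGraph (Fin n)) : Function.Injective (tourStep F) := by
  rintro ⟨a, b⟩ ⟨c, d⟩ h
  unfold tourStep at h
  split_ifs at h with h1 h2 h2
  all_goals
    simp only [Prod.mk.injEq, EmbeddingLike.apply_eq_iff_eq] at h h1 h2
    obtain ⟨rfl, rfl⟩ := h
  · rfl
  · exact (h2 h1.symm).elim
  · exact (h1 h2.symm).elim
  · rfl

/-- Two neighbors of `v` joined by a walk avoiding `v` would close a cycle, unless they are equal.
-/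
theorem eq_of_walk_avoiding {V : Type*} {F : SimpleGraph V} (hF : F.IsAcyclic) {v j k : V}
    (hj : F.Adj v j) (hk : F.Adj v k) (p : F.Walk j k) (hp : v ∉ p.support) : j = k := by
  have h1 : (SimpleGraph.Walk.cons hj p.bypass).IsPath :=
    p.bypass_isPath.cons fun h => hp (p.support_bypass_subset_support h)
  have h2 : (SimpleGraph.Walk.cons hk .nil).IsPath := by simp [hk.ne]
  have h3 := congrArg Subtype.val ((hF.subsingleton_path v k).elim ⟨_, h1⟩ ⟨_, h2⟩)
  have h4 : j ∈ (SimpleGraph.Walk.cons hj p.bypass).support := by simp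
  rw [show SimpleGraph.Walk.cons hj p.bypass = SimpleGraph.Walk.cons hk .nil from h3] at h4
  simpa [hj.ne'] using h4

/-- If the traversal leaves `v` for `j`, periodicity brings it back. In a forest the first return
must come from `j` itself, and it leaves the pointer just past `j`, as if the branch at `j` had been
skipped. -/
theorem tour_rotate {F : SimpleGraph (Fin n)} (hF : F.IsAcyclic) (v j : Fin n) :
    ∃ t, (tourStep F)^[t] (v, j) = (v, finRotate n j) := by
  by_cases hvj : F.Adj v j
  swap
  · exact ⟨1, by simp [tourStep, hvj]⟩
  have h1 : (tourStep F)^[1] (v, j) = (j, finRotate n v) := by simp [tourStep, hvj]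
  -- The count starts after the first step, when `v` has been left, so that the least `t` with `pos
  -- t` at `v` is the first return.
  set pos : ℕ → Fin n × Fin n := fun t => (tourStep F)^[t + 1] (v, j) with hpos
  have hsucc : ∀ t, pos (t + 1) = tourStep F (pos t) := fun t => Function.iterate_succ_apply' _ _ _
  have hret : ∃ t, (pos t).1 = v := by
    obtain ⟨m, hm, hper⟩ := (tourStep_injective F).mem_periodicPts (v, j)
    refine ⟨m - 1, ?_⟩
    rw [hpos]
    dsimp only
    rw [Nat.sub_add_cancel hm, hper.eq]
  set m := Nat.find hret with hm
  have hmv : (pos m).1 = v := Nat.find_spec hret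
  have hlt : ∀ t < m, (pos t).1 ≠ v := fun t ht => Nat.find_min hret ht
  have h0 : pos 0 = (j, finRotate n v) := h1
  have hwalk : ∀ t < m, ∃ p : F.Walk j (pos t).1, v ∉ p.support := by
    intro t
    induction t with
    | zero =>
      intro ht
      have := hlt 0 ht
      rw [h0] at this ⊢
      exact ⟨.nil, by simpa [eq_comm] using this⟩
    | succ t ih =>
      intro ht
      obtain ⟨p, hp⟩ := ih (by omega)
      have hne := hlt _ ht
      have e := hsucc t
      rw [tourStep] at e
      split_ifs at e with hadj
      · rw [e] at hne ⊢
        exact ⟨p.concat hadj, by simpa [SimpleGraph.Walk.support_concat] using ⟨hp, Ne.symm hne⟩⟩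
      · rw [e]
        exact ⟨p, hp⟩
  obtain ⟨k, hk⟩ : ∃ k, m = k + 1 := Nat.exists_eq_succ_of_ne_zero fun h => hvj.ne' (by
    rw [h, h0] at hmv; exact hmv)
  obtain ⟨p, hp⟩ := hwalk k (by omega)
  have hkv := hlt k (by omega)
  have hs := hsucc k
  rw [← hk, tourStep] at hs
  split_ifs at hs with hadj
  · rw [hs] at hmv
    dsimp only at hmv
    rw [hmv] at hadj
    have := eq_of_walk_avoiding hF hvj hadj.symm p hp
    refine ⟨m + 1, ?_⟩
    change pos m = _
    rw [hs, hmv, ← this]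
  · rw [hs] at hmv
    exact (hkv hmv).elim

theorem tour_pointer {F : SimpleGraph (Fin n)} (hF : F.IsAcyclic) (v j k : Fin n) :
    ∃ t, (tourStep F)^[t] (v, j) = (v, k) := by
  have key : ∀ i : ℕ, ∃ t, (tourStep F)^[t] (v, j) = (v, (finRotate n)^[i] j) := by
    intro i
    induction i with
    | zero => exact ⟨0, rfl⟩
    | succ i ih =>
      obtain ⟨t, ht⟩ := ih
      obtain ⟨u, hu⟩ := tour_rotate hF v ((finRotate n)^[i] j)
      exact ⟨u + t, by rw [Function.iterate_add_apply, ht, hu, Function.iterate_succ_apply']⟩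
  have : NeZero n := v.neZero
  obtain ⟨t, ht⟩ := key (k - j).1
  refine ⟨t, ht.trans ?_⟩
  rw [← finCycle_eq_finRotate_iterate]
  simp [finCycle]

theorem tour_of_reachable {F : SimpleGraph (Fin n)} (hF : F.IsAcyclic) {u x : Fin n}
    (h : F.Reachable u x) (j : Fin n) : ∃ t, ((tourStep F)^[t] (u, j)).1 = x := by
  obtain ⟨p⟩ := h
  induction p generalizing j with
  | nil => exact ⟨0, rfl⟩
  | @cons u v w h _ ih =>
    obtain ⟨t, ht⟩ := tour_pointer hF u j v
    obtain ⟨k, hk⟩ := ih (finRotate n u)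
    refine ⟨k + (1 + t), ?_⟩
    rw [Function.iterate_add_apply, Function.iterate_add_apply, ht]
    simpa [tourStep, h] using hk

theorem reachable_tour (F : SimpleGraph (Fin n)) (u j : Fin n) (t : ℕ) :
    F.Reachable u ((tourStep F)^[t] (u, j)).1 := by
  induction t with
  | zero => exact .refl _
  | succ t ih =>
    rw [Function.iterate_succ_apply', tourStep]
    split_ifs with h
    · exact ih.trans h.reachable
    · exact ih

/-- If the first success came later, two earlier iterates would coincide, and cutting out the loop
between them would give an earlier success. -/
theorem exists_iterate_lt_card {α : Type*} [Fintype α] (f : α → α) (a : α) {P : α → Prop}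
    (h : ∃ t, P (f^[t] a)) : ∃ t < Fintype.card α, P (f^[t] a) := by
  refine ⟨Nat.find h, ?_, Nat.find_spec h⟩
  by_contra hcon
  push Not at hcon
  obtain ⟨i, j, hne, hij⟩ := Fintype.exists_ne_map_eq_of_card_lt
    (fun i : Fin (Fintype.card α + 1) => f^[i.1] a) (by simp)
  wlog hlt : i < j generalizing i j
  · exact this j i hne.symm hij.symm (lt_of_le_of_ne (not_lt.1 hlt) hne.symm)
  have hlt' : i.1 < j.1 := hlt
  have hj := j.2
  refine Nat.find_min h (m := Nat.find h - j.1 + i.1) (by omega) ?_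
  rw [Function.iterate_add_apply]
  rw [hij, ← Function.iterate_add_apply, Nat.sub_add_cancel (by omega)]
  exact Nat.find_spec h

theorem reachable_iff_tour {F : SimpleGraph (Fin n)} (hF : F.IsAcyclic) {u x : Fin n} :
    F.Reachable u x ↔ ∃ t < n * n, ((tourStep F)^[t] (u, u)).1 = x := by
  constructor
  · intro h
    simpa using exists_iterate_lt_card (tourStep F) (u, u) (P := fun s => s.1 = x)
      (tour_of_reachable hF h u)
  · rintro ⟨t, -, rfl⟩
    exact reachable_tour F u u t

/-- The graph with all edges at the node `v` removed. -/
def isolate {V : Type*} (S : SimpleGraph V) (v : V) : SimpleGraph V where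
  Adj a b := S.Adj a b ∧ a ≠ v ∧ b ≠ v
  symm := ⟨fun _ _ h => ⟨h.1.symm, h.2.2, h.2.1⟩⟩
  loopless := ⟨fun _ h => h.1.ne rfl⟩

theorem isolate_reachable_iff {V : Type*} {S : SimpleGraph V} {v a b : V} (ha : a ≠ v) :
    (isolate S v).Reachable a b ↔ ∃ p : S.Walk a b, v ∉ p.support := by
  constructor
  · rintro ⟨p⟩
    induction p with
    | nil => exact ⟨.nil, by simpa using ha.symm⟩
    | cons h _ ih =>
      obtain ⟨q, hq⟩ := ih h.2.2
      exact ⟨.cons h.1 q, by simpa using ⟨ha.symm, hq⟩⟩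
  · rintro ⟨p, hp⟩
    induction p with
    | nil => exact .refl _
    | @cons a c b h q ih =>
      simp only [SimpleGraph.Walk.support_cons, List.mem_cons, not_or] at hp
      have hc : c ≠ v := by rintro rfl; exact hp.2 q.start_mem_support
      have : (isolate S v).Adj a c := ⟨h, ha, hc⟩
      exact this.reachable.trans (ih hc hp.2)

/-- A node `v` other than the root is above `x` exactly if isolating `v` cuts `x` off from the root.
The resulting graph is a forest, so its traversal from the root decides this within `n * n` steps.
-/
theorem isAncestor_iff_tour {S : SimpleGraph (Fin n)} (hS : S.IsTree) {r v x : Fin n} :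
    IsAncestor S r v x ↔
      v = r ∨ ¬ ∃ t < n * n, ((tourStep (isolate S v))^[t] (r, r)).1 = x := by
  have hF : (isolate S v).IsAcyclic := hS.isAcyclic.anti fun _ _ h => h.1
  rw [← reachable_iff_tour hF]
  by_cases hv : v = r
  · subst hv
    simp [isAncestor_root hS]
  · rw [isolate_reachable_iff (Ne.symm hv), isAncestor_iff_forall_walk hS]
    simp [hv]

end Tour

/-! ### The input words -/

section Words

theorem getElem?_flatMap {α β : Type*} (f : α → List β) {k : ℕ} (hk : ∀ a, (f a).length = k)
    (l : List α) {i j : ℕ} (hi : i < l.length) (hj : j < k) :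
    (l.flatMap f)[i * k + j]? = (f l[i])[j]? := by
  induction l generalizing i with
  | nil => simp at hi
  | cons a l ih =>
    rw [List.flatMap_cons]
    cases i with
    | zero =>
      rw [List.getElem?_append_left (by rw [hk]; omega)]
      simp
    | succ i =>
      rw [List.getElem?_append_right (by rw [hk, Nat.succ_mul]; omega), hk,
        show (i + 1) * k + j - k = i * k + j by rw [Nat.succ_mul]; omega,
        ih (by simpa using hi)]
      simp

theorem length_encodeRow {n : ℕ} (P : Fin n → Prop) : (encodeRow P).length = n + 1 := by
  simp [encodeRow]

theorem length_encodeRel {n : ℕ} (R : Fin n → Fin n → Prop) :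
    (encodeRel R).length = n * (n + 1) := by
  simp [encodeRel, List.length_flatMap, length_encodeRow]

open Classical in
theorem getElem?_encodeRow {n : ℕ} (P : Fin n → Prop) (j : Fin n) :
    (encodeRow P)[j.1]? = some (some (decide (P j))) := by
  rw [encodeRow, List.getElem?_append_left (by simp)]
  simp

theorem getElem?_encodeRow_end {n : ℕ} (P : Fin n → Prop) : (encodeRow P)[n]? = some none := by
  rw [encodeRow, List.getElem?_append_right (by simp)]
  simp

open Classical in
theorem getElem?_encodeRel {n : ℕ} (R : Fin n → Fin n → Prop) (i j : Fin n) :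
    (encodeRel R)[i.1 * (n + 1) + j.1]? = some (some (decide (R i j))) := by
  rw [encodeRel, getElem?_flatMap _ (fun i => length_encodeRow (R i)) _ (by simp) (by omega)]
  simp [getElem?_encodeRow]

open Classical in
theorem inputCell_encodeRel {n : ℕ} (R : Fin n → Fin n → Prop) (l : List (Option Bool))
    (i j : Fin n) :
    inputCell (encodeRel R ++ l) (i.1 * (n + 1) + j.1 + 1) = .letter (some (decide (R i j))) := by
  have : i.1 * (n + 1) + j.1 < n * (n + 1) := by
    have h1 := i.2
    have h2 := j.2
    calc i.1 * (n + 1) + j.1 < i.1 * (n + 1) + (n + 1) := by omega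
      _ = (i.1 + 1) * (n + 1) := by ring
      _ ≤ n * (n + 1) := Nat.mul_le_mul_right _ h1
  rw [inputCell, List.getElem?_append_left (by rwa [length_encodeRel]), getElem?_encodeRel]

theorem inputCell_encodeRel_end {n : ℕ} (R : Fin n → Fin n → Prop) (l : List (Option Bool))
    (hn : 0 < n) : inputCell (encodeRel R ++ l) (n + 1) = .letter none := by
  have h1 : n < n * (n + 1) := by nlinarith
  have h2 := getElem?_flatMap (fun i => encodeRow (R i)) (fun i => length_encodeRow (R i))
    (List.finRange n) (i := 0) (j := n) (by simpa using hn) (by omega)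
  rw [inputCell, List.getElem?_append_left (by rwa [length_encodeRel])]
  rw [zero_mul, zero_add, getElem?_encodeRow_end] at h2
  rw [encodeRel, h2]

end Words

/-! ### Bounded search, counting and arithmetic -/

section Search

open Classical

variable {E ι : Type*} {Γ : E → Inp ι}

theorem LComp.lift {f : E → ℕ} (h : LComp Γ f) (n : E → ℕ) :
    LComp (finCtx Γ n) fun p => f p.1 :=
  h.comap Sigma.fst some (fun _ => rfl) fun _ _ => rfl

theorem LComp.last (Γ : E → Inp ι) (n : E → ℕ) : LComp (finCtx Γ n) fun p => (p.2 : ℕ) :=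
  (LComp.var none).congr fun _ => rfl

/-! ### Values available inside a loop -/

section Loop

variable {m : ℕ} {Z : E → ℕ → Fin m → ℕ} {D : E → ℕ → Prop}

theorem LComp.liftLoop {f : E → ℕ} (h : LComp Γ f) : LComp (loopCtx Γ Z D) fun p => f p.1.1 :=
  h.comap (fun p : {p : E × ℕ // D p.1 p.2} => p.1.1) Sum.inl (fun _ => rfl) fun _ _ => rfl

theorem LComp.index (Γ : E → Inp ι) (Z : E → ℕ → Fin m → ℕ) (D : E → ℕ → Prop) :
    LComp (loopCtx Γ Z D) fun p => p.1.2 :=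
  (LComp.var (.inr none)).congr fun _ => rfl

theorem LComp.state (Γ : E → Inp ι) (Z : E → ℕ → Fin m → ℕ) (D : E → ℕ → Prop) (j : Fin m) :
    LComp (loopCtx Γ Z D) fun p => Z p.1.1 p.1.2 j :=
  (LComp.var (.inr (some j))).congr fun _ => rfl

theorem LComp.toLoop {n : E → ℕ} {f : (Σ e, Fin (n e)) → ℕ} (h : LComp (finCtx Γ n) f)
    (hD : ∀ e t, D e t → t < n e) :
    LComp (loopCtx Γ Z D) fun p => f ⟨p.1.1, p.1.2, hD _ _ p.2⟩ :=
  h.comap (fun p : {p : E × ℕ // D p.1 p.2} => ⟨p.1.1, p.1.2, hD _ _ p.2⟩)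
    (fun o => o.elim (.inr none) .inl) (fun _ => rfl) fun e i => by cases i <;> rfl

theorem LComp.loop_le {T : E → ℕ} (hT : LComp Γ T)
    (hb : ∀ e, T e ≤ regBound (Γ e).word.length) (h0 : ∀ j, LComp Γ fun e => Z e 0 j)
    (hstep : ∀ j, LComp (loopCtx Γ Z fun e t => t < T e) fun p => Z p.1.1 (p.1.2 + 1) j)
    (j : Fin m) : LComp Γ fun e => Z e (T e) j :=
  LComp.loop hb h0 ((LComp.index _ _ _).eq hT.liftLoop) hstep j

end Loop

theorem LDec.exists {n : E → ℕ} {P : (e : E) → Fin (n e) → Prop} (hn : LComp Γ n)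
    (hb : ∀ e, n e ≤ regBound (Γ e).word.length) (hP : LDec (finCtx Γ n) fun p => P p.1 p.2) :
    LDec Γ fun e => ∃ y, P e y := by
  -- The single loop variable records whether a witness has been met so far.
  let Z : E → ℕ → Fin 1 → ℕ := fun e t _ => if ∃ y : Fin (n e), y.1 < t ∧ P e y then 1 else 0
  have h := LComp.loop_le (Z := Z) hn hb (fun _ => LComp.zero.congr fun e => by simp [Z])
    (fun j => (LComp.ite (LComp.toLoop hP fun _ _ h => h) .one (LComp.state _ _ _ j)).congr
      fun p => by
        obtain ⟨⟨e, t⟩, ht⟩ := p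
        by_cases hp : P e ⟨t, ht⟩
        · have : ∃ y : Fin (n e), y.1 < t + 1 ∧ P e y := ⟨⟨t, ht⟩, Nat.lt_succ_self t, hp⟩
          simp only [hp, if_true, Z, this]
        · simp only [hp, if_false, Z]
          congr 1
          refine propext (exists_congr fun y => and_congr_left fun hy => ?_)
          have : y.1 ≠ t := by rintro rfl; exact hp hy
          omega) 0
  exact h.congr fun e => by simp [Z]

theorem LDec.forall {n : E → ℕ} {P : (e : E) → Fin (n e) → Prop} (hn : LComp Γ n)
    (hb : ∀ e, n e ≤ regBound (Γ e).word.length) (hP : LDec (finCtx Γ n) fun p => P p.1 p.2) :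
    LDec Γ fun e => ∀ y, P e y :=
  (LDec.exists (P := fun e y => ¬ P e y) hn hb hP.not).not.congr fun _ => not_exists_not

theorem LComp.ncard {n : E → ℕ} {P : (e : E) → Fin (n e) → Prop} (hn : LComp Γ n)
    (hb : ∀ e, n e ≤ regBound (Γ e).word.length) (hP : LDec (finCtx Γ n) fun p => P p.1 p.2) :
    LComp Γ fun e => {y | P e y}.ncard := by
  let Z : E → ℕ → Fin 1 → ℕ := fun e t _ => Nat.count (fun k => ∃ h : k < n e, P e ⟨k, h⟩) t
  have h := LComp.loop_le (Z := Z) hn hb (fun _ => LComp.zero.congr fun e => by simp [Z])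
    (fun j => (LComp.ite (LComp.toLoop hP fun _ _ h => h)
      ((LComp.state _ _ _ j).succ fun p => ?_) (LComp.state _ _ _ j)).congr fun p => ?_) 0
  · refine h.congr fun e => ?_
    have hinj : Function.Injective (Fin.val : Fin (n e) → ℕ) := Fin.val_injective
    rw [← Set.ncard_image_of_injective _ hinj]
    simp only [Z, Nat.count_eq_card_filter_range]
    rw [← Set.ncard_coe_finset]
    congr 1
    ext k
    simp only [Finset.coe_filter, Finset.mem_range, Set.mem_ofPred_eq, Set.mem_image]
    constructor
    · rintro ⟨h1, h2, h3⟩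
      exact ⟨_, h3, rfl⟩
    · rintro ⟨y, hy, rfl⟩
      exact ⟨y.2, y.2, hy⟩
  · obtain ⟨⟨e, t⟩, ht⟩ := p
    exact (lt_of_le_of_lt (Nat.count_le _) ht).trans_le (hb e)
  · obtain ⟨⟨e, t⟩, ht⟩ := p
    have ht' : t < n e := ht
    by_cases hp : P e ⟨t, ht⟩
    · simp [Z, Nat.count_succ, hp, ht']
    · simp [Z, Nat.count_succ, hp, ht']

/-- A number is computable if it can be recognized. -/
theorem LComp.search {T : E → ℕ} (hb : ∀ e, T e ≤ regBound (Γ e).word.length)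
    (h : LDec (loopCtx Γ (fun _ t (_ : Fin 1) => t) fun e t => t ≤ T e) fun p => p.1.2 = T p.1.1) :
    LComp Γ T :=
  LComp.loop (Z := fun _ t (_ : Fin 1) => t) hb (fun _ => .zero) h
    (fun _ => (LComp.index _ _ _).succ fun p => p.2.trans_le (hb _)) 0

/-- Centers and children are characterized rather than constructed; being able to recognize them
suffices. -/
theorem LComp.find {n : E → ℕ} {f : (e : E) → Fin (n e)}
    (hb : ∀ e, n e ≤ regBound (Γ e).word.length)
    (h : LDec (finCtx Γ n) fun p => p.2 = f p.1) : LComp Γ fun e => (f e : ℕ) :=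
  LComp.search (fun e => (f e).2.le.trans (hb e))
    (LDec.congr (LComp.toLoop h fun e _ ht => ht.trans_lt (f e).2) fun _ => Fin.ext_iff)

theorem LComp.add {f g : E → ℕ} (hf : LComp Γ f) (hg : LComp Γ g)
    (hb : ∀ e, f e + g e ≤ regBound (Γ e).word.length) : LComp Γ fun e => f e + g e :=
  LComp.loop_le (Z := fun e t (_ : Fin 1) => f e + t) hg (fun e => le_of_add_le_right (hb e))
    (fun _ => hf) (fun j => (LComp.state _ _ _ j).succ fun p => by
      have h1 : p.1.2 < g p.1.1 := p.2
      have h2 := hb p.1.1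
      change f p.1.1 + p.1.2 < regBound (Γ p.1.1).word.length
      omega) 0

theorem LComp.mul {f g : E → ℕ} (hf : LComp Γ f) (hg : LComp Γ g)
    (hb : ∀ e, f e * g e ≤ regBound (Γ e).word.length)
    (hb' : ∀ e, g e ≤ regBound (Γ e).word.length) : LComp Γ fun e => f e * g e :=
  LComp.loop_le (Z := fun e t (_ : Fin 1) => f e * t) hg hb'
    (fun _ => LComp.zero) (fun j => (LComp.add (LComp.state _ _ _ j) hf.liftLoop fun p => by
      exact (Nat.mul_le_mul_left (f p.1.1) (Nat.succ_le_of_lt p.2)).trans (hb p.1.1))) 0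

theorem LComp.lt {f g : E → ℕ} (hf : LComp Γ f) (hg : LComp Γ g)
    (hb : ∀ e, g e ≤ regBound (Γ e).word.length) : LDec Γ fun e => f e < g e :=
  (LDec.exists (P := fun e y => (y : ℕ) = f e) hg hb ((LComp.last Γ g).eq (hf.lift g))).congr
    fun e => ⟨fun ⟨y, hy⟩ => hy ▸ y.2, fun h => ⟨⟨f e, h⟩, rfl⟩⟩

theorem LComp.le {f g : E → ℕ} (hf : LComp Γ f) (hg : LComp Γ g)
    (hb : ∀ e, f e ≤ regBound (Γ e).word.length) : LDec Γ fun e => f e ≤ g e :=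
  (LComp.lt hg hf hb).not.congr fun _ => not_lt

end Search

/-! ### Access to the input graph -/

section Access

open Classical

variable {E ι : Type*}

/-- The input word starts with the adjacency matrix of a tree, and the chosen node is computable. -/
structure Reads (Γ : E → Inp ι) (d : E → PointedGraph) : Prop where
  tree : ∀ e, (d e).graph.IsTree
  word : ∀ e, ∃ l, (Γ e).word = encodeRel (d e).graph.Adj ++ l
  root : LComp Γ fun e => ((d e).node : ℕ)

namespace Reads

variable {Γ : E → Inp ι} {d : E → PointedGraph} (H : Reads Γ d)

include H

theorem comap {E' κ : Type*} {Δ : E' → Inp κ} (φ : E' → E) (ρ : ι → κ)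
    (hw : ∀ e, (Γ (φ e)).word = (Δ e).word) (hr : ∀ e i, (Γ (φ e)).reg i = (Δ e).reg (ρ i)) :
    Reads Δ fun e => d (φ e) where
  tree e := H.tree _
  word e := by rw [← hw]; exact H.word _
  root := H.root.comap φ ρ hw hr

theorem lift (n : E → ℕ) : Reads (finCtx Γ n) fun p => d p.1 :=
  H.comap Sigma.fst some (fun _ => rfl) fun _ _ => rfl

theorem liftLoop {m : ℕ} {Z : E → ℕ → Fin m → ℕ} {D : E → ℕ → Prop} :
    Reads (loopCtx Γ Z D) fun p => d p.1.1 :=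
  H.comap (fun p : {p : E × ℕ // D p.1 p.2} => p.1.1) Sum.inl (fun _ => rfl) fun _ _ => rfl

theorem restrict (P : E → Prop) : Reads (restrict Γ P) fun e => d e.1 :=
  H.comap Subtype.val id (fun _ => rfl) fun _ _ => rfl

theorem mul_le (e : E) : (d e).n * ((d e).n + 1) ≤ (Γ e).word.length := by
  obtain ⟨l, hl⟩ := H.word e
  rw [hl, List.length_append, length_encodeRel]
  exact Nat.le_add_right _ _

theorem le_bound (e : E) : (d e).n ≤ regBound (Γ e).word.length := by
  have := H.mul_le e
  unfold regBound
  nlinarith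

theorem mul_le_bound (e : E) : (d e).n * (d e).n ≤ regBound (Γ e).word.length := by
  have := H.mul_le e
  unfold regBound
  nlinarith

theorem two_mul_le_bound (e : E) : 2 * (d e).n ≤ regBound (Γ e).word.length := by
  have := H.mul_le e
  unfold regBound
  nlinarith [Nat.zero_le ((d e).n)]

omit H in
theorem pos (d : PointedGraph) : 0 < d.n := d.node.pos

/-- The number of nodes is found as the length of the first row: cells `1, …, n` hold bits and cell
`n + 1` the first separator. There is a first row, because the chosen node exists. -/
theorem size : LComp Γ fun e => (d e).n := by
  refine LComp.search H.le_bound ?_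
  let P : InputSymbol Letter → Bool := fun c => match c with
    | .letter none => Bool.true
    | _ => Bool.false
  have hlt : ∀ p : {p : E × ℕ // p.2 ≤ (d p.1).n},
      p.1.2 < regBound (Γ p.1.1).word.length := by
    intro p
    have h1 := p.2
    have h2 := H.mul_le p.1.1
    have h3 := pos (d p.1.1)
    unfold regBound
    nlinarith
  refine (LComp.read ((LComp.index Γ _ _).succ hlt) (fun p => Nat.succ_le_of_lt (hlt p)) P).congr ?_
  rintro ⟨⟨e, t⟩, ht⟩
  obtain ⟨l, hl⟩ := H.word e
  change P (inputCell (Γ e).word (t + 1)) = Bool.true ↔ t = (d e).n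
  rcases Nat.lt_or_eq_of_le ht with h | h
  · have := inputCell_encodeRel (d e).graph.Adj l ⟨0, pos _⟩ ⟨t, h⟩
    simp only [zero_mul, zero_add] at this
    rw [hl, this]
    simpa [P] using h.ne
  · have h' : t = (d e).n := h
    rw [hl, h', inputCell_encodeRel_end _ _ (pos _)]
    simp [P]

theorem forall_node {P : (e : E) → Fin (d e).n → Prop}
    (hP : LDec (finCtx Γ fun e => (d e).n) fun p => P p.1 p.2) : LDec Γ fun e => ∀ y, P e y :=
  LDec.forall H.size H.le_bound hP

variable {u v x c : (e : E) → Fin (d e).n}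

omit H in
theorem eq (hu : LComp Γ fun e => (u e : ℕ)) (hv : LComp Γ fun e => (v e : ℕ)) :
    LDec Γ fun e => u e = v e :=
  (hu.eq hv).congr fun _ => Fin.ext_iff.symm

theorem adj (hu : LComp Γ fun e => (u e : ℕ)) (hv : LComp Γ fun e => (v e : ℕ)) :
    LDec Γ fun e => (d e).graph.Adj (u e) (v e) := by
  let P : InputSymbol Letter → Bool := fun c => match c with
    | .letter (some b) => b
    | _ => Bool.false
  have hcell : ∀ e, (u e : ℕ) * ((d e).n + 1) + v e < (Γ e).word.length := by
    intro e
    have h1 := (u e).2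
    have h2 := (v e).2
    refine lt_of_lt_of_le ?_ (H.mul_le e)
    calc (u e : ℕ) * ((d e).n + 1) + v e < (u e : ℕ) * ((d e).n + 1) + ((d e).n + 1) := by omega
      _ = ((u e : ℕ) + 1) * ((d e).n + 1) := by ring
      _ ≤ _ := Nat.mul_le_mul_right _ h1
  have hcell' : ∀ e, (u e : ℕ) * ((d e).n + 1) + v e < regBound (Γ e).word.length := fun e => by
    have := hcell e
    unfold regBound
    omega
  have hn : ∀ e, (d e).n + 1 ≤ regBound (Γ e).word.length := fun e => by
    have := H.mul_le e
    unfold regBound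
    nlinarith
  have h1 := LComp.mul hu (H.size.succ fun e => hn e) (fun e => by have := hcell' e; omega) hn
  have h2 := h1.add hv fun e => (hcell' e).le
  refine (LComp.read (h2.succ hcell') (fun e => hcell' e) P).congr fun e => ?_
  obtain ⟨l, hl⟩ := H.word e
  rw [hl, inputCell_encodeRel]
  simp [P]

theorem rotate (hu : LComp Γ fun e => (u e : ℕ)) :
    LComp Γ fun e => (finRotate (d e).n (u e) : ℕ) := by
  have hs := hu.succ fun e => (u e).2.trans_le (H.le_bound e)
  refine (LComp.ite (hs.eq H.size) .zero hs).congr fun e => ?_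
  have := Fin.neZero (u e)
  obtain ⟨m, hm⟩ := Nat.exists_eq_succ_of_ne_zero this.out
  have key : ∀ (n : ℕ) (i : Fin n), n = m + 1 →
      (if i.1 + 1 = n then 0 else i.1 + 1) = (finRotate n i : ℕ) := by
    rintro _ i rfl
    rw [coe_finRotate]
    simp only [Fin.ext_iff, Fin.val_last, Nat.add_right_cancel_iff]
  convert key _ (u e) hm

theorem isAncestor (hv : LComp Γ fun e => (v e : ℕ)) (hx : LComp Γ fun e => (x e : ℕ)) :
    LDec Γ fun e => IsAncestor (d e).graph (d e).node (v e) (x e) := by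
  let s : (e : E) → ℕ → Fin (d e).n × Fin (d e).n := fun e t =>
    (tourStep (isolate (d e).graph (v e)))^[t] ((d e).node, (d e).node)
  -- The loop carries the node and the pointer of the traversal, and whether `x` has been visited.
  let Z : E → ℕ → Fin 3 → ℕ := fun e t =>
    ![(s e t).1, (s e t).2, if ∃ k < t, (s e k).1 = x e then 1 else 0]
  have hT := H.size.mul H.size H.mul_le_bound H.le_bound
  have h := LComp.loop_le (Z := Z) hT H.mul_le_bound (fun j => ?_) (fun j => ?_) 2
  · have h' : LDec Γ fun e => ∃ k < (d e).n * (d e).n, (s e k).1 = x e :=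
      LComp.congr h fun e => by simp [Z]
    refine ((Reads.eq hv H.root).or h'.not).congr fun e => ?_
    rw [isAncestor_iff_tour (H.tree e)]
  · fin_cases j
    · exact H.root
    · exact H.root
    · exact LComp.zero.congr fun e => by simp [Z]
  · set D : E → ℕ → Prop := fun e t => t < (d e).n * (d e).n with hD
    have H' : Reads (loopCtx Γ Z D) fun p => d p.1.1 := H.liftLoop
    have h1 : LComp (loopCtx Γ Z D) fun p => ((s p.1.1 p.1.2).1 : ℕ) :=
      LComp.state Γ Z D 0
    have h2 : LComp (loopCtx Γ Z D) fun p => ((s p.1.1 p.1.2).2 : ℕ) :=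
      LComp.state Γ Z D 1
    have h3 : LComp (loopCtx Γ Z D) fun p => Z p.1.1 p.1.2 2 :=
      LComp.state Γ Z D 2
    have hv' : LComp (loopCtx Γ Z D) fun p => (v p.1.1 : ℕ) := hv.liftLoop
    have hx' : LComp (loopCtx Γ Z D) fun p => (x p.1.1 : ℕ) := hx.liftLoop
    have hadj : LDec (loopCtx Γ Z D) fun p =>
        (isolate (d p.1.1).graph (v p.1.1)).Adj (s p.1.1 p.1.2).1 (s p.1.1 p.1.2).2 :=
      (H'.adj h1 h2).and ((Reads.eq h1 hv').not.and (Reads.eq h2 hv').not)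
    have hs : ∀ e t, s e (t + 1) = tourStep (isolate (d e).graph (v e)) (s e t) :=
      fun e t => Function.iterate_succ_apply' _ _ _
    fin_cases j
    · refine (LComp.ite hadj h2 h1).congr fun p => ?_
      change _ = ((s p.1.1 (p.1.2 + 1)).1 : ℕ)
      rw [hs, tourStep]
      split_ifs <;> rfl
    · refine (LComp.ite hadj (H'.rotate h1) (H'.rotate h2)).congr fun p => ?_
      change _ = ((s p.1.1 (p.1.2 + 1)).2 : ℕ)
      rw [hs, tourStep]
      split_ifs <;> rfl
    · refine (LComp.ite (Reads.eq h1 hx') .one h3).congr fun p => ?_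
      change _ = if ∃ k < p.1.2 + 1, (s p.1.1 k).1 = x p.1.1 then 1 else 0
      by_cases hp : (s p.1.1 p.1.2).1 = x p.1.1
      · rw [if_pos hp, if_pos ⟨_, Nat.lt_succ_self _, hp⟩]
      · rw [if_neg hp]
        change (if ∃ k < p.1.2, (s p.1.1 k).1 = x p.1.1 then 1 else 0) = _
        congr 1
        refine propext (exists_congr fun k => and_congr_left fun hk => ?_)
        have : k ≠ p.1.2 := by rintro rfl; exact hp hk
        omega

end Reads

end Access

/-! ### Computation of the working tree -/

section Construction

/-- Both cases are merged into one formula without pattern matching on `w`. The default `v` in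
`w.getD v` is arbitrary: it occurs only beside `w ≠ none`. -/
theorem isCenter_iff {V : Type*} [Finite V] [LinearOrder V] {S : SimpleGraph V} {r : V}
    (hS : S.IsTree) {v c : V} {w : Option V} (hv : IsPieceIndex S r v w) :
    IsCenter S r v w c ↔
      (w = none ∧ IsBalancedNode S (piece S r v none) c ∧
        ∀ x, IsBalancedNode S (piece S r v none) x → c ≤ x) ∨
      (w ≠ none ∧ IsAncestor S r v c ∧ IsAncestor S r c (w.getD v) ∧ c ≠ w.getD v ∧
        (∀ x, IsAncestor S r c x → x ≠ c → IsAncestor S r x (w.getD v) →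
          2 * (piece S r x w).ncard ≤ (piece S r v w).ncard) ∧
        (c = v ∨ ¬ 2 * (piece S r c w).ncard ≤ (piece S r v w).ncard)) := by
  cases w with
  | none => simp [IsCenter, IsLeast, mem_lowerBounds]
  | some w =>
    rw [isCenter_some_iff hS (hv w rfl)]
    simp

open Classical

/-- The number which represents a node or its absence. -/
def optCode {n : ℕ} (o : Option (Fin n)) : ℕ := o.elim n Fin.val

theorem optCode_eq_iff {n : ℕ} (o : Option (Fin n)) : optCode o = n ↔ o = none := by
  cases o with
  | none => simp [optCode]
  | some i => simpa [optCode] using i.2.ne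

theorem optCode_eq_val_iff {n : ℕ} (o : Option (Fin n)) (i : Fin n) :
    optCode o = i ↔ o = some i := by
  cases o with
  | none => simpa [optCode] using i.2.ne'
  | some j => simp [optCode, Fin.ext_iff]

namespace Reads

variable {E ι : Type*} {Γ : E → Inp ι} {d : E → PointedGraph} (H : Reads Γ d)
  {u v x c : (e : E) → Fin (d e).n} {w : (e : E) → Option (Fin (d e).n)}

include H

theorem eq_none (hw : LComp Γ fun e => optCode (w e)) : LDec Γ fun e => w e = none :=
  (hw.eq H.size).congr fun _ => optCode_eq_iff _

theorem getD (hw : LComp Γ fun e => optCode (w e)) (hv : LComp Γ fun e => (v e : ℕ)) :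
    LComp Γ fun e => ((w e).getD (v e) : ℕ) :=
  (LComp.ite (H.eq_none hw) hv hw).congr fun e => by cases h : w e <;> simp [optCode]

theorem mem_piece (hv : LComp Γ fun e => (v e : ℕ)) (hw : LComp Γ fun e => optCode (w e))
    (hx : LComp Γ fun e => (x e : ℕ)) :
    LDec Γ fun e => x e ∈ piece (d e).graph (d e).node (v e) (w e) :=
  ((H.isAncestor hv hx).and ((H.eq_none hw).or (H.isAncestor (H.getD hw hv) hx).not)).congr
    fun e => by cases h : w e <;> simp [piece]

theorem ncard_piece (hv : LComp Γ fun e => (v e : ℕ)) (hw : LComp Γ fun e => optCode (w e)) :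
    LComp Γ fun e => (piece (d e).graph (d e).node (v e) (w e)).ncard :=
  LComp.ncard (P := fun e y => y ∈ piece (d e).graph (d e).node (v e) (w e)) H.size H.le_bound
    ((H.lift fun e => (d e).n).mem_piece (x := fun p => p.2) (hv.lift _) (hw.lift _) (LComp.last Γ _))

theorem two_mul_le {v' : (e : E) → Fin (d e).n} {w' : (e : E) → Option (Fin (d e).n)}
    (hv : LComp Γ fun e => (v e : ℕ)) (hw : LComp Γ fun e => optCode (w e))
    (hv' : LComp Γ fun e => (v' e : ℕ)) (hw' : LComp Γ fun e => optCode (w' e)) :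
    LDec Γ fun e => 2 * (piece (d e).graph (d e).node (v e) (w e)).ncard ≤
      (piece (d e).graph (d e).node (v' e) (w' e)).ncard := by
  have hb : ∀ e, 2 * (piece (d e).graph (d e).node (v e) (w e)).ncard ≤
      regBound (Γ e).word.length := fun e => by
    have := Set.ncard_le_card (piece (d e).graph (d e).node (v e) (w e))
    rw [Nat.card_eq_fintype_card, Fintype.card_fin] at this
    exact (Nat.mul_le_mul_left 2 this).trans (H.two_mul_le_bound e)
  have h := H.ncard_piece hv hw
  have h2 : LComp Γ fun e => 2 * (piece (d e).graph (d e).node (v e) (w e)).ncard :=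
    (h.add h fun e => by have := hb e; omega).congr fun e => (two_mul _).symm
  exact h2.le (H.ncard_piece hv' hw') hb

theorem isBalancedNode (hv : LComp Γ fun e => (v e : ℕ)) (hc : LComp Γ fun e => (c e : ℕ)) :
    LDec Γ fun e => IsBalancedNode (d e).graph (piece (d e).graph (d e).node (v e) none) (c e) := by
  have hn : LComp Γ fun e => optCode (none : Option (Fin (d e).n)) := H.size
  have hsc : LComp Γ fun e => optCode (some (c e)) := hc
  have hl := LComp.last Γ fun e => (d e).n
  refine ((H.isAncestor hv hc).and ((H.two_mul_le (w := fun e => some (c e)) hv hsc hv hn).and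
    (H.forall_node (P := fun e x => IsAncestor (d e).graph (d e).node (c e) x → x ≠ c e →
      2 * (piece (d e).graph (d e).node x none).ncard ≤
        (piece (d e).graph (d e).node (v e) none).ncard) ?_))).congr
      fun e => (isBalancedNode_iff (H.tree e)).symm
  exact ((H.lift fun e => (d e).n).isAncestor (x := fun p => p.2) (hc.lift _) hl).imp
    ((Reads.eq (u := fun p => p.2) hl (hc.lift _)).not.imp
      ((H.lift fun e => (d e).n).two_mul_le (v := fun p => p.2) (w := fun _ => none) (w' := fun _ => none)
        hl (hn.lift _) (hv.lift _) (hn.lift _)))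

theorem isCenter (hp : ∀ e, IsPieceIndex (d e).graph (d e).node (v e) (w e))
    (hv : LComp Γ fun e => (v e : ℕ)) (hw : LComp Γ fun e => optCode (w e))
    (hc : LComp Γ fun e => (c e : ℕ)) :
    LDec Γ fun e => IsCenter (d e).graph (d e).node (v e) (w e) (c e) := by
  have hl := LComp.last Γ fun e => (d e).n
  have hb := H.getD hw hv
  refine LDec.congr (LDec.or ?_ ?_) fun e => (isCenter_iff (H.tree e) (hp e)).symm
  · refine (H.eq_none hw).and ((H.isBalancedNode hv hc).and (H.forall_node
      (P := fun e x => IsBalancedNode (d e).graph (piece (d e).graph (d e).node (v e) none) x →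
        c e ≤ x) ?_))
    exact ((H.lift fun e => (d e).n).isBalancedNode (c := fun p => p.2) (hv.lift _) hl).imp
      ((LComp.le (hc.lift _) hl fun p => (c p.1).2.le.trans (H.le_bound p.1)).congr
        fun p => Fin.le_def.symm)
  · refine (H.eq_none hw).not.and ((H.isAncestor hv hc).and ((H.isAncestor hc hb).and
      ((Reads.eq hc hb).not.and (LDec.and (H.forall_node (P := fun e x =>
        IsAncestor (d e).graph (d e).node (c e) x → x ≠ c e →
        IsAncestor (d e).graph (d e).node x ((w e).getD (v e)) →
          2 * (piece (d e).graph (d e).node x (w e)).ncard ≤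
            (piece (d e).graph (d e).node (v e) (w e)).ncard) ?_)
        ((Reads.eq hc hv).or (H.two_mul_le hc hw hv hw).not)))))
    exact ((H.lift fun e => (d e).n).isAncestor (x := fun p => p.2) (hc.lift _) hl).imp
      ((Reads.eq (u := fun p => p.2) hl (hc.lift _)).not.imp
      (((H.lift fun e => (d e).n).isAncestor (v := fun p => p.2) hl (hb.lift _)).imp
      ((H.lift fun e => (d e).n).two_mul_le (v := fun p => p.2) (w := fun p => w p.1) (w' := fun p => w p.1)
        hl (hw.lift _) (hv.lift _) (hw.lift _))))

theorem center (hp : ∀ e, IsProper (d e).graph (d e).node (v e) (w e))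
    (hv : LComp Γ fun e => (v e : ℕ)) (hw : LComp Γ fun e => optCode (w e)) :
    LComp Γ fun e =>
      ((WorkingTree.center (d e).graph (d e).node (v e) (w e) : Fin (d e).n) : ℕ) :=
  LComp.find (f := fun e => WorkingTree.center (d e).graph (d e).node (v e) (w e)) H.le_bound
    (((H.lift fun e => (d e).n).isCenter (v := fun p => v p.1) (w := fun p => w p.1)
    (c := fun p => p.2) (fun p => (hp p.1).1) (hv.lift _) (hw.lift _) (LComp.last Γ _)).congr
    fun p => by rw [← (hp p.1).center_eq_iff (H.tree p.1), eq_comm])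

theorem child (h : ∀ e, IsAncestor (d e).graph (d e).node (c e) (x e)) (hne : ∀ e, x e ≠ c e)
    (hc : LComp Γ fun e => (c e : ℕ)) (hx : LComp Γ fun e => (x e : ℕ)) :
    LComp Γ fun e => ((WorkingTree.child (d e).graph (d e).node (c e) (x e) : Fin (d e).n) : ℕ) := by
  have hl := LComp.last Γ fun e => (d e).n
  refine LComp.find (f := fun e => WorkingTree.child (d e).graph (d e).node (c e) (x e))
    H.le_bound ((((H.lift fun e => (d e).n).adj (v := fun p => p.2) (hc.lift _) hl).and
    (((H.lift fun e => (d e).n).isAncestor (x := fun p => p.2) (hc.lift _) hl).and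
    ((H.lift fun e => (d e).n).isAncestor (v := fun p => p.2) hl (hx.lift _)))).congr fun p => ?_)
  obtain ⟨h1, h2, h3⟩ := child_spec (H.tree p.1) (h p.1) (hne p.1)
  constructor
  · rintro ⟨k1, k2, k3⟩
    have := child_isAncestor (H.tree p.1) (h p.1) (hne p.1) k2 k1.ne' k3
    rcases k2.of_adj (H.tree p.1) k1 this with e | e
    · exact e.symm
    · exact absurd (e.antisymm (H.tree p.1) h2) (child_ne (H.tree p.1) (h p.1) (hne p.1))
  · intro e
    rw [e]
    exact ⟨h1, h2, h3⟩

end Reads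

end Construction

/-! ### Writing the parent relation -/

section Output

open Classical

namespace Reads

variable {E ι : Type*} {Γ : E → Inp ι} {d : E → PointedGraph} (H : Reads Γ d)
  {v x y : (e : E) → Fin (d e).n} {w : (e : E) → Option (Fin (d e).n)}

include H

theorem lowerEnd (hw : LComp Γ fun e => optCode (w e)) (hy : LComp Γ fun e => (y e : ℕ)) :
    LComp Γ fun e => optCode (WorkingTree.lowerEnd (d e).graph (d e).node (w e) (y e)) := by
  refine (LComp.ite ((H.eq_none hw).or (H.isAncestor hy (H.getD hw hy))) hw H.size).congr
    fun e => ?_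
  cases h : w e with
  | none => simp [WorkingTree.lowerEnd]
  | some w' =>
    simp only [WorkingTree.lowerEnd, IsPieceIndex, optCode, reduceCtorEq, false_or,
      Option.getD_some, Option.mem_def, Option.some.injEq, forall_eq', Option.elim_some]
    split_ifs <;> rfl

theorem nextOf (hp : ∀ e, IsProper (d e).graph (d e).node (v e) (w e))
    (hne : ∀ e, x e ≠ WorkingTree.center (d e).graph (d e).node (v e) (w e))
    (hv : LComp Γ fun e => (v e : ℕ)) (hw : LComp Γ fun e => optCode (w e))
    (hx : LComp Γ fun e => (x e : ℕ)) :
    (LComp Γ fun e =>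
      (((WorkingTree.nextOf (d e).graph (d e).node (v e) (w e) (x e)).1 : Fin (d e).n) : ℕ)) ∧
    LComp Γ fun e =>
      optCode (WorkingTree.nextOf (d e).graph (d e).node (v e) (w e) (x e)).2 := by
  have hc := H.center hp hv hw
  have hdec := H.isAncestor hc hx
  have hch := (H.restrict _).child (c := fun e : {e // IsAncestor (d e).graph (d e).node
    (WorkingTree.center (d e).graph (d e).node (v e) (w e)) (x e)} =>
      WorkingTree.center (d e.1).graph (d e.1).node (v e.1) (w e.1)) (x := fun e => x e.1)
    (fun e => e.2) (fun e => hne e.1) (hc.restrict _) (hx.restrict _)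
  constructor
  · refine hdec.cases (hch.congr fun e => ?_) ((hv.restrict _).congr fun e => ?_)
    · rw [WorkingTree.nextOf, nextPiece, if_pos e.2]
    · rw [WorkingTree.nextOf, nextPiece, if_neg e.2]
  · refine hdec.cases (((H.restrict _).lowerEnd (w := fun e => w e.1) (hw.restrict _) hch).congr
      fun e => ?_) ((hc.restrict _).congr fun e => ?_)
    · rw [WorkingTree.nextOf, nextPiece, if_pos e.2]
    · rw [WorkingTree.nextOf, nextPiece, if_neg e.2]
      rfl

theorem trace (hx : LComp Γ fun e => (x e : ℕ)) : LComp Γ fun e =>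
    optCode (WorkingTree.trace (d e).graph (d e).node (x e) (d e).n).1 := by
  let s : (e : E) → ℕ → Option (Fin (d e).n) × Fin (d e).n × Option (Fin (d e).n) :=
    fun e t => WorkingTree.trace (d e).graph (d e).node (x e) t
  -- Three registers describe the stage of the recursion that contains `x`: the previous center and
  -- the two ends of the component.
  let Z : E → ℕ → Fin 3 → ℕ := fun e t => ![optCode (s e t).1, (s e t).2.1, optCode (s e t).2.2]
  refine LComp.loop_le (Z := Z) H.size H.le_bound (fun j => ?_) (fun j => ?_) 0
  · fin_cases j
    · exact H.size
    · exact H.root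
    · exact H.size
  · set D : E → ℕ → Prop := fun e t => t < (d e).n with hD
    have H' : Reads (loopCtx Γ Z D) fun p => d p.1.1 := H.liftLoop
    have hv : LComp (loopCtx Γ Z D) fun p => ((s p.1.1 p.1.2).2.1 : ℕ) := LComp.state Γ Z D 1
    have hw : LComp (loopCtx Γ Z D) fun p => optCode (s p.1.1 p.1.2).2.2 := LComp.state Γ Z D 2
    have hx' : LComp (loopCtx Γ Z D) fun p => (x p.1.1 : ℕ) := hx.liftLoop
    have hp : ∀ p : {p : E × ℕ // D p.1 p.2},
        IsProper (d p.1.1).graph (d p.1.1).node (s p.1.1 p.1.2).2.1 (s p.1.1 p.1.2).2.2 :=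
      fun p => trace_isProper (H.tree _) _ _
    have hc : LComp (loopCtx Γ Z D) fun p =>
        ((traceCenter (d p.1.1).graph (d p.1.1).node (x p.1.1) p.1.2 : Fin _) : ℕ) :=
      H'.center hp hv hw
    have hdec : LDec (loopCtx Γ Z D) fun p =>
        x p.1.1 = traceCenter (d p.1.1).graph (d p.1.1).node (x p.1.1) p.1.2 := Reads.eq hx' hc
    have hnext := (H'.restrict _).nextOf (fun q => hp q.1)
      (x := fun q : {p : {p : E × ℕ // D p.1 p.2} //
        ¬ x p.1.1 = traceCenter (d p.1.1).graph (d p.1.1).node (x p.1.1) p.1.2} => x q.1.1.1)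
      (fun q => q.2) (hv.restrict _) (hw.restrict _) (hx'.restrict _)
    refine hdec.cases (((LComp.state Γ Z D j).restrict _).congr fun q => ?_) ?_
    · have : s q.1.1.1 (q.1.1.2 + 1) = s q.1.1.1 q.1.1.2 := trace_succ_of_eq q.2
      simp only [Z, this]
    · have hs : ∀ q : {p : {p : E × ℕ // D p.1 p.2} //
          ¬ x p.1.1 = traceCenter (d p.1.1).graph (d p.1.1).node (x p.1.1) p.1.2},
          s q.1.1.1 (q.1.1.2 + 1) = _ := fun q => trace_succ_of_ne q.2
      fin_cases j
      · refine (hc.restrict _).congr fun q => ?_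
        change _ = optCode (s q.1.1.1 (q.1.1.2 + 1)).1
        rw [hs]
        rfl
      · refine hnext.1.congr fun q => ?_
        change _ = ((s q.1.1.1 (q.1.1.2 + 1)).2.1 : ℕ)
        rw [hs]
      · refine hnext.2.congr fun q => ?_
        change _ = optCode (s q.1.1.1 (q.1.1.2 + 1)).2.2
        rw [hs]

theorem parent (hx : LComp Γ fun e => (x e : ℕ)) (hy : LComp Γ fun e => (y e : ℕ)) :
    LDec Γ fun e => Parent (d e).graph (d e).node (x e) (y e) :=
  ((H.trace hx).eq hy).congr fun e => by
    rw [parent_iff (H.tree e), Nat.card_eq_fintype_card, Fintype.card_fin, optCode_eq_val_iff]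

theorem encodeRel : LOut Γ fun e =>
    WorkingTree.encodeRel (Parent (d e).graph (d e).node) := by
  refine LOut.flatMap H.size H.le_bound (LOut.append (g := fun p : Σ e, Fin (d e).n =>
    (List.finRange (d p.1).n).map fun j =>
      some (decide (Parent (d p.1).graph (d p.1).node p.2 j))) ?_ (LOut.single none))
  have H₁ := H.lift fun e => (d e).n
  have hl := LComp.last Γ fun e => (d e).n
  have hg := LOut.flatMap H₁.size H₁.le_bound
    (g := fun p j => if Parent (d p.1).graph (d p.1).node p.2 j then [some true] else [some false])
    (LOut.ite ((H₁.lift fun p => (d p.1).n).parent (x := fun q => q.1.2) (y := fun q => q.2)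
      (hl.lift _) (LComp.last _ _)) (LOut.single _) (LOut.single _))
  convert hg using 2 with p
  rw [List.map_eq_flatMap]
  congr 1
  ext1 j
  split_ifs with h <;> simp [h]

end Reads

theorem inputCell_encodePointed {n : ℕ} (S : SimpleGraph (Fin n)) (r y : Fin n) :
    inputCell (encodePointed S r) (n * (n + 1) + y + 1) = .letter (some (decide (y = r))) := by
  rw [inputCell, encodePointed, List.getElem?_append_right (by rw [length_encodeRel]; omega),
    length_encodeRel, Nat.add_sub_cancel_left, getElem?_encodeRow]
  simp

theorem reads_encodePointed : Reads (fun d : {d : PointedGraph // d.graph.IsTree} =>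
    (⟨encodePointed d.1.graph d.1.node, Empty.elim⟩ : Inp Empty)) fun d => d.1 := by
  set Γ : {d : PointedGraph // d.graph.IsTree} → Inp Empty :=
    fun d => ⟨encodePointed d.1.graph d.1.node, Empty.elim⟩ with hΓ
  -- To locate the row that marks the root, the number of nodes must be known first. It is obtained
  -- from the same word with node `0` as a provisional root.
  have H₀ : Reads Γ fun d => ⟨d.1.n, d.1.graph, ⟨0, d.1.node.pos⟩⟩ :=
    ⟨fun d => d.2, fun d => ⟨_, rfl⟩, LComp.zero⟩
  have hn : LComp Γ fun d => d.1.n := H₀.size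
  refine ⟨fun d => d.2, fun d => ⟨_, rfl⟩, LComp.find H₀.le_bound ?_⟩
  have hlen : ∀ d, (Γ d).word.length = d.1.n * (d.1.n + 1) + (d.1.n + 1) := fun d => by
    change (encodePointed _ _).length = _
    rw [encodePointed, List.length_append, length_encodeRel, length_encodeRow]
  have hbound : ∀ p : Σ d : {d : PointedGraph // d.graph.IsTree}, Fin d.1.n,
      p.1.1.n * (p.1.1.n + 1) + p.2 < regBound (Γ p.1).word.length := fun p => by
    have := p.2.2
    rw [hlen, regBound]
    omega
  have hm : LComp Γ fun d => d.1.n * (d.1.n + 1) :=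
    hn.mul (hn.succ fun d => by rw [hlen, regBound]; nlinarith)
      (fun d => by rw [hlen, regBound]; nlinarith) fun d => by rw [hlen, regBound]; nlinarith
  have hcell := ((hm.lift fun d => d.1.n).add (LComp.last Γ _) fun p => (hbound p).le).succ hbound
  let P : InputSymbol Letter → Bool := fun c => match c with
    | .letter (some b) => b
    | _ => false
  refine (LComp.read hcell (fun p => hbound p) P).congr fun p => ?_
  change P (inputCell (encodePointed p.1.1.graph p.1.1.node) _) = true ↔ _
  rw [inputCell_encodePointed]
  simp [P]

theorem reads_encodeRel :
    Reads (fun d : {d : PointedGraph // d.graph.IsTree ∧ ∀ x, d.node ≤ x} =>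
      (⟨encodeRel d.1.graph.Adj, Empty.elim⟩ : Inp Empty)) fun d => d.1 where
  tree d := d.2.1
  word _ := ⟨[], (List.append_nil _).symm⟩
  root := LComp.zero.congr fun d => (Nat.le_zero.1 (Fin.le_def.1 (d.2.2 ⟨0, d.1.node.pos⟩))).symm

end Output

end WorkingTree

theorem mainTheorem6 :
    -- the recursive construction is well defined and all its components have the form `S_{v,w}`
    (∀ (n : ℕ) (S : SimpleGraph (Fin n)) (r : Fin n), S.IsTree →
      ∀ (q : Option (Fin n)) (v : Fin n) (w : Option (Fin n)), WorkingTree.Stage S r q v w →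
        (∃! c, WorkingTree.IsCenter S r v w c) ∧
          ∀ c, WorkingTree.IsCenter S r v w c → ∀ B : Set (Fin n),
            WorkingTree.IsComponentAfterRemoval S (WorkingTree.piece S r v w) c B →
              ∃ v₁ w₁, WorkingTree.IsPieceIndex S r v₁ w₁ ∧ B = WorkingTree.piece S r v₁ w₁) ∧
    -- the working tree is a rooted tree on the same nodes
    (∀ (n : ℕ) (S : SimpleGraph (Fin n)) (r : Fin n), S.IsTree →
      ∃ t, WorkingTree.IsRoot S r t ∧ WorkingTree.IsRootedTree (WorkingTree.Parent S r) t) ∧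
    -- its depth is `O(log n)`
    (∃ C : ℝ, ∀ (n : ℕ) (S : SimpleGraph (Fin n)) (r : Fin n), S.IsTree →
      ∀ s : RelSeries {e : Fin n × Fin n | WorkingTree.Parent S r e.1 e.2},
        (s.length : ℝ) ≤ C * Real.log n) ∧
    -- least common ancestors lie on the paths of `S`
    (∀ (n : ℕ) (S : SimpleGraph (Fin n)) (r : Fin n), S.IsTree → ∀ u v : Fin n,
      (∃! a, WorkingTree.IsLCA (WorkingTree.Parent S r) u v a) ∧
        ∀ a, WorkingTree.IsLCA (WorkingTree.Parent S r) u v a → WorkingTree.OnPath S u v a) ∧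
    -- it can be constructed in log-space from `S` and `r`
    WorkingTree.LogspaceComputable
      (fun d : WorkingTree.PointedGraph => d.graph.IsTree)
      (fun d => WorkingTree.encodePointed d.graph d.node)
      (fun d => WorkingTree.encodeRel (WorkingTree.Parent d.graph d.node)) ∧
    -- it can be constructed in log-space from `S` alone, with the first node taken as `r`
    WorkingTree.LogspaceComputable
      (fun d : WorkingTree.PointedGraph => d.graph.IsTree ∧ ∀ x, d.node ≤ x)
      (fun d => WorkingTree.encodeRel d.graph.Adj)
      (fun d => WorkingTree.encodeRel (WorkingTree.Parent d.graph d.node)) := by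
  -- The constant converts the bound `3 log₂ n` to natural logarithms. It covers `n = 1` too, where
  -- both sides vanish.
  refine ⟨fun n S r hS q v w h => ?_, fun n S r hS => ?_, ⟨3 / Real.log 2, fun n S r hS s => ?_⟩,
    fun n S r hS u v => ?_, WorkingTree.reads_encodePointed.encodeRel.logspaceComputable,
    WorkingTree.reads_encodeRel.encodeRel.logspaceComputable⟩
  · have hp := h.isProper hS
    refine ⟨hp.existsUnique_isCenter hS, fun c hc B hB => ?_⟩
    obtain ⟨x, hx⟩ := hB.nonempty
    obtain ⟨hcv, hcw⟩ := hc.mem hS hp.1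
    have hx' := hB.subset hx
    exact ⟨_, _, (WorkingTree.nextPiece_spec hS hcv hcw hx'.1 hx'.2).1,
      hB.eq_nextPiece hS hcv hcw hx⟩
  · exact WorkingTree.isRootedTree_parent hS
  · have h1 : s.length ≤ 3 * Nat.log 2 n := by
      simpa using WorkingTree.relSeries_length_le hS s
    have h2 := Real.natLog_le_logb n 2
    rw [Real.logb] at h2
    push_cast at h2
    calc (s.length : ℝ) ≤ 3 * (Nat.log 2 n : ℝ) := by exact_mod_cast h1
      _ ≤ 3 * (Real.log n / Real.log 2) := by gcongr
      _ = 3 / Real.log 2 * Real.log n := by ring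
  · obtain ⟨a, ha⟩ := WorkingTree.exists_isLCA hS u v
    exact ⟨⟨a, ha, fun b hb => hb.unique_of_isTree hS ha⟩, fun a ha => ha.onPath hS⟩
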